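/- **Setting.** Let $G$ be a Lie group acting smoothly, freely and properly on a finite-dimensional manifold $Q$, let $\pi:Q\to Q/G$ be the resulting principal bundle with vertical distribution $V\pi=\ker T\pi$, and let $m=\dim Q/G$. Let $g$ be a $G$-invariant Riemannian metric on $Q$ (the kinetic energy) and $\mathcal D$ a smooth $G$-invariant distribution with $TQ=\mathcal D\oplus V\pi$ (a purely kinetic Chaplygin system). Write $X^H$ for the horizontal lift to $\mathcal D$, $\mathcal R(X,Y)=\tilde{\mathcal Q}[X^H,Y^H]$ where $\tilde{\mathcal Q}:TQ\to V\pi$ is the projection along $\mathcal D$, and $\mathcal P:TQ\to\mathcal D$ for the $g$-orthogonal projection. On $Q/G$ let $g^{red}(X,Y)=g(X^H,Y^H)$, let $\mathcal T(X,Y)=T\pi\,\mathcal P\,\mathcal R(X,Y)$ be the gyroscopic tensor, and let $\beta(Y)=\sum_a\langle Z^a,\mathcal T(Z_a,Y)\rangle$, for a local frame $\{Z_a\}$ with dual frame $\{Z^a\}$. For a velocity $u$ and tangent vectors $X,Y,Z$ of $Q/G$ put $\kappa(u,X,Y)=g(u^H,\mathcal R(X,Y))$ and define $$(\theta_l)_u(X)=g^{red}(u,X),\qquad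 \Xi^G_u(X,Y)=-\kappa(u,X,Y),$$ $$\gamma^G_u(X,Y)=\tfrac13\big(-\kappa(X,u,Y)+\kappa(Y,u,X)-2\kappa(u,X,Y)\big),$$ $$\Theta^G(X,Y,Z)=-\tfrac19\big(\kappa(X,Y,Z)+\kappa(Y,Z,X)+\kappa(Z,X,Y)\big).$$ The reduced equations of motion on $Q/G$ are those of the vector field $\Gamma^{red}$ on $T(Q/G)$ given in coordinates by $$g_{cd}\big(\ddot q^d+\Gamma^{d,red}_{ab}\dot q^a\dot q^b\big)=g_{db}R^d_{ac}\dot q^a\dot q^b,$$ where $g_{ab}$ and $\Gamma^{d,red}_{ab}$ are the components and Christoffel symbols of $g^{red}$ and $\mathcal T(\partial_a,\partial_c)=R^d_{ac}\partial_d$. **Statement.** Assume $m\le 2$ and let $W\subseteq Q/G$ be open (for instance $W=Q/G$). Then the following statements are equivalent. 1. $d\beta=0$ on $W$. 2. The system is locally $\varphi$-simple on $W$: every point of $W$ has an open neighbourhood $U$ with a smooth function $\varphi$ on $U$ such that $\mathcal T(X,Y)=-d\varphi(X)\,Y+d\varphi(Y)\,X$ on $U$. 3. $d\beta=0$ and $\beta\wedge\theta_l=(m-1)\,\Xi^G$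 on $W$. 4. $d\beta=0$, $\beta\wedge\theta_l=(m-1)\,\gamma^G$ and $\Theta^G=0$ on $W$. 5. Locally on $W$ there is a $(V\pi,\mathcal D)$-orthogonal projective geodesic extension by a $\mathcal D$-conformal modification: every point of $W$ has an open neighbourhood $U$ with a smooth function $f$ on $U$, a $G$-invariant Riemannian metric $\bar g$ on $\pi^{-1}(U)$ with $\bar g|_{\mathcal D\times\mathcal D}=g|_{\mathcal D\times\mathcal D}$ and $\bar g|_{V\pi\times\mathcal D}=0$, and a smooth fibrewise linear function $P$ on $TQ|_{\pi^{-1}(U)}$ such that, for $\hat g=e^{2(f\circ\pi)}\bar g$, the nonholonomic vector field of $(g,\mathcal D)$ equals $\Gamma_{\hat g}+P\Delta$ on $\mathcal D$. Here $\Gamma_{\hat g}$ is the geodesic spray of $\hat g$ and $\Delta$ the Liouville vector field; explicitly, $\mathcal P\nabla_XX=\hat\nabla_XX-P(X)X$ for every local section $X$ of $\mathcal D$, with $\nabla,\hat\nabla$ the Levi-Civita connections of $g,\hat g$. 6. $d\beta=0$ and $\beta\wedge\theta_l=(m-1)\,\gamma^G$ on $W$. 7. Locally on $W$ the reduced equations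 have an invariant volume form: every point of $W$ has an open neighbourhood $U$ such that $TU$ carries a volume form $\sigma$ with $\mathcal L_{\Gamma^{red}}\sigma=0$. 8. As 7, with $\sigma$ basic, i.e. with density independent of the velocities in the coordinates induced on $TU$ by a chart of $U$. So, when $\dim Q/G\le 2$, $\varphi$-simplicity, the existence of such a $\mathcal D$-conformal projective geodesic extension and the existence of an invariant volume form are locally all equivalent to the single condition $d\beta=0$. -/

import Mathlib

open Set Filter Topology Bundle
open scoped Manifold ContDiff

/-! ## Chaplygin systems -/

/-- A purely kinetic Chaplygin system.  The Lie group `G` acts smoothly, freely and properly on the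
configuration manifold `Q`, and `proj : Q → M` is the quotient map of the principal bundle
`Q → Q/G = M` (a smooth surjective submersion whose fibres are the `G`-orbits).  The kinetic energy
metric and the constraint distribution are `G`-invariant, and the distribution is horizontal:
it is a smooth distribution complementary to the vertical distribution `ker (T proj)`. -/
structure ChaplyginSystem
    (EQ : Type*) [NormedAddCommGroup EQ] [NormedSpace ℝ EQ] [FiniteDimensional ℝ EQ]
    (Q : Type*) [TopologicalSpace Q] [ChartedSpace EQ Q] [IsManifold 𝓘(ℝ, EQ) ∞ Q]
    (EG : Type*) [NormedAddCommGroup EG] [NormedSpace ℝ EG] [FiniteDimensional ℝ EG]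
    (G : Type*) [TopologicalSpace G] [ChartedSpace EG G] [Group G] [LieGroup 𝓘(ℝ, EG) ∞ G]
    [MulAction G Q] [ContMDiffSMul 𝓘(ℝ, EG) 𝓘(ℝ, EQ) ∞ G Q] [ProperSMul G Q]
    (EM : Type*) [NormedAddCommGroup EM] [NormedSpace ℝ EM] [FiniteDimensional ℝ EM]
    (M : Type*) [TopologicalSpace M] [ChartedSpace EM M] [IsManifold 𝓘(ℝ, EM) ∞ M] where
  proj : Q → M
  proj_smooth : ContMDiff 𝓘(ℝ, EQ) 𝓘(ℝ, EM) ∞ proj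
  proj_surjective : Function.Surjective proj
  proj_submersion : ∀ q, Function.Surjective (mfderiv 𝓘(ℝ, EQ) 𝓘(ℝ, EM) proj q)
  proj_eq_iff : ∀ q q' : Q, proj q = proj q' ↔ ∃ h : G, h • q = q'
  free : ∀ (h : G) (q : Q), h • q = q → h = 1
  metric : ContMDiffRiemannianMetric 𝓘(ℝ, EQ) ∞ EQ (fun q : Q => TangentSpace 𝓘(ℝ, EQ) q)
  metric_invariant : ∀ (h : G) (q : Q) (v w : TangentSpace 𝓘(ℝ, EQ) q),
    metric.inner (h • q) (mfderiv 𝓘(ℝ, EQ) 𝓘(ℝ, EQ) (fun x : Q => h • x) q v)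
      (mfderiv 𝓘(ℝ, EQ) 𝓘(ℝ, EQ) (fun x : Q => h • x) q w) = metric.inner q v w
  dist : (q : Q) → Submodule ℝ (TangentSpace 𝓘(ℝ, EQ) q)
  dist_smooth : ∀ q₀ : Q, ∃ N ∈ 𝓝 q₀,
    ∃ X : Fin (Module.finrank ℝ EM) → (q : Q) → TangentSpace 𝓘(ℝ, EQ) q,
      (∀ a, ContMDiffOn 𝓘(ℝ, EQ) 𝓘(ℝ, EQ).tangent ∞
        (fun q => (⟨q, X a q⟩ : TangentBundle 𝓘(ℝ, EQ) Q)) N) ∧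
      ∀ q ∈ N, dist q = Submodule.span ℝ (Set.range fun a => X a q)
  dist_invariant : ∀ (h : G) (q : Q),
    (dist q).map (mfderiv 𝓘(ℝ, EQ) 𝓘(ℝ, EQ) (fun x : Q => h • x) q).toLinearMap = dist (h • q)
  dist_compl : ∀ q, IsCompl (dist q)
    (LinearMap.ker (mfderiv 𝓘(ℝ, EQ) 𝓘(ℝ, EM) proj q).toLinearMap)

/-! ## Riemannian notions on the configuration manifold -/

section Riemannian

variable {EQ : Type*} [NormedAddCommGroup EQ] [NormedSpace ℝ EQ]
  {Q : Type*} [TopologicalSpace Q] [ChartedSpace EQ Q] [IsManifold 𝓘(ℝ, EQ) ∞ Q]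

/-- `a = (∇_X Y)(q)` for the Levi-Civita connection of the metric `g`, by the Koszul formula. -/
def IsLeviCivitaAt
    (g : (q : Q) → TangentSpace 𝓘(ℝ, EQ) q →L[ℝ] TangentSpace 𝓘(ℝ, EQ) q →L[ℝ] ℝ)
    (X Y : (q : Q) → TangentSpace 𝓘(ℝ, EQ) q) (q : Q) (a : TangentSpace 𝓘(ℝ, EQ) q) : Prop :=
  ∀ Z : (q : Q) → TangentSpace 𝓘(ℝ, EQ) q,
    ContMDiffAt 𝓘(ℝ, EQ) 𝓘(ℝ, EQ).tangent ∞
      (fun x => (⟨x, Z x⟩ : TangentBundle 𝓘(ℝ, EQ) Q)) q →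
    2 * g q a (Z q) =
      mvfderiv 𝓘(ℝ, EQ) (fun x => g x (Y x) (Z x)) q (X q)
      + mvfderiv 𝓘(ℝ, EQ) (fun x => g x (X x) (Z x)) q (Y q)
      - mvfderiv 𝓘(ℝ, EQ) (fun x => g x (X x) (Y x)) q (Z q)
      + g q (VectorField.mlieBracket 𝓘(ℝ, EQ) X Y q) (Z q)
      - g q (VectorField.mlieBracket 𝓘(ℝ, EQ) X Z q) (Y q)
      - g q (VectorField.mlieBracket 𝓘(ℝ, EQ) Y Z q) (X q)

/-- `g` restricts to a smooth Riemannian metric on the open set `N`. -/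
structure IsRiemannianOn
    (g : (q : Q) → TangentSpace 𝓘(ℝ, EQ) q →L[ℝ] TangentSpace 𝓘(ℝ, EQ) q →L[ℝ] ℝ)
    (N : Set Q) : Prop where
  symm : ∀ q ∈ N, ∀ v w, g q v w = g q w v
  pos : ∀ q ∈ N, ∀ v, v ≠ 0 → 0 < g q v v
  smooth : ContMDiffOn 𝓘(ℝ, EQ) (𝓘(ℝ, EQ).prod 𝓘(ℝ, EQ →L[ℝ] EQ →L[ℝ] ℝ)) ∞
    (fun q => TotalSpace.mk' (EQ →L[ℝ] EQ →L[ℝ] ℝ)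
      (E := fun q : Q => TangentSpace 𝓘(ℝ, EQ) q →L[ℝ] TangentSpace 𝓘(ℝ, EQ) q →L[ℝ] ℝ) q (g q)) N

end Riemannian

/-! ## Lie derivative of a differential form on a vector space -/

/-- The Lie derivative along the vector field `Γ` of the `k`-form `σ`:
`(L_Γ σ)(w₁, …, w_k) = (Dσ · Γ)(w₁, …, w_k) + ∑ᵢ σ(w₁, …, DΓ · wᵢ, …, w_k)`. -/
noncomputable def formLieDeriv {E : Type*} [NormedAddCommGroup E] [NormedSpace ℝ E] {k : ℕ}
    (Γ : E → E) (σ : E → E [⋀^Fin k]→L[ℝ] ℝ) (z : E) (w : Fin k → E) : ℝ :=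
  fderiv ℝ σ z (Γ z) w + ∑ i, σ z (Function.update w i (fderiv ℝ Γ z (w i)))

namespace ChaplyginSystem

variable {EQ : Type*} [NormedAddCommGroup EQ] [NormedSpace ℝ EQ] [FiniteDimensional ℝ EQ]
  {Q : Type*} [TopologicalSpace Q] [ChartedSpace EQ Q] [IsManifold 𝓘(ℝ, EQ) ∞ Q]
  {EG : Type*} [NormedAddCommGroup EG] [NormedSpace ℝ EG] [FiniteDimensional ℝ EG]
  {G : Type*} [TopologicalSpace G] [ChartedSpace EG G] [Group G] [LieGroup 𝓘(ℝ, EG) ∞ G]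
  [MulAction G Q] [ContMDiffSMul 𝓘(ℝ, EG) 𝓘(ℝ, EQ) ∞ G Q] [ProperSMul G Q]
  {EM : Type*} [NormedAddCommGroup EM] [NormedSpace ℝ EM] [FiniteDimensional ℝ EM]
  {M : Type*} [TopologicalSpace M] [ChartedSpace EM M] [IsManifold 𝓘(ℝ, EM) ∞ M]
  (S : ChaplyginSystem EQ Q EG G EM M)

/-! ## Horizontal lifts, projections and the gyroscopic tensor

A tensor on `M = Q/G` is evaluated at `p : M` through a point `q` of the fibre over `p`; by
`G`-invariance its value does not depend on `q`. -/

/-- The tangent map of the bundle projection at `q`. -/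
noncomputable def dproj (q : Q) :
    TangentSpace 𝓘(ℝ, EQ) q →L[ℝ] TangentSpace 𝓘(ℝ, EM) (S.proj q) :=
  mfderiv 𝓘(ℝ, EQ) 𝓘(ℝ, EM) S.proj q

/-- The vertical distribution. -/
noncomputable def vert (q : Q) : Submodule ℝ (TangentSpace 𝓘(ℝ, EQ) q) :=
  LinearMap.ker (S.dproj q).toLinearMap

theorem dproj_bijective (q : Q) :
    Function.Bijective ((S.dproj q).toLinearMap.domRestrict (S.dist q)) := by
  constructor
  · rw [← LinearMap.ker_eq_bot, LinearMap.ker_eq_bot']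
    intro v hv
    have h := (S.dist_compl q).disjoint.le_bot ⟨v.2, hv⟩
    exact Subtype.ext h
  · intro u
    obtain ⟨w, hw⟩ := S.proj_submersion q u
    obtain ⟨d, hd, k, hk, rfl⟩ := Submodule.mem_sup.1
      ((S.dist_compl q).codisjoint.eq_top ▸ Submodule.mem_top : w ∈ S.dist q ⊔ _)
    refine ⟨⟨d, hd⟩, ?_⟩
    rw [← hw, map_add]
    exact (add_eq_left.2 hk).symm

/-- The horizontal lift to `q` of a tangent vector of `Q/G`. -/
noncomputable def hlift (q : Q) (u : TangentSpace 𝓘(ℝ, EM) (S.proj q)) :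
    TangentSpace 𝓘(ℝ, EQ) q :=
  ((LinearEquiv.ofBijective _ (S.dproj_bijective q)).symm u : S.dist q)

/-- The horizontal lift of a vector field on `Q/G`. -/
noncomputable def hliftField (X : (p : M) → TangentSpace 𝓘(ℝ, EM) p) (q : Q) :
    TangentSpace 𝓘(ℝ, EQ) q :=
  S.hlift q (X (S.proj q))

/-- The orthogonal complement of the constraint distribution. -/
noncomputable def distOrth (q : Q) : Submodule ℝ (TangentSpace 𝓘(ℝ, EQ) q) where
  carrier := {w | ∀ d ∈ S.dist q, S.metric.inner q w d = 0}
  zero_mem' := by simp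
  add_mem' := by
    intro a b ha hb d hd
    simp [ha d hd, hb d hd]
  smul_mem' := by
    intro c a ha d hd
    simp [ha d hd]

theorem isCompl_distOrth (q : Q) : IsCompl (S.dist q) (S.distOrth q) := by
  have : FiniteDimensional ℝ (TangentSpace 𝓘(ℝ, EQ) q) :=
    inferInstanceAs (FiniteDimensional ℝ EQ)
  let B : LinearMap.BilinForm ℝ (TangentSpace 𝓘(ℝ, EQ) q) :=
    LinearMap.mk₂ ℝ (fun v w => S.metric.inner q v w) (by simp) (by simp) (by simp) (by simp)
  have hB : ∀ v w, B v w = S.metric.inner q v w := fun _ _ => rfl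
  have h : S.distOrth q = B.orthogonal (S.dist q) := by
    ext w
    refine forall₂_congr fun d _ => ?_
    change _ ↔ B d w = 0
    rw [hB, S.metric.symm]
  rw [h, LinearMap.BilinForm.isCompl_orthogonal_iff_disjoint
    (fun v w hvw => by rw [hB, S.metric.symm]; exact hvw), Submodule.disjoint_def]
  intro v hv hv'
  by_contra hne
  exact (S.metric.pos q v hne).ne' (hv' v hv)

/-- The orthogonal projection onto the constraint distribution. -/
noncomputable def orthProj (q : Q) : TangentSpace 𝓘(ℝ, EQ) q →ₗ[ℝ] TangentSpace 𝓘(ℝ, EQ) q :=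
  (S.dist q).projection (S.distOrth q) (S.isCompl_distOrth q)

/-- The vertical projection along the constraint distribution, that is, the principal connection. -/
noncomputable def vertProj (q : Q) : TangentSpace 𝓘(ℝ, EQ) q →ₗ[ℝ] TangentSpace 𝓘(ℝ, EQ) q :=
  (S.vert q).projection (S.dist q) (S.dist_compl q).symm

/-- The curvature `R(X, Y) = vertProj [Xᴴ, Yᴴ]` of the principal connection. -/
noncomputable def curvature (q : Q) (u v : TangentSpace 𝓘(ℝ, EM) (S.proj q)) :
    TangentSpace 𝓘(ℝ, EQ) q :=
  S.vertProj q (VectorField.mlieBracket 𝓘(ℝ, EQ)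
    (S.hliftField (FiberBundle.extend EM u)) (S.hliftField (FiberBundle.extend EM v)) q)

/-- The gyroscopic tensor `T(X, Y) = Tπ (orthProj (R(X, Y)))`. -/
noncomputable def gyroscopicTensor (q : Q) (u v : TangentSpace 𝓘(ℝ, EM) (S.proj q)) :
    TangentSpace 𝓘(ℝ, EM) (S.proj q) :=
  S.dproj q (S.orthProj q (S.curvature q u v))

/-- The reduced metric on `Q/G`. -/
noncomputable def redMetric (q : Q) (u v : TangentSpace 𝓘(ℝ, EM) (S.proj q)) : ℝ :=
  S.metric.inner q (S.hlift q u) (S.hlift q v)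

/-- The contraction `β(Y) = ∑ₐ ⟨Zᵃ, T(Zₐ, Y)⟩` of the gyroscopic tensor. -/
noncomputable def beta (q : Q) (Y : TangentSpace 𝓘(ℝ, EM) (S.proj q)) : ℝ :=
  haveI : FiniteDimensional ℝ (TangentSpace 𝓘(ℝ, EM) (S.proj q)) :=
    inferInstanceAs (FiniteDimensional ℝ EM)
  let Z := Module.finBasis ℝ (TangentSpace 𝓘(ℝ, EM) (S.proj q))
  ∑ a, Z.coord a (S.gyroscopicTensor q (Z a) Y)

/-! ## Semi-basic forms on `T(Q/G)`

A semi-basic form on `T(Q/G)` is evaluated at a velocity `u` and at tangent vectors of `Q/G`. -/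

/-- `(β ∧ θ_l)_u (X, Y)`, where `θ_l` is the Poincaré–Cartan 1-form, `(θ_l)_u (X) = gʳᵉᵈ(u, X)`. -/
noncomputable def betaWedgeTheta (q : Q) (u X Y : TangentSpace 𝓘(ℝ, EM) (S.proj q)) : ℝ :=
  S.beta q X * S.redMetric q u Y - S.beta q Y * S.redMetric q u X

/-- `g(uᴴ, R(X, Y))`. -/
noncomputable def metricCurv (q : Q) (u X Y : TangentSpace 𝓘(ℝ, EM) (S.proj q)) : ℝ :=
  S.metric.inner q (S.hlift q u) (S.curvature q X Y)

/-- The gyroscopic 2-form `Ξ^G`. -/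
noncomputable def Xi (q : Q) (u X Y : TangentSpace 𝓘(ℝ, EM) (S.proj q)) : ℝ :=
  -S.metricCurv q u X Y

/-- The 2-form `γ^G`. -/
noncomputable def gamma (q : Q) (u X Y : TangentSpace 𝓘(ℝ, EM) (S.proj q)) : ℝ :=
  (1 / 3) * (-S.metricCurv q X u Y + S.metricCurv q Y u X - 2 * S.metricCurv q u X Y)

/-- The 3-form `Θ^G` on `Q/G`. -/
noncomputable def Theta (q : Q) (X Y Z : TangentSpace 𝓘(ℝ, EM) (S.proj q)) : ℝ :=
  -(1 / 9) * (S.metricCurv q X Y Z + S.metricCurv q Y Z X + S.metricCurv q Z X Y)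

/-! ## Coordinate expressions on `Q/G` -/

/-- The vector field on `Q/G` with constant components `w` in the chart around `p₀`. -/
noncomputable def coordField (p₀ : M) (w : EM) : (p : M) → TangentSpace 𝓘(ℝ, EM) p :=
  VectorField.mpullback 𝓘(ℝ, EM) 𝓘(ℝ, EM) (extChartAt 𝓘(ℝ, EM) p₀) (fun _ => w)

/-- A point of the fibre over the point of `Q/G` with coordinates `x` in the chart around `p₀`. -/
noncomputable def fibrePoint (p₀ : M) (x : EM) : Q :=
  Function.surjInv S.proj_surjective ((extChartAt 𝓘(ℝ, EM) p₀).symm x)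

/-- The vector with components `w` in the chart around `p₀`, at the point with coordinates `x`. -/
noncomputable def coordVec (p₀ : M) (x w : EM) :
    TangentSpace 𝓘(ℝ, EM) (S.proj (S.fibrePoint p₀ x)) :=
  coordField p₀ w (S.proj (S.fibrePoint p₀ x))

/-- `β` in coordinates. -/
noncomputable def betaCoord (p₀ : M) (w x : EM) : ℝ :=
  S.beta (S.fibrePoint p₀ x) (S.coordVec p₀ x w)

/-- The reduced metric in coordinates. -/
noncomputable def metricCoord (p₀ : M) (u w x : EM) : ℝ :=
  S.redMetric (S.fibrePoint p₀ x) (S.coordVec p₀ x u) (S.coordVec p₀ x w)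

/-- `gʳᵉᵈ(u, T(v, w))` in coordinates. -/
noncomputable def gyroCoord (p₀ : M) (u v w x : EM) : ℝ :=
  S.redMetric (S.fibrePoint p₀ x) (S.coordVec p₀ x u)
    (S.gyroscopicTensor (S.fibrePoint p₀ x) (S.coordVec p₀ x v) (S.coordVec p₀ x w))

/-! ## The statements of the classification -/

/-- `dβ = 0` on `W`: in every chart, `∂_u (β_w) = ∂_w (β_u)`. -/
def BetaClosedOn (W : Set M) : Prop :=
  ∀ p₀ : M, ∀ x ∈ (extChartAt 𝓘(ℝ, EM) p₀).target, (extChartAt 𝓘(ℝ, EM) p₀).symm x ∈ W →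
    ∀ u w : EM, fderiv ℝ (S.betaCoord p₀ w) x u = fderiv ℝ (S.betaCoord p₀ u) x w

/-- The system is `φ`-simple over `U`: `T = -dφ ⊗ id + id ⊗ dφ`. -/
def IsPhiSimpleOn (U : Set M) (φ : M → ℝ) : Prop :=
  ContMDiffOn 𝓘(ℝ, EM) 𝓘(ℝ, ℝ) ∞ φ U ∧
  ∀ q, S.proj q ∈ U → ∀ u v : TangentSpace 𝓘(ℝ, EM) (S.proj q),
    S.gyroscopicTensor q u v =
      -(mvfderiv 𝓘(ℝ, EM) φ (S.proj q) u) • v + mvfderiv 𝓘(ℝ, EM) φ (S.proj q) v • u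

/-- `(ĝ, P)` is a projective geodesic extension over `N`: `Γⁿʰ = (Γ_ĝ + P Δ)` on the constraint
distribution.  The nonholonomic vector field `Γⁿʰ` is the one of the connection
`orthProj ∘ ∇` on sections of the constraint distribution (`∇` the Levi-Civita connection of the
kinetic energy metric), `Γ_ĝ` is the geodesic spray of `ĝ`, and adding `P Δ` to a quadratic spray
replaces `∇̂_X X` by `∇̂_X X - P(X) X`. -/
def IsProjectiveGeodesicExtensionOn (N : Set Q)
    (ghat : (q : Q) → TangentSpace 𝓘(ℝ, EQ) q →L[ℝ] TangentSpace 𝓘(ℝ, EQ) q →L[ℝ] ℝ)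
    (P : (q : Q) → TangentSpace 𝓘(ℝ, EQ) q →L[ℝ] ℝ) : Prop :=
  IsRiemannianOn ghat N ∧
  ContMDiffOn 𝓘(ℝ, EQ).tangent 𝓘(ℝ, ℝ) ∞
    (fun z : TangentBundle 𝓘(ℝ, EQ) Q => P z.proj z.2) {z | z.proj ∈ N} ∧
  ∀ q ∈ N, ∀ X : (q : Q) → TangentSpace 𝓘(ℝ, EQ) q,
    ContMDiffAt 𝓘(ℝ, EQ) 𝓘(ℝ, EQ).tangent ∞
      (fun x => (⟨x, X x⟩ : TangentBundle 𝓘(ℝ, EQ) Q)) q →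
    (∀ᶠ x in 𝓝 q, X x ∈ S.dist x) →
    ∃ a ahat : TangentSpace 𝓘(ℝ, EQ) q,
      IsLeviCivitaAt S.metric.inner X X q a ∧ IsLeviCivitaAt ghat X X q ahat ∧
      S.orthProj q a = ahat - P q (X q) • X q

/-- Over `U` there is a `(Vπ, 𝒟)`-orthogonal projective geodesic extension by a `𝒟`-conformal
modification `ĝ = e^{2F} ḡ`, `F = f ∘ π`, of the kinetic energy metric, with `ḡ` a `G`-invariant
Riemannian metric. -/
def HasConformalGeodesicExtensionOn (U : Set M) : Prop :=
  ∃ (f : M → ℝ)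
    (gbar : (q : Q) → TangentSpace 𝓘(ℝ, EQ) q →L[ℝ] TangentSpace 𝓘(ℝ, EQ) q →L[ℝ] ℝ)
    (P : (q : Q) → TangentSpace 𝓘(ℝ, EQ) q →L[ℝ] ℝ),
    ContMDiffOn 𝓘(ℝ, EM) 𝓘(ℝ, ℝ) ∞ f U ∧
    IsRiemannianOn gbar (S.proj ⁻¹' U) ∧
    (∀ (h : G) (q : Q), S.proj q ∈ U → ∀ v w : TangentSpace 𝓘(ℝ, EQ) q,
      gbar (h • q) (mfderiv 𝓘(ℝ, EQ) 𝓘(ℝ, EQ) (fun x : Q => h • x) q v)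
        (mfderiv 𝓘(ℝ, EQ) 𝓘(ℝ, EQ) (fun x : Q => h • x) q w) = gbar q v w) ∧
    (∀ q, S.proj q ∈ U → ∀ v ∈ S.dist q, ∀ w ∈ S.dist q,
      gbar q v w = S.metric.inner q v w) ∧
    (∀ q, S.proj q ∈ U → ∀ v ∈ S.vert q, ∀ w ∈ S.dist q, gbar q v w = 0) ∧
    S.IsProjectiveGeodesicExtensionOn (S.proj ⁻¹' U)
      (fun q => Real.exp (2 * f (S.proj q)) • gbar q) P

/-- `A x v` is the acceleration of the reduced equations of motion at the point with coordinates `x`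
and velocity `v`, for `x` in `V`:
`g_{cd} (q̈ᵈ + Γᵈ_{ab} q̇ᵃ q̇ᵇ) = g_{db} Rᵈ_{ac} q̇ᵃ q̇ᵇ`, with `Γᵈ_{ab}` the Christoffel symbols of the
reduced metric and `Rᵈ_{ac}` the components of the gyroscopic tensor. -/
def IsReducedAccelerationOn (p₀ : M) (V : Set EM) (A : EM → EM → EM) : Prop :=
  ∀ x ∈ V, ∀ v w : EM,
    S.metricCoord p₀ (A x v) w x
      + (fderiv ℝ (S.metricCoord p₀ v w) x v - (1 / 2) * fderiv ℝ (S.metricCoord p₀ v v) x w)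
      = S.gyroCoord p₀ v v w x

/-- `σ` is, in the coordinates of the chart around `p₀`, a volume form on the restriction of
`T(Q/G)` to `U` which is invariant under the reduced vector field
`Γʳᵉᵈ = q̇ ∂/∂q + A(q, q̇) ∂/∂q̇`. -/
def IsInvariantVolumeOn (p₀ : M) (U : Set M)
    (σ : EM × EM → (EM × EM) [⋀^Fin (2 * Module.finrank ℝ EM)]→L[ℝ] ℝ) : Prop :=
  ∃ A : EM → EM → EM,
    S.IsReducedAccelerationOn p₀ (extChartAt 𝓘(ℝ, EM) p₀ '' U) A ∧
    ContDiffOn ℝ ∞ σ ((extChartAt 𝓘(ℝ, EM) p₀ '' U) ×ˢ univ) ∧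
    ∀ z ∈ (extChartAt 𝓘(ℝ, EM) p₀ '' U) ×ˢ (univ : Set EM),
      σ z ≠ 0 ∧ ∀ w, formLieDeriv (fun y : EM × EM => (y.2, A y.1 y.2)) σ z w = 0

/-- Every point of `W` has an open neighbourhood on which the system is `φ`-simple. -/
def LocallyPhiSimple (W : Set M) : Prop :=
  ∀ p ∈ W, ∃ U : Set M, IsOpen U ∧ p ∈ U ∧ ∃ φ : M → ℝ, S.IsPhiSimpleOn U φ

/-- Locally on `W` there is a projective geodesic extension by a `𝒟`-conformal modification. -/
def LocallyHasConformalGeodesicExtension (W : Set M) : Prop :=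
  ∀ p ∈ W, ∃ U : Set M, IsOpen U ∧ p ∈ U ∧ S.HasConformalGeodesicExtensionOn U

/-- Locally on `W` the reduced equations of motion have an invariant volume form. -/
def LocallyHasInvariantVolume (W : Set M) : Prop :=
  ∀ p ∈ W, ∃ U : Set M, IsOpen U ∧ p ∈ U ∧ U ⊆ (extChartAt 𝓘(ℝ, EM) p).source ∧
    ∃ σ, S.IsInvariantVolumeOn p U σ

/-- Locally on `W` the reduced equations of motion have a basic invariant volume form, i.e. one
whose density with respect to induced coordinates on `T(Q/G)`, or equivalently with respect to the
power `ω_lᵐ` of the symplectic form `ω_l`, does not depend on the velocities. -/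
def LocallyHasBasicInvariantVolume (W : Set M) : Prop :=
  ∀ p ∈ W, ∃ U : Set M, IsOpen U ∧ p ∈ U ∧ U ⊆ (extChartAt 𝓘(ℝ, EM) p).source ∧
    ∃ σ, S.IsInvariantVolumeOn p U σ ∧
      ∀ x ∈ extChartAt 𝓘(ℝ, EM) p '' U, ∀ v : EM, σ (x, v) = σ (x, 0)

/-- `β/(m-1) ∧ θ_l = Ξ^G` on `W`, written without division. -/
def BetaXiOn (W : Set M) : Prop :=
  ∀ q, S.proj q ∈ W → ∀ u X Y : TangentSpace 𝓘(ℝ, EM) (S.proj q),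
    S.betaWedgeTheta q u X Y = ((Module.finrank ℝ EM : ℝ) - 1) * S.Xi q u X Y

/-- `β/(m-1) ∧ θ_l = γ^G` on `W`, written without division. -/
def BetaGammaOn (W : Set M) : Prop :=
  ∀ q, S.proj q ∈ W → ∀ u X Y : TangentSpace 𝓘(ℝ, EM) (S.proj q),
    S.betaWedgeTheta q u X Y = ((Module.finrank ℝ EM : ℝ) - 1) * S.gamma q u X Y

/-- `Θ^G = 0` on `W`. -/
def ThetaZeroOn (W : Set M) : Prop :=
  ∀ q, S.proj q ∈ W → ∀ X Y Z : TangentSpace 𝓘(ℝ, EM) (S.proj q), S.Theta q X Y Z = 0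

end ChaplyginSystem

/-! Everything rests on one algebraic fact: on a space of dimension at most two a skew bilinear map
with vector values is determined by its trace, T(u, v) = -β(u) v + β(v) u
(`alternating_eq_of_finrank_le_two`). Hence, whether or not β is closed, `gyroscopicTensor_eq`
holds, and g(u, T(v, w)) is a combination of β and the reduced metric (`metricCurv_eq_beta`). The
identities for Ξ, γ and Θ become pointwise algebra, with no condition on the system, so conditions
3, 4 and 6 reduce to closedness of β.

Closedness is exchanged for local potentials: the Poincaré lemma on a ball in a chart gives φ with
dφ = β (`exists_potential`), and symmetry of second derivatives goes back
(`betaClosedOn_of_potential`). Each remaining condition is shown to yield a local potential and to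
follow from one. In dimension at most one β vanishes, so closedness is automatic; this case is
treated separately where the given function need not be a potential.

φ-simplicity: compare coefficients with the trace formula on an independent pair.

Geodesic extension: passing from g to ḡ changes the covector of ∇_X X in horizontal directions by a
curvature term (`koszul_horizontal`), which is again expressed by β; in vertical directions the
covector of ḡ vanishes (`koszul_vertical`), as for a Riemannian submersion. With the conformal
factor, the horizontal discrepancy is a multiple of X plus |X|² times the gradient of β - df. It is
a multiple of X for every X exactly when β = df in dimension two, and then P = d(f ∘ π) works.

Invariant volume: in a chart the divergence of the reduced field at (x, v) is (1 - m) β(v) minus the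
logarithmic derivative of det g (`IsGyroscopicSystemOn.trace_fderiv`). For m = 2, or β = 0, a
potential φ makes det g · e^φ an invariant density, and it is basic. Conversely, if σ is any
invariant density, F = log|σ| - log det g satisfies Γ F = β(v); since the acceleration is quadratic
in v, replacing v by t v, dividing by t and letting t → 0 shows that F restricted to zero velocity
is a potential. The passage from an arbitrary volume to a basic one therefore goes through
closedness of β.

Tensors on the quotient are evaluated at arbitrarily chosen fibre points, so much of the work is to
show that the choice is immaterial (group invariance) and that the resulting coordinate expressions
are smooth. -/

set_option linter.unusedSectionVars false
set_option synthInstance.maxHeartbeats 200000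
set_option maxHeartbeats 1000000

/-! ## Bilinear forms -/

/-- Continuous bilinear forms, as a normed space. -/
noncomputable def Bil (F : Type*) [NormedAddCommGroup F] [NormedSpace ℝ F] := F →L[ℝ] F →L[ℝ] ℝ

namespace Bil

variable {E : Type*} [NormedAddCommGroup E] [NormedSpace ℝ E]
  {F : Type*} [NormedAddCommGroup F] [NormedSpace ℝ F]

noncomputable instance : NormedAddCommGroup (Bil F) :=
  inferInstanceAs (NormedAddCommGroup (F →L[ℝ] F →L[ℝ] ℝ))

noncomputable instance : NormedSpace ℝ (Bil F) :=
  inferInstanceAs (NormedSpace ℝ (F →L[ℝ] F →L[ℝ] ℝ))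

/-- Evaluation of a bilinear form in the first variable. -/
def app (γ : Bil F) : F →L[ℝ] F →L[ℝ] ℝ := γ

noncomputable instance : CoeFun (Bil F) (fun _ => F → F →L[ℝ] ℝ) := ⟨fun γ => ⇑γ.app⟩

@[simp] theorem add_app (γ δ : Bil F) (a : F) : (γ + δ) a = γ a + δ a := rfl

@[simp] theorem sub_app (γ δ : Bil F) (a : F) : (γ - δ) a = γ a - δ a := rfl

@[simp] theorem smul_app (c : ℝ) (γ : Bil F) (a : F) : (c • γ) a = c • γ a := rfl

@[simp] theorem zero_app (a : F) : (0 : Bil F) a = 0 := rfl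

theorem fderiv_bilin_apply {γ : E → F →L[ℝ] F →L[ℝ] ℝ} {X Z : E → F} {y : E}
    (hγ : DifferentiableAt ℝ γ y) (hX : DifferentiableAt ℝ X y) (hZ : DifferentiableAt ℝ Z y)
    (v : E) :
    fderiv ℝ (fun y => γ y (X y) (Z y)) y v =
      fderiv ℝ γ y v (X y) (Z y) + γ y (fderiv ℝ X y v) (Z y) + γ y (X y) (fderiv ℝ Z y v) := by
  have h := ((hγ.hasFDerivAt.clm_apply hX.hasFDerivAt).clm_apply hZ.hasFDerivAt).fderiv
  rw [h]
  simp
  ring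

theorem fderiv_app {γ : E → Bil F} {X Z : E → F} {y : E}
    (hγ : DifferentiableAt ℝ γ y) (hX : DifferentiableAt ℝ X y) (hZ : DifferentiableAt ℝ Z y)
    (v : E) :
    fderiv ℝ (fun y => γ y (X y) (Z y)) y v =
      (fderiv ℝ γ y v) (X y) (Z y) + γ y (fderiv ℝ X y v) (Z y) + γ y (X y) (fderiv ℝ Z y v) := by
  exact fderiv_bilin_apply (γ := fun y => (γ y).app) hγ hX hZ v

theorem contDiffAt_app {γ : E → Bil F} {X Z : E → F} {y : E} {n : ℕ∞ω}
    (hγ : ContDiffAt ℝ n γ y) (hX : ContDiffAt ℝ n X y) (hZ : ContDiffAt ℝ n Z y) :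
    ContDiffAt ℝ n (fun y => γ y (X y) (Z y)) y := by
  have h1 : ContDiffAt ℝ n (fun y => (γ y).app) y := hγ
  exact (h1.clm_apply hX).clm_apply hZ

/-- A basis of `F` identifies linear maps out of `F` with finite tuples of values, so smoothness can
be tested one vector at a time. -/
theorem contDiffAt_clm_of_apply [FiniteDimensional ℝ F] {G : Type*} [NormedAddCommGroup G]
    [NormedSpace ℝ G] {f : E → F →L[ℝ] G} {y : E} {n : ℕ∞ω}
    (h : ∀ a, ContDiffAt ℝ n (fun y => f y a) y) : ContDiffAt ℝ n f y := by
  let d := Module.finrank ℝ F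
  have hd : d = Module.finrank ℝ (Fin d → ℝ) := (Module.finrank_fin_fun ℝ).symm
  let e₁ := ContinuousLinearEquiv.ofFinrankEq hd
  let e₂ := (e₁.arrowCongr (1 : G ≃L[ℝ] G)).trans (ContinuousLinearEquiv.piRing (Fin d))
  rw [← Function.id_comp f, ← e₂.symm_comp_self]
  exact e₂.symm.contDiff.contDiffAt.comp y (contDiffAt_pi.mpr fun i => h _)

theorem contDiffAt_of_app [FiniteDimensional ℝ F] {γ : E → Bil F} {y : E} {n : ℕ∞ω}
    (h : ∀ a b, ContDiffAt ℝ n (fun y => γ y a b) y) : ContDiffAt ℝ n γ y := by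
  have h1 : ContDiffAt ℝ n (fun y => (γ y).app) y :=
    contDiffAt_clm_of_apply fun a => contDiffAt_clm_of_apply fun b => h a b
  exact h1

end Bil

/-! ### Tangent vectors, vector fields, brackets and metrics read in a chart -/

namespace TangentCoord

section Chart

variable {E : Type*} [NormedAddCommGroup E] [NormedSpace ℝ E]
  {N : Type*} [TopologicalSpace N] [ChartedSpace E N] [IsManifold 𝓘(ℝ, E) ∞ N]

/-- Components of a tangent vector at `x` in the chart around `x₀`. -/
noncomputable def toCoord (x₀ x : N) : TangentSpace 𝓘(ℝ, E) x →L[ℝ] E :=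
  (trivializationAt E (TangentSpace 𝓘(ℝ, E)) x₀).continuousLinearMapAt ℝ x

/-- The tangent vector at `x` with given components in the chart around `x₀`. -/
noncomputable def ofCoord (x₀ x : N) : E →L[ℝ] TangentSpace 𝓘(ℝ, E) x :=
  (trivializationAt E (TangentSpace 𝓘(ℝ, E)) x₀).symmL ℝ x

theorem mem_baseSet {x₀ x : N} (hx : x ∈ (extChartAt 𝓘(ℝ, E) x₀).source) :
    x ∈ (trivializationAt E (TangentSpace 𝓘(ℝ, E)) x₀).baseSet := by
  simpa using hx

theorem toCoord_ofCoord {x₀ x : N} (hx : x ∈ (extChartAt 𝓘(ℝ, E) x₀).source) (w : E) :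
    toCoord x₀ x (ofCoord x₀ x w) = w :=
  Trivialization.continuousLinearMapAt_symmL _ (mem_baseSet hx) w

theorem ofCoord_toCoord {x₀ x : N} (hx : x ∈ (extChartAt 𝓘(ℝ, E) x₀).source)
    (v : TangentSpace 𝓘(ℝ, E) x) : ofCoord x₀ x (toCoord x₀ x v) = v :=
  Trivialization.symmL_continuousLinearMapAt _ (mem_baseSet hx) v

theorem toCoord_injective {x₀ x : N} (hx : x ∈ (extChartAt 𝓘(ℝ, E) x₀).source) :
    Function.Injective (toCoord (E := E) x₀ x) :=
  Function.LeftInverse.injective (ofCoord_toCoord hx)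

theorem toCoord_eq_mfderiv {x₀ x : N} (hx : x ∈ (extChartAt 𝓘(ℝ, E) x₀).source) :
    toCoord x₀ x = mfderiv 𝓘(ℝ, E) 𝓘(ℝ, E) (extChartAt 𝓘(ℝ, E) x₀) x :=
  TangentBundle.continuousLinearMapAt_trivializationAt (by simpa using hx)

theorem ofCoord_eq_mfderiv {x₀ x : N} (hx : x ∈ (extChartAt 𝓘(ℝ, E) x₀).source) (w : E) :
    @Eq E (ofCoord x₀ x w)
      (mfderiv 𝓘(ℝ, E) 𝓘(ℝ, E) (extChartAt 𝓘(ℝ, E) x₀).symm (extChartAt 𝓘(ℝ, E) x₀ x) w) := by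
  have h := TangentBundle.symmL_trivializationAt (I := 𝓘(ℝ, E)) (x₀ := x₀) (x := x) (by simpa using hx)
  rw [ModelWithCorners.range_eq_univ, mfderivWithin_univ] at h
  exact DFunLike.congr_fun h w

/-- A vector field in the chart around `x₀`. -/
noncomputable def fieldRep (x₀ : N) (X : (x : N) → TangentSpace 𝓘(ℝ, E) x) (y : E) : E :=
  toCoord x₀ ((extChartAt 𝓘(ℝ, E) x₀).symm y) (X ((extChartAt 𝓘(ℝ, E) x₀).symm y))

theorem fieldRep_extChartAt {x₀ x : N} (hx : x ∈ (extChartAt 𝓘(ℝ, E) x₀).source)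
    (X : (x : N) → TangentSpace 𝓘(ℝ, E) x) :
    fieldRep x₀ X (extChartAt 𝓘(ℝ, E) x₀ x) = toCoord x₀ x (X x) := by
  rw [fieldRep, (extChartAt 𝓘(ℝ, E) x₀).left_inv hx]


theorem target_mem_nhds {x₀ x : N} (hx : x ∈ (extChartAt 𝓘(ℝ, E) x₀).source) :
    (extChartAt 𝓘(ℝ, E) x₀).target ∈ 𝓝 (extChartAt 𝓘(ℝ, E) x₀ x) :=
  (isOpen_extChartAt_target x₀).mem_nhds ((extChartAt 𝓘(ℝ, E) x₀).map_source hx)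

theorem contMDiffAt_extChartAt_symm' {x₀ x : N} (hx : x ∈ (extChartAt 𝓘(ℝ, E) x₀).source) :
    ContMDiffAt 𝓘(ℝ, E) 𝓘(ℝ, E) ∞ (extChartAt 𝓘(ℝ, E) x₀).symm (extChartAt 𝓘(ℝ, E) x₀ x) :=
  (contMDiffOn_extChartAt_symm x₀).contMDiffAt (target_mem_nhds hx)

theorem contMDiffAt_extChartAt'' {x₀ x : N} (hx : x ∈ (extChartAt 𝓘(ℝ, E) x₀).source) :
    ContMDiffAt 𝓘(ℝ, E) 𝓘(ℝ, E) ∞ (extChartAt 𝓘(ℝ, E) x₀) x :=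
  contMDiffAt_extChartAt' (by simpa using hx)

theorem continuousAt_symm {x₀ x : N} (hx : x ∈ (extChartAt 𝓘(ℝ, E) x₀).source) :
    Tendsto (extChartAt 𝓘(ℝ, E) x₀).symm (𝓝 (extChartAt 𝓘(ℝ, E) x₀ x)) (𝓝 x) := by
  have := (contMDiffAt_extChartAt_symm' hx).continuousAt
  rwa [ContinuousAt, (extChartAt 𝓘(ℝ, E) x₀).left_inv hx] at this

theorem eventually_symm_mem_source {x₀ x : N} (hx : x ∈ (extChartAt 𝓘(ℝ, E) x₀).source) :
    ∀ᶠ y in 𝓝 (extChartAt 𝓘(ℝ, E) x₀ x),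
      (extChartAt 𝓘(ℝ, E) x₀).symm y ∈ (extChartAt 𝓘(ℝ, E) x₀).source := by
  filter_upwards [target_mem_nhds hx] with y hy using (extChartAt 𝓘(ℝ, E) x₀).map_target hy

/-- Smoothness of a map into a manifold-valued function read through the chart of the source. -/
theorem contMDiffAt_iff_comp_symm {F : Type*} [NormedAddCommGroup F] [NormedSpace ℝ F]
    {x₀ x : N} (hx : x ∈ (extChartAt 𝓘(ℝ, E) x₀).source) {f : N → F} :
    ContMDiffAt 𝓘(ℝ, E) 𝓘(ℝ, F) ∞ f x ↔
      ContDiffAt ℝ ∞ (fun y => f ((extChartAt 𝓘(ℝ, E) x₀).symm y)) (extChartAt 𝓘(ℝ, E) x₀ x) := by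
  rw [← contMDiffAt_iff_contDiffAt]
  constructor
  · intro h
    refine ContMDiffAt.comp (I' := 𝓘(ℝ, E)) _ (g := f) ?_ (contMDiffAt_extChartAt_symm' hx)
    rwa [(extChartAt 𝓘(ℝ, E) x₀).left_inv hx]
  · intro h
    have h2 := ContMDiffAt.comp x h (contMDiffAt_extChartAt'' hx)
    refine h2.congr_of_eventuallyEq ?_
    filter_upwards [(isOpen_extChartAt_source (I := 𝓘(ℝ, E)) x₀).mem_nhds hx] with z hz
    exact (congrArg f ((extChartAt 𝓘(ℝ, E) x₀).left_inv hz)).symm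

theorem contMDiffAt_iff_fieldRep {x₀ x : N} (hx : x ∈ (extChartAt 𝓘(ℝ, E) x₀).source)
    {X : (x : N) → TangentSpace 𝓘(ℝ, E) x} :
    ContMDiffAt 𝓘(ℝ, E) 𝓘(ℝ, E).tangent ∞ (fun x => (⟨x, X x⟩ : TangentBundle 𝓘(ℝ, E) N)) x ↔
      ContDiffAt ℝ ∞ (fieldRep x₀ X) (extChartAt 𝓘(ℝ, E) x₀ x) := by
  have h1 := Trivialization.contMDiffAt_section_iff (IB := 𝓘(ℝ, E)) (n := ∞) (s := X)
    (trivializationAt E (TangentSpace 𝓘(ℝ, E)) x₀) (mem_baseSet hx)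
  refine h1.trans ((contMDiffAt_iff_comp_symm hx).trans ?_)
  have h2 : fieldRep x₀ X =ᶠ[𝓝 (extChartAt 𝓘(ℝ, E) x₀ x)] fun y =>
      (trivializationAt E (TangentSpace 𝓘(ℝ, E)) x₀ ⟨(extChartAt 𝓘(ℝ, E) x₀).symm y,
        X ((extChartAt 𝓘(ℝ, E) x₀).symm y)⟩).2 := by
    filter_upwards [eventually_symm_mem_source hx] with y hy
    rw [fieldRep, toCoord, Trivialization.continuousLinearMapAt_apply_of_mem]
    exact mem_baseSet hy
  exact ⟨fun h => h.congr_of_eventuallyEq h2, fun h => h.congr_of_eventuallyEq h2.symm⟩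

theorem contMDiffAt_ofCoord {x₀ x : N} (hx : x ∈ (extChartAt 𝓘(ℝ, E) x₀).source) (w : E) :
    ContMDiffAt 𝓘(ℝ, E) 𝓘(ℝ, E).tangent ∞
      (fun x => (⟨x, ofCoord x₀ x w⟩ : TangentBundle 𝓘(ℝ, E) N)) x := by
  rw [contMDiffAt_iff_fieldRep (X := fun x => ofCoord x₀ x w) hx]
  refine (contDiffAt_const (c := w)).congr_of_eventuallyEq ?_
  filter_upwards [eventually_symm_mem_source hx] with y hy
  rw [fieldRep, toCoord_ofCoord hy]

theorem mvfderiv_eq_fderiv {F : Type*} [NormedAddCommGroup F] [NormedSpace ℝ F]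
    {x₀ x : N} (hx : x ∈ (extChartAt 𝓘(ℝ, E) x₀).source) {f : N → F}
    (hf : MDifferentiableAt 𝓘(ℝ, E) 𝓘(ℝ, F) f x) (v : TangentSpace 𝓘(ℝ, E) x) :
    mvfderiv 𝓘(ℝ, E) f x v =
      fderiv ℝ (fun y => f ((extChartAt 𝓘(ℝ, E) x₀).symm y)) (extChartAt 𝓘(ℝ, E) x₀ x)
        (toCoord x₀ x v) := by
  have hs := (contMDiffAt_extChartAt_symm' hx).mdifferentiableAt (by simp)
  have hl := (extChartAt 𝓘(ℝ, E) x₀).left_inv hx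
  have hc := mfderiv_comp (I := 𝓘(ℝ, E)) (I' := 𝓘(ℝ, E)) (I'' := 𝓘(ℝ, F))
    (extChartAt 𝓘(ℝ, E) x₀ x) (g := f) (f := (extChartAt 𝓘(ℝ, E) x₀).symm) (by rwa [hl]) hs
  rw [mfderiv_eq_fderiv] at hc
  have h2 := DFunLike.congr_fun hc (toCoord x₀ x v)
  -- The chain rule yields a derivative at the image of the chart point, which equals `x` only
  -- propositionally; generalising the base point allows substitution.
  have h3 : ∀ x' : N, x' = x → ∀ w : TangentSpace 𝓘(ℝ, E) x', @Eq E w v →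
      @Eq F (mfderiv 𝓘(ℝ, E) 𝓘(ℝ, F) f x' w) (mfderiv 𝓘(ℝ, E) 𝓘(ℝ, F) f x v) := by
    rintro _ rfl w hw
    exact congrArg (mfderiv 𝓘(ℝ, E) 𝓘(ℝ, F) f _) hw
  refine (h2.trans (h3 _ hl _ ?_)).symm
  exact (ofCoord_eq_mfderiv hx _).symm.trans (ofCoord_toCoord hx v)

/-- Naturality of the bracket under pullback by the inverse chart; the pullback of a field is its
coordinate representative, and on a vector space the manifold bracket is the usual one. -/
theorem toCoord_mlieBracket [CompleteSpace E] {x₀ x : N}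
    (hx : x ∈ (extChartAt 𝓘(ℝ, E) x₀).source)
    {X Y : (x : N) → TangentSpace 𝓘(ℝ, E) x}
    (hX : ContMDiffAt 𝓘(ℝ, E) 𝓘(ℝ, E).tangent ∞
      (fun x => (⟨x, X x⟩ : TangentBundle 𝓘(ℝ, E) N)) x)
    (hY : ContMDiffAt 𝓘(ℝ, E) 𝓘(ℝ, E).tangent ∞
      (fun x => (⟨x, Y x⟩ : TangentBundle 𝓘(ℝ, E) N)) x) :
    toCoord x₀ x (VectorField.mlieBracket 𝓘(ℝ, E) X Y x) =
      VectorField.lieBracket ℝ (fieldRep x₀ X) (fieldRep x₀ Y) (extChartAt 𝓘(ℝ, E) x₀ x) := by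
  have hl := (extChartAt 𝓘(ℝ, E) x₀).left_inv hx
  have hn : (2 : ℕ∞ω) ≤ ∞ := WithTop.coe_le_coe.2 le_top
  have hn' : (3 : ℕ∞ω) ≤ ∞ := WithTop.coe_le_coe.2 le_top
  have : IsManifold 𝓘(ℝ, E) (minSmoothness ℝ 2) N :=
    IsManifold.of_le (n := ∞) (by simpa using hn)
  have : IsManifold 𝓘(ℝ, E) (minSmoothness ℝ 3) N :=
    IsManifold.of_le (n := ∞) (by simpa using hn')
  have key := VectorField.mpullback_mlieBracket (I := 𝓘(ℝ, E)) (I' := 𝓘(ℝ, E)) (n := ∞)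
    (f := (extChartAt 𝓘(ℝ, E) x₀).symm) (V := X) (W := Y) (x₀ := extChartAt 𝓘(ℝ, E) x₀ x)
    (by rw [hl]; exact hX.mdifferentiableAt (by simp))
    (by rw [hl]; exact hY.mdifferentiableAt (by simp))
    (contMDiffAt_extChartAt_symm' hx) (by simpa using hn)
  have hpull : ∀ (Z : (x : N) → TangentSpace 𝓘(ℝ, E) x), ∀ y ∈ (extChartAt 𝓘(ℝ, E) x₀).target,
      VectorField.mpullback 𝓘(ℝ, E) 𝓘(ℝ, E) (extChartAt 𝓘(ℝ, E) x₀).symm Z y =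
        fieldRep x₀ Z y := by
    intro Z y hy
    have h1 := mfderiv_extChartAt_comp_mfderivWithin_extChartAt_symm (I := 𝓘(ℝ, E)) hy
    have h2 := mfderivWithin_extChartAt_symm_comp_mfderiv_extChartAt (I := 𝓘(ℝ, E)) hy
    rw [ModelWithCorners.range_eq_univ, mfderivWithin_univ] at h1 h2
    rw [VectorField.mpullback_apply, ContinuousLinearMap.inverse_eq h2 h1, fieldRep,
      toCoord_eq_mfderiv ((extChartAt 𝓘(ℝ, E) x₀).map_target hy)]
    rfl
  have hy := (extChartAt 𝓘(ℝ, E) x₀).map_source hx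
  have hev : ∀ Z : (x : N) → TangentSpace 𝓘(ℝ, E) x,
      VectorField.mpullback 𝓘(ℝ, E) 𝓘(ℝ, E) (extChartAt 𝓘(ℝ, E) x₀).symm Z
        =ᶠ[𝓝 (extChartAt 𝓘(ℝ, E) x₀ x)] fieldRep x₀ Z := fun Z => by
    filter_upwards [target_mem_nhds hx] with y hy using hpull Z y hy
  have hb : ∀ (V W : (x : E) → TangentSpace 𝓘(ℝ, E) x) (z : E),
      VectorField.mlieBracket 𝓘(ℝ, E) V W z = VectorField.lieBracket ℝ V W z := fun V W z => by
    have h1 := congrFun (VectorField.mlieBracketWithin_eq_lieBracketWithin (𝕜 := ℝ) (V := V) (W := W)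
      (s := univ)) z
    rw [VectorField.mlieBracketWithin_univ] at h1
    exact h1.trans (congrFun (VectorField.lieBracketWithin_univ (𝕜 := ℝ) (E := E)) z)
  rw [← fieldRep_extChartAt hx]
  refine (hpull _ _ hy).symm.trans (key.trans ?_)
  exact (Filter.EventuallyEq.mlieBracket_vectorField_eq (hev X) (hev Y)).trans (hb _ _ _)

/-- A bilinear form on tangent vectors in the chart around `x₀`. -/
noncomputable def metricRep (x₀ : N)
    (g : (x : N) → TangentSpace 𝓘(ℝ, E) x →L[ℝ] TangentSpace 𝓘(ℝ, E) x →L[ℝ] ℝ) (y : E) :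
    Bil E :=
  (trivializationAt (E →L[ℝ] E →L[ℝ] ℝ)
    (fun x : N => TangentSpace 𝓘(ℝ, E) x →L[ℝ] TangentSpace 𝓘(ℝ, E) x →L[ℝ] ℝ) x₀
      ⟨(extChartAt 𝓘(ℝ, E) x₀).symm y, g ((extChartAt 𝓘(ℝ, E) x₀).symm y)⟩).2

theorem metricRep_apply' {x₀ : N} {y : E}
    (hy : (extChartAt 𝓘(ℝ, E) x₀).symm y ∈ (extChartAt 𝓘(ℝ, E) x₀).source)
    (g : (x : N) → TangentSpace 𝓘(ℝ, E) x →L[ℝ] TangentSpace 𝓘(ℝ, E) x →L[ℝ] ℝ) (v w : E) :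
    metricRep x₀ g y v w = g ((extChartAt 𝓘(ℝ, E) x₀).symm y)
      (ofCoord x₀ _ v) (ofCoord x₀ _ w) := by
  have h := inCoordinates_apply_eq₂ (𝕜 := ℝ) (F₁ := E) (F₂ := E) (F₃ := ℝ)
    (E₁ := fun x : N => TangentSpace 𝓘(ℝ, E) x) (E₂ := fun x : N => TangentSpace 𝓘(ℝ, E) x)
    (E₃ := Bundle.Trivial N ℝ) (x₀ := x₀) (x := (extChartAt 𝓘(ℝ, E) x₀).symm y)
    (ϕ := g ((extChartAt 𝓘(ℝ, E) x₀).symm y)) (v := v) (w := w)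
    (mem_baseSet hy) (mem_baseSet hy) (by simp)
  refine Eq.trans h ?_
  rw [ofCoord, Trivialization.symmL_apply _ (mem_baseSet hy),
    Trivialization.symmL_apply _ (mem_baseSet hy)]
  simp

theorem metricRep_apply {x₀ x : N} (hx : x ∈ (extChartAt 𝓘(ℝ, E) x₀).source)
    (g : (x : N) → TangentSpace 𝓘(ℝ, E) x →L[ℝ] TangentSpace 𝓘(ℝ, E) x →L[ℝ] ℝ) (v w : E) :
    metricRep x₀ g (extChartAt 𝓘(ℝ, E) x₀ x) v w = g x (ofCoord x₀ x v) (ofCoord x₀ x w) := by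
  have hl := (extChartAt 𝓘(ℝ, E) x₀).left_inv hx
  rw [metricRep_apply' (by rwa [hl]), hl]

theorem metricRep_toCoord {x₀ x : N} (hx : x ∈ (extChartAt 𝓘(ℝ, E) x₀).source)
    (g : (x : N) → TangentSpace 𝓘(ℝ, E) x →L[ℝ] TangentSpace 𝓘(ℝ, E) x →L[ℝ] ℝ)
    (v w : TangentSpace 𝓘(ℝ, E) x) :
    metricRep x₀ g (extChartAt 𝓘(ℝ, E) x₀ x) (toCoord x₀ x v) (toCoord x₀ x w) = g x v w := by
  rw [metricRep_apply hx, ofCoord_toCoord hx, ofCoord_toCoord hx]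

set_option synthInstance.maxHeartbeats 200000 in
theorem contMDiffAt_iff_metricRep {x₀ x : N} (hx : x ∈ (extChartAt 𝓘(ℝ, E) x₀).source)
    {g : (x : N) → TangentSpace 𝓘(ℝ, E) x →L[ℝ] TangentSpace 𝓘(ℝ, E) x →L[ℝ] ℝ} :
    ContMDiffAt 𝓘(ℝ, E) (𝓘(ℝ, E).prod 𝓘(ℝ, E →L[ℝ] E →L[ℝ] ℝ)) ∞
      (fun x => TotalSpace.mk' (E →L[ℝ] E →L[ℝ] ℝ)
        (E := fun x : N => TangentSpace 𝓘(ℝ, E) x →L[ℝ] TangentSpace 𝓘(ℝ, E) x →L[ℝ] ℝ) x (g x)) x ↔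
      ContDiffAt ℝ ∞ (metricRep x₀ g) (extChartAt 𝓘(ℝ, E) x₀ x) := by
  have h1 := Trivialization.contMDiffAt_section_iff (IB := 𝓘(ℝ, E)) (n := ∞)
    (F := E →L[ℝ] E →L[ℝ] ℝ)
    (E := fun x : N => TangentSpace 𝓘(ℝ, E) x →L[ℝ] TangentSpace 𝓘(ℝ, E) x →L[ℝ] ℝ) (s := g)
    (trivializationAt (E →L[ℝ] E →L[ℝ] ℝ)
      (fun x : N => TangentSpace 𝓘(ℝ, E) x →L[ℝ] TangentSpace 𝓘(ℝ, E) x →L[ℝ] ℝ) x₀)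
    (x₀ := x) (by exact ⟨mem_baseSet hx, mem_baseSet hx, mem_univ _⟩)
  exact h1.trans (contMDiffAt_iff_comp_symm hx)

end Chart
end TangentCoord

/-! ## Calculus in a chart -/

section FlatCalculus

variable {E : Type*} [NormedAddCommGroup E] [NormedSpace ℝ E]
  {F : Type*} [NormedAddCommGroup F] [NormedSpace ℝ F]

theorem fderiv_eventually_zero {G : Type*} [NormedAddCommGroup G] [NormedSpace ℝ G]
    {f : E → G} {y : E} (h : ∀ᶠ y' in 𝓝 y, f y' = 0) (v : E) :
    fderiv ℝ f y v = 0 := by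
  rw [Filter.EventuallyEq.fderiv_eq (f₁ := f) (f := fun _ => 0) h]
  simp

/-- The curvature of the projection field `Pr`, as a two-form. -/
noncomputable def curvForm (Pr : E → E →L[ℝ] E) (y a b : E) : E :=
  fderiv ℝ Pr y a b - fderiv ℝ Pr y b a

/-- Differentiating Pr W = W gives (1 - Pr) DW = (D Pr) W for a field W in the image. Applied to
both fields this removes their derivatives from the complementary part of the bracket, which is why
curvature is a tensor. -/
theorem lieBracket_sub_proj {Pr : E → E →L[ℝ] E} {X Z : E → E} {y : E}
    (hPr : DifferentiableAt ℝ Pr y) (hX : DifferentiableAt ℝ X y) (hZ : DifferentiableAt ℝ Z y)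
    (hPrX : ∀ᶠ y' in 𝓝 y, Pr y' (X y') = X y') (hPrZ : ∀ᶠ y' in 𝓝 y, Pr y' (Z y') = Z y') :
    VectorField.lieBracket ℝ X Z y - Pr y (VectorField.lieBracket ℝ X Z y) =
      curvForm Pr y (X y) (Z y) := by
  have key : ∀ {W : E → E}, DifferentiableAt ℝ W y → (∀ᶠ y' in 𝓝 y, Pr y' (W y') = W y') →
      ∀ v, fderiv ℝ W y v = fderiv ℝ Pr y v (W y) + Pr y (fderiv ℝ W y v) := by
    intro W hW hPrW v
    have h := (hPr.hasFDerivAt.clm_apply hW.hasFDerivAt).fderiv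
    rw [Filter.EventuallyEq.fderiv_eq hPrW] at h
    conv_lhs => rw [h]
    simp [add_comm]
  rw [VectorField.lieBracket, map_sub, curvForm]
  have h1 := key hX hPrX (Z y)
  have h2 := key hZ hPrZ (X y)
  rw [sub_sub_eq_add_sub, sub_eq_iff_eq_add]
  rw [eq_sub_of_add_eq h1.symm, eq_sub_of_add_eq h2.symm]
  abel

/-- Twice the covector `γ(∇_X X, ·)` of the Levi-Civita connection of `γ`. -/
noncomputable def koszul (γ : E → Bil E) (X : E → E) (y z : E) : ℝ :=
  2 * fderiv ℝ γ y (X y) (X y) z + 2 * γ y (fderiv ℝ X y (X y)) z - fderiv ℝ γ y z (X y) (X y)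

/-- The derivatives of `Z` in the metric terms cancel those in the brackets, so only the value of
`Z` at `y` survives. -/
theorem koszul_formula {γ : E → Bil E} {X Z : E → E} {y : E}
    (hγ : DifferentiableAt ℝ γ y) (hs : ∀ a b, γ y a b = γ y b a)
    (hX : DifferentiableAt ℝ X y) (hZ : DifferentiableAt ℝ Z y) :
    fderiv ℝ (fun y => γ y (X y) (Z y)) y (X y) + fderiv ℝ (fun y => γ y (X y) (Z y)) y (X y)
      - fderiv ℝ (fun y => γ y (X y) (X y)) y (Z y)
      + γ y (VectorField.lieBracket ℝ X X y) (Z y)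
      - γ y (VectorField.lieBracket ℝ X Z y) (X y)
      - γ y (VectorField.lieBracket ℝ X Z y) (X y) = koszul γ X y (Z y) := by
  rw [Bil.fderiv_app hγ hX hZ, Bil.fderiv_app hγ hX hX]
  simp only [VectorField.lieBracket, map_sub, sub_apply, koszul, sub_self]
  rw [hs (X y) (fderiv ℝ Z y (X y)), hs (X y) (fderiv ℝ X y (Z y))]
  simp
  ring

/-- Extend `z` to the horizontal field Z = Pr z. Since γ - γb vanishes on horizontal pairs near `y`,
so do the derivatives of its values on (X, Z) and (X, X). In the Koszul formula only the bracket [X,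
Z] remains: its horizontal part contributes equally to both metrics, and its vertical part, the
curvature, is seen by γ but is γb-orthogonal to X. -/
theorem koszul_horizontal {γ γb : E → Bil E} {Pr : E → E →L[ℝ] E} {X : E → E} {y z : E}
    (hγ : DifferentiableAt ℝ γ y) (hγb : DifferentiableAt ℝ γb y)
    (hs : ∀ a b, γ y a b = γ y b a) (hsb : ∀ a b, γb y a b = γb y b a)
    (hPr : DifferentiableAt ℝ Pr y) (hX : DifferentiableAt ℝ X y)
    (hPrX : ∀ᶠ y' in 𝓝 y, Pr y' (X y') = X y')
    (hPrPr : ∀ᶠ y' in 𝓝 y, ∀ a, Pr y' (Pr y' a) = Pr y' a)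
    (heq : ∀ᶠ y' in 𝓝 y, ∀ a b, γb y' (Pr y' a) (Pr y' b) = γ y' (Pr y' a) (Pr y' b))
    (horth : ∀ a b, γb y (Pr y a) (b - Pr y b) = 0)
    (hz : Pr y z = z) :
    koszul γ X y z - koszul γb X y z = -2 * γ y (X y) (curvForm Pr y (X y) z) := by
  have hZ : DifferentiableAt ℝ (fun y' => Pr y' z) y := hPr.clm_apply (differentiableAt_const _)
  have hX0 := hPrX.self_of_nhds
  have hδ : DifferentiableAt ℝ (fun y => γ y - γb y) y :=
    DifferentiableAt.fun_sub hγ hγb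
  have hDδ : ∀ v a b, fderiv ℝ (fun y => γ y - γb y) y v a b =
      fderiv ℝ γ y v a b - fderiv ℝ γb y v a b := by
    intro v a b
    rw [fderiv_fun_sub hγ hγb]
    rfl
  have e1 : ∀ v, fderiv ℝ (fun y' => (γ y' - γb y') (X y') (Pr y' z)) y v = 0 := by
    apply fderiv_eventually_zero
    filter_upwards [hPrX, heq] with y' h1 h2
    have := h2 (X y') z
    rw [h1] at this
    simp [this]
  have e2 : ∀ v, fderiv ℝ (fun y' => (γ y' - γb y') (X y') (X y')) y v = 0 := by
    apply fderiv_eventually_zero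
    filter_upwards [hPrX, heq] with y' h1 h2
    have := h2 (X y') (X y')
    rw [h1] at this
    simp [this]
  have e1' := e1 (X y)
  have e2' := e2 z
  rw [Bil.fderiv_app hδ hX hZ, hDδ, hz] at e1'
  rw [Bil.fderiv_app hδ hX hX, hDδ] at e2'
  simp only [Bil.sub_app, sub_apply] at e1' e2'
  have hbr := lieBracket_sub_proj hPr hX hZ hPrX (hPrPr.mono fun y' h => h z)
  simp only [hz] at hbr
  rw [← hbr]
  set W := VectorField.lieBracket ℝ X (fun y' => Pr y' z) y with hW
  have hWdef : W = fderiv ℝ (fun y' => Pr y' z) y (X y) - fderiv ℝ X y z := by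
    rw [hW, VectorField.lieBracket, hz]
  have h3 := horth (X y) W
  have h4 := heq.self_of_nhds (X y) W
  rw [hX0] at h3 h4
  have h5 : γb y (X y) W = γ y (X y) (Pr y W) := by
    rw [← h4, ← sub_eq_zero, ← map_sub, h3]
  rw [hWdef] at h5 ⊢
  simp only [map_sub] at h5 ⊢
  simp only [koszul]
  rw [hs (fderiv ℝ X y z), hsb (fderiv ℝ X y z)] at e2'
  linarith

/-- The classical conformal change of the Levi-Civita connection, from the product rule for the
factor e^{2f}. -/
theorem koszul_conformal {γb : E → Bil E} {f : E → ℝ} {X : E → E} {y : E}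
    (hγb : DifferentiableAt ℝ γb y) (hf : DifferentiableAt ℝ f y) (z : E) :
    koszul (fun y => Real.exp (2 * f y) • γb y) X y z =
      Real.exp (2 * f y) * (koszul γb X y z + 4 * fderiv ℝ f y (X y) * γb y (X y) z
        - 2 * fderiv ℝ f y z * γb y (X y) (X y)) := by
  have h : HasFDerivAt (fun y => Real.exp (2 * f y) • γb y) _ y :=
    HasFDerivAt.fun_smul ((hf.hasFDerivAt.const_mul 2).exp) hγb.hasFDerivAt
  simp only [koszul, h.fderiv]
  simp
  ring

/-- The covector of γb(∇_X X, ·) vanishes on vertical vectors because pairing with `X` factors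
through the base metric `hh`. `X` need not be projectable: differentiating along the vertical field
Z leaves hh(D²p(Z, X), Dp X), and differentiating Dp Z = 0 along X produces hh(D²p(X, Z), Dp X), so
symmetry of D²p cancels the two. -/
theorem koszul_vertical {γb : E → Bil E} {hh : F → Bil F}
    {p : E → F} {X Z : E → E} {y : E}
    (hγb : DifferentiableAt ℝ γb y) (hsb : ∀ᶠ y' in 𝓝 y, ∀ a b, γb y' a b = γb y' b a)
    (hp : ContDiffAt ℝ ∞ p y) (hhd : DifferentiableAt ℝ hh (p y))
    (hhs : ∀ a b, hh (p y) a b = hh (p y) b a)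
    (hX : DifferentiableAt ℝ X y) (hZ : DifferentiableAt ℝ Z y)
    (hpull : ∀ᶠ y' in 𝓝 y, ∀ a, γb y' a (X y') = hh (p y') (fderiv ℝ p y' a) (fderiv ℝ p y' (X y')))
    (hZv : ∀ᶠ y' in 𝓝 y, fderiv ℝ p y' (Z y') = 0) :
    koszul γb X y (Z y) = 0 := by
  have hp1 : DifferentiableAt ℝ p y := hp.differentiableAt (by simp)
  have hp2 : DifferentiableAt ℝ (fderiv ℝ p) y :=
    (hp.fderiv_right (m := 1) (by exact WithTop.coe_le_coe.2 le_top)).differentiableAt (by simp)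
  have hsymm : ∀ a b, fderiv ℝ (fderiv ℝ p) y a b = fderiv ℝ (fderiv ℝ p) y b a :=
    (hp.isSymmSndFDerivAt (by simpa using! (WithTop.coe_le_coe.2 le_top : (2 : ℕ∞ω) ≤ ∞))).eq
  have hZ0 := hZv.self_of_nhds
  have e1 : fderiv ℝ (fun y' => γb y' (X y') (Z y')) y (X y) = 0 := by
    apply fderiv_eventually_zero
    filter_upwards [hsb, hpull, hZv] with y' h1 h2 h3
    rw [h1, h2, h3]
    simp
  have e2 : fderiv ℝ (fun y' => γb y' (X y') (X y')) y (Z y) =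
      fderiv ℝ (fun y' => (hh ∘ p) y' (fderiv ℝ p y' (X y')) (fderiv ℝ p y' (X y'))) y (Z y) := by
    congr 1
    apply Filter.EventuallyEq.fderiv_eq
    filter_upwards [hpull] with y' h using h _
  have e3 : fderiv ℝ (fun y' => fderiv ℝ p y' (Z y')) y (X y) = 0 := fderiv_eventually_zero hZv _
  -- The base metric is constant along the fibres.
  have hcomp : fderiv ℝ (hh ∘ p) y (Z y) = 0 := by
    rw [(HasFDerivAt.comp (g := hh) y hhd.hasFDerivAt hp1.hasFDerivAt).fderiv]
    simp [hZ0]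
  have hDX : DifferentiableAt ℝ (fun y' => fderiv ℝ p y' (X y')) y := hp2.clm_apply hX
  have hDXv : ∀ v, fderiv ℝ (fun y' => fderiv ℝ p y' (X y')) y v =
      fderiv ℝ (fderiv ℝ p) y v (X y) + fderiv ℝ p y (fderiv ℝ X y v) := fun v => by
    rw [(hp2.hasFDerivAt.clm_apply hX.hasFDerivAt).fderiv]
    simp [add_comm]
  have hDZv : ∀ v, fderiv ℝ (fun y' => fderiv ℝ p y' (Z y')) y v =
      fderiv ℝ (fderiv ℝ p) y v (Z y) + fderiv ℝ p y (fderiv ℝ Z y v) := fun v => by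
    rw [(hp2.hasFDerivAt.clm_apply hZ.hasFDerivAt).fderiv]
    simp [add_comm]
  rw [Bil.fderiv_app hγb hX hZ] at e1
  rw [Bil.fderiv_app hγb hX hX,
    Bil.fderiv_app (γ := hh ∘ p) (DifferentiableAt.comp y hhd hp1) hDX hDX, hcomp, hDXv] at e2
  rw [hDZv] at e3
  have hp0 := hpull.self_of_nhds
  have hs0 := hsb.self_of_nhds
  rw [hs0 (X y) (fderiv ℝ X y (Z y)), hp0] at e2
  rw [hs0 (X y) (fderiv ℝ Z y (X y)), hp0 (fderiv ℝ Z y (X y)),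
    eq_neg_of_add_eq_zero_right e3, hsymm] at e1
  rw [Function.comp_apply, hhs (fderiv ℝ p y (X y))] at e2
  simp only [map_add, map_neg, add_apply, neg_apply,
    zero_apply, Bil.zero_app] at e1 e2
  simp only [koszul]
  linarith

/-- Submersions have smooth local sections. -/
theorem exists_local_section [FiniteDimensional ℝ E] [FiniteDimensional ℝ F] {p : E → F} {y : E}
    (hp : ContDiffAt ℝ ∞ p y) (hs : Function.Surjective (fderiv ℝ p y)) :
    ∃ s : F → E, ContDiffAt ℝ ∞ s (p y) ∧ s (p y) = y ∧ ∀ᶠ x in 𝓝 (p y), p (s x) = x := by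
  obtain ⟨R, hR⟩ := (fderiv ℝ p y).toLinearMap.exists_rightInverse_of_surjective
    (LinearMap.range_eq_top.2 hs)
  have := FiniteDimensional.complete ℝ F
  let R' : F →L[ℝ] E := R.toContinuousLinearMap
  -- An affine section to first order: `p ∘ A` has identity derivative at `p y`, so the inverse
  -- function theorem supplies the reparametrisation that makes it an exact section.
  let A : F → E := fun x => y + R' (x - p y)
  have hA0 : A (p y) = y := by simp [A]
  have hA : ContDiffAt ℝ ∞ A (p y) := by fun_prop
  have hAd : HasFDerivAt A R' (p y) :=
    (R'.hasFDerivAt.comp (p y) ((hasFDerivAt_id (p y)).sub_const (p y))).const_add y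
  have hpA : ContDiffAt ℝ ∞ (p ∘ A) (p y) := ContDiffAt.comp _ (by rwa [hA0]) hA
  have hd : HasFDerivAt (p ∘ A) (ContinuousLinearEquiv.refl ℝ F : F →L[ℝ] F) (p y) := by
    have h1 : HasFDerivAt p (fderiv ℝ p y) (A (p y)) := by
      rw [hA0]; exact (hp.differentiableAt (by simp)).hasFDerivAt
    convert! h1.comp (p y) hAd
    ext x
    exact (LinearMap.congr_fun hR x).symm
  have hne : (∞ : ℕ∞ω) ≠ 0 := by simp
  have hfix : (p ∘ A) (p y) = p y := congrArg p hA0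
  have hL := hpA.to_localInverse hd hne
  rw [hfix] at hL
  set I := hpA.localInverse hd hne with hI
  have hI0 : I (p y) = p y := by
    have := hpA.localInverse_apply_image hd hne
    rwa [hfix] at this
  refine ⟨A ∘ I, ContDiffAt.comp _ (by rwa [hI0]) hL, by simp [hI0, hA0], ?_⟩
  have h1 := (hpA.hasStrictFDerivAt' hd hne).eventually_right_inverse
  rw [hfix] at h1
  exact h1

/-- Evaluating an alternating map after applying an endomorphism to one vector of a basis. -/
theorem sum_alternating_update {ι V : Type*} [Fintype ι] [DecidableEq ι] [AddCommGroup V]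
    [Module ℝ V] (b : Module.Basis ι ℝ V) (σ : V [⋀^ι]→ₗ[ℝ] ℝ) (f : V →ₗ[ℝ] V) :
    ∑ i, σ (Function.update b i (f (b i))) = LinearMap.trace ℝ V f * σ b := by
  rw [LinearMap.trace_eq_matrix_trace ℝ b, Matrix.trace, Finset.sum_mul]
  refine Finset.sum_congr rfl fun i _ => ?_
  conv_lhs => rw [← b.sum_repr (f (b i))]
  rw [AlternatingMap.map_update_sum, Finset.sum_eq_single i]
  · rw [AlternatingMap.map_update_smul, Function.update_eq_self, Matrix.diag_apply,
      LinearMap.toMatrix_apply, smul_eq_mul]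
  · intro j _ hj
    rw [AlternatingMap.map_update_smul, AlternatingMap.map_update_self _ _ hj.symm, smul_zero]
  · simp

end FlatCalculus

namespace ChaplyginSystem

open TangentCoord

variable {EQ : Type*} [NormedAddCommGroup EQ] [NormedSpace ℝ EQ] [FiniteDimensional ℝ EQ]
  {Q : Type*} [TopologicalSpace Q] [ChartedSpace EQ Q] [IsManifold 𝓘(ℝ, EQ) ∞ Q]
  {EG : Type*} [NormedAddCommGroup EG] [NormedSpace ℝ EG] [FiniteDimensional ℝ EG]
  {G : Type*} [TopologicalSpace G] [ChartedSpace EG G] [Group G] [LieGroup 𝓘(ℝ, EG) ∞ G]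
  [MulAction G Q] [ContMDiffSMul 𝓘(ℝ, EG) 𝓘(ℝ, EQ) ∞ G Q] [ProperSMul G Q]
  {EM : Type*} [NormedAddCommGroup EM] [NormedSpace ℝ EM] [FiniteDimensional ℝ EM]
  {M : Type*} [TopologicalSpace M] [ChartedSpace EM M] [IsManifold 𝓘(ℝ, EM) ∞ M]
  (S : ChaplyginSystem EQ Q EG G EM M)

/-! ## Horizontal lifts -/

/-- The horizontal lift as a linear map. -/
noncomputable def hliftₗ (q : Q) :
    TangentSpace 𝓘(ℝ, EM) (S.proj q) →ₗ[ℝ] TangentSpace 𝓘(ℝ, EQ) q :=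
  (S.dist q).subtype ∘ₗ (LinearEquiv.ofBijective _ (S.dproj_bijective q)).symm.toLinearMap

theorem hlift_add (q : Q) (u v : TangentSpace 𝓘(ℝ, EM) (S.proj q)) :
    S.hlift q (u + v) = S.hlift q u + S.hlift q v := map_add (S.hliftₗ q) u v

theorem hlift_smul (q : Q) (c : ℝ) (u : TangentSpace 𝓘(ℝ, EM) (S.proj q)) :
    S.hlift q (c • u) = c • S.hlift q u := map_smul (S.hliftₗ q) c u

theorem hlift_mem (q : Q) (u : TangentSpace 𝓘(ℝ, EM) (S.proj q)) : S.hlift q u ∈ S.dist q :=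
  Subtype.property _

theorem dproj_hlift (q : Q) (u : TangentSpace 𝓘(ℝ, EM) (S.proj q)) :
    S.dproj q (S.hlift q u) = u :=
  LinearEquiv.apply_symm_apply (LinearEquiv.ofBijective _ (S.dproj_bijective q)) u

theorem hlift_dproj {q : Q} {v : TangentSpace 𝓘(ℝ, EQ) q} (hv : v ∈ S.dist q) :
    S.hlift q (S.dproj q v) = v :=
  congrArg Subtype.val
    (LinearEquiv.symm_apply_apply (LinearEquiv.ofBijective _ (S.dproj_bijective q)) ⟨v, hv⟩)

theorem eq_hlift {q : Q} {v : TangentSpace 𝓘(ℝ, EQ) q} (hv : v ∈ S.dist q)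
    {u : TangentSpace 𝓘(ℝ, EM) (S.proj q)} (h : S.dproj q v = u) : v = S.hlift q u := by
  rw [← h, S.hlift_dproj hv]

theorem vertProj_apply (q : Q) (v : TangentSpace 𝓘(ℝ, EQ) q) :
    S.vertProj q v = v - S.hlift q (S.dproj q v) := by
  have hk : v - S.hlift q (S.dproj q v) ∈ S.vert q := by
    change S.dproj q (v - S.hlift q (S.dproj q v)) = 0
    rw [map_sub, dproj_hlift, sub_self]
  have h1 : S.vertProj q (v - S.hlift q (S.dproj q v)) = v - S.hlift q (S.dproj q v) :=
    Submodule.projection_apply_of_mem_left _ hk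
  have h2 : S.vertProj q (S.hlift q (S.dproj q v)) = 0 :=
    Submodule.projection_apply_of_mem_right _ (S.hlift_mem q _)
  conv_lhs => rw [← sub_add_cancel v (S.hlift q (S.dproj q v))]
  rw [map_add, h1, h2, add_zero]

theorem sub_orthProj_mem (q : Q) (v : TangentSpace 𝓘(ℝ, EQ) q) :
    v - S.orthProj q v ∈ S.distOrth q :=
  Submodule.sub_projection_mem (S.isCompl_distOrth q) v

theorem orthProj_mem (q : Q) (v : TangentSpace 𝓘(ℝ, EQ) q) : S.orthProj q v ∈ S.dist q :=
  Submodule.projection_apply_mem (S.isCompl_distOrth q) v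

theorem metric_orthProj {q : Q} (v : TangentSpace 𝓘(ℝ, EQ) q) {d : TangentSpace 𝓘(ℝ, EQ) q}
    (hd : d ∈ S.dist q) : S.metric.inner q (S.orthProj q v) d = S.metric.inner q v d := by
  have h := S.sub_orthProj_mem q v d hd
  rw [map_sub, sub_apply, sub_eq_zero] at h
  exact h.symm

/-! ## The system in charts -/

/-- The bundle projection in charts. -/
noncomputable def projCoord (q₀ : Q) (p₀ : M) (y : EQ) : EM :=
  extChartAt 𝓘(ℝ, EM) p₀ (S.proj ((extChartAt 𝓘(ℝ, EQ) q₀).symm y))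

/-- The horizontal lift in charts. -/
noncomputable def liftCoord (q₀ : Q) (p₀ : M) (y : EQ) : EM →L[ℝ] EQ :=
  LinearMap.toContinuousLinearMap
    ((toCoord q₀ ((extChartAt 𝓘(ℝ, EQ) q₀).symm y)).toLinearMap ∘ₗ
      S.hliftₗ ((extChartAt 𝓘(ℝ, EQ) q₀).symm y) ∘ₗ
      (ofCoord p₀ (S.proj ((extChartAt 𝓘(ℝ, EQ) q₀).symm y))).toLinearMap)

variable {S} {q₀ q : Q} {p₀ : M}

theorem liftCoord_apply (hq : q ∈ (extChartAt 𝓘(ℝ, EQ) q₀).source) (u : EM) :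
    S.liftCoord q₀ p₀ (extChartAt 𝓘(ℝ, EQ) q₀ q) u =
      toCoord q₀ q (S.hlift q (ofCoord p₀ (S.proj q) u)) := by
  change toCoord q₀ ((extChartAt 𝓘(ℝ, EQ) q₀).symm (extChartAt 𝓘(ℝ, EQ) q₀ q))
    (S.hlift _ (ofCoord p₀ _ u)) = _
  rw [(extChartAt 𝓘(ℝ, EQ) q₀).left_inv hq]

theorem projCoord_apply (hq : q ∈ (extChartAt 𝓘(ℝ, EQ) q₀).source) :
    S.projCoord q₀ p₀ (extChartAt 𝓘(ℝ, EQ) q₀ q) = extChartAt 𝓘(ℝ, EM) p₀ (S.proj q) := by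
  rw [projCoord, (extChartAt 𝓘(ℝ, EQ) q₀).left_inv hq]

theorem eventually_coord (hq : q ∈ (extChartAt 𝓘(ℝ, EQ) q₀).source) {V : Set Q} (hV : V ∈ 𝓝 q)
    {P : EQ → Prop}
    (h : ∀ q' ∈ V, q' ∈ (extChartAt 𝓘(ℝ, EQ) q₀).source → P (extChartAt 𝓘(ℝ, EQ) q₀ q')) :
    ∀ᶠ y in 𝓝 (extChartAt 𝓘(ℝ, EQ) q₀ q), P y := by
  filter_upwards [target_mem_nhds hq, (continuousAt_symm hq).eventually hV] with y hy hyV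
  have := h _ hyV ((extChartAt 𝓘(ℝ, EQ) q₀).map_target hy)
  rwa [(extChartAt 𝓘(ℝ, EQ) q₀).right_inv hy] at this

theorem proj_source_mem_nhds (hp : S.proj q ∈ (extChartAt 𝓘(ℝ, EM) p₀).source) :
    S.proj ⁻¹' (extChartAt 𝓘(ℝ, EM) p₀).source ∈ 𝓝 q :=
  S.proj_smooth.continuous.continuousAt.preimage_mem_nhds
    ((isOpen_extChartAt_source p₀).mem_nhds hp)

theorem contDiffAt_projCoord (hq : q ∈ (extChartAt 𝓘(ℝ, EQ) q₀).source)
    (hp : S.proj q ∈ (extChartAt 𝓘(ℝ, EM) p₀).source) :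
    ContDiffAt ℝ ∞ (S.projCoord q₀ p₀) (extChartAt 𝓘(ℝ, EQ) q₀ q) := by
  have h : ContMDiffAt 𝓘(ℝ, EQ) 𝓘(ℝ, EM) ∞ (fun q => extChartAt 𝓘(ℝ, EM) p₀ (S.proj q)) q :=
    (contMDiffAt_extChartAt'' hp).comp q S.proj_smooth.contMDiffAt
  exact (contMDiffAt_iff_comp_symm hq).1 h

theorem fderiv_projCoord (hq : q ∈ (extChartAt 𝓘(ℝ, EQ) q₀).source)
    (hp : S.proj q ∈ (extChartAt 𝓘(ℝ, EM) p₀).source) (v : TangentSpace 𝓘(ℝ, EQ) q) :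
    fderiv ℝ (S.projCoord q₀ p₀) (extChartAt 𝓘(ℝ, EQ) q₀ q) (toCoord q₀ q v) =
      toCoord p₀ (S.proj q) (S.dproj q v) := by
  have hc := (contMDiffAt_extChartAt'' hp).mdifferentiableAt (by simp)
  have hπ := (S.proj_smooth.contMDiffAt (x := q)).mdifferentiableAt (by simp)
  have h := mvfderiv_eq_fderiv hq (f := fun q => extChartAt 𝓘(ℝ, EM) p₀ (S.proj q))
    (hc.comp q hπ) v
  refine Eq.trans h.symm ?_
  have h2 := DFunLike.congr_fun (mfderiv_comp (I := 𝓘(ℝ, EQ)) (I' := 𝓘(ℝ, EM))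
    (I'' := 𝓘(ℝ, EM)) q hc hπ) v
  rw [toCoord_eq_mfderiv hp]
  exact h2

theorem fderiv_projCoord_liftCoord (hq : q ∈ (extChartAt 𝓘(ℝ, EQ) q₀).source)
    (hp : S.proj q ∈ (extChartAt 𝓘(ℝ, EM) p₀).source) (u : EM) :
    fderiv ℝ (S.projCoord q₀ p₀) (extChartAt 𝓘(ℝ, EQ) q₀ q)
      (S.liftCoord q₀ p₀ (extChartAt 𝓘(ℝ, EQ) q₀ q) u) = u := by
  rw [liftCoord_apply hq, fderiv_projCoord hq hp, dproj_hlift, toCoord_ofCoord hp]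

theorem liftCoord_fderiv_projCoord (hq : q ∈ (extChartAt 𝓘(ℝ, EQ) q₀).source)
    (hp : S.proj q ∈ (extChartAt 𝓘(ℝ, EM) p₀).source) (v : TangentSpace 𝓘(ℝ, EQ) q) :
    S.liftCoord q₀ p₀ (extChartAt 𝓘(ℝ, EQ) q₀ q)
      (fderiv ℝ (S.projCoord q₀ p₀) (extChartAt 𝓘(ℝ, EQ) q₀ q) (toCoord q₀ q v)) =
      toCoord q₀ q (S.hlift q (S.dproj q v)) := by
  rw [liftCoord_apply hq, fderiv_projCoord hq hp, ofCoord_toCoord hp]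

/-- A local spanning family of the distribution defines a smooth map Φ from tuples to tangent
vectors, and A = Dπ ∘ Φ is invertible. The lift equals Φ ∘ A⁻¹, and inversion of linear maps is
smooth. -/
theorem contDiffAt_liftCoord (hq : q ∈ (extChartAt 𝓘(ℝ, EQ) q₀).source)
    (hp : S.proj q ∈ (extChartAt 𝓘(ℝ, EM) p₀).source) :
    ContDiffAt ℝ ∞ (S.liftCoord q₀ p₀) (extChartAt 𝓘(ℝ, EQ) q₀ q) := by
  obtain ⟨N, hN, X, hX, hspan⟩ := S.dist_smooth q
  have := FiniteDimensional.complete ℝ EM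
  let m := Module.finrank ℝ EM
  let Φ : EQ → (Fin m → ℝ) →L[ℝ] EQ := fun y =>
    ∑ a, (ContinuousLinearMap.proj a : (Fin m → ℝ) →L[ℝ] ℝ).smulRight (fieldRep q₀ (X a) y)
  have hΦ : ∀ y c, Φ y c = ∑ a, c a • fieldRep q₀ (X a) y := fun y c => by
    simp [Φ]
  have hΦs : ContDiffAt ℝ ∞ Φ (extChartAt 𝓘(ℝ, EQ) q₀ q) := by
    refine Bil.contDiffAt_clm_of_apply fun c => ?_
    simp only [hΦ]
    refine ContDiffAt.sum fun a _ => ContDiffAt.const_smul _ ?_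
    exact (contMDiffAt_iff_fieldRep hq).1 ((hX a).contMDiffAt hN)
  let A : EQ → (Fin m → ℝ) →L[ℝ] EM := fun y => (fderiv ℝ (S.projCoord q₀ p₀) y).comp (Φ y)
  have hA : ContDiffAt ℝ ∞ A (extChartAt 𝓘(ℝ, EQ) q₀ q) :=
    ((contDiffAt_projCoord hq hp).fderiv_right (by simp)).clm_comp hΦs
  have key : ∀ q' ∈ N ∩ S.proj ⁻¹' (extChartAt 𝓘(ℝ, EM) p₀).source,
      q' ∈ (extChartAt 𝓘(ℝ, EQ) q₀).source →
      (A (extChartAt 𝓘(ℝ, EQ) q₀ q')).IsInvertible ∧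
      S.liftCoord q₀ p₀ (extChartAt 𝓘(ℝ, EQ) q₀ q') =
        (Φ (extChartAt 𝓘(ℝ, EQ) q₀ q')).comp (A (extChartAt 𝓘(ℝ, EQ) q₀ q')).inverse := by
    rintro q' ⟨hN', hp'⟩ hq'
    have hΦ' : ∀ c, Φ (extChartAt 𝓘(ℝ, EQ) q₀ q') c = toCoord q₀ q' (∑ a, c a • X a q') := by
      intro c
      rw [hΦ, map_sum]
      simp only [map_smul, fieldRep_extChartAt hq']
    have hsurj : Function.Surjective (A (extChartAt 𝓘(ℝ, EQ) q₀ q')) := by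
      intro u
      have hm := S.hlift_mem q' (ofCoord p₀ (S.proj q') u)
      rw [hspan q' hN', Submodule.mem_span_range_iff_exists_fun] at hm
      obtain ⟨c, hc⟩ := hm
      refine ⟨c, ?_⟩
      change fderiv ℝ (S.projCoord q₀ p₀) _ (Φ _ c) = u
      rw [hΦ', hc, fderiv_projCoord hq' hp', dproj_hlift, toCoord_ofCoord hp']
    -- The spanning family has exactly dim M members, so surjectivity forces injectivity.
    have hinj : Function.Injective (A (extChartAt 𝓘(ℝ, EQ) q₀ q')) :=
      (LinearMap.injective_iff_surjective_of_finrank_eq_finrank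
        (f := (A (extChartAt 𝓘(ℝ, EQ) q₀ q')).toLinearMap) (by simp [m])).2 hsurj
    let e : (Fin m → ℝ) ≃L[ℝ] EM := (LinearEquiv.ofBijective
      (A (extChartAt 𝓘(ℝ, EQ) q₀ q')).toLinearMap ⟨hinj, hsurj⟩).toContinuousLinearEquiv
    have he : (e : (Fin m → ℝ) →L[ℝ] EM) = A (extChartAt 𝓘(ℝ, EQ) q₀ q') := by
      ext; rfl
    refine ⟨⟨e, he⟩, ?_⟩
    rw [← he, ContinuousLinearMap.inverse_equiv]
    ext u
    obtain ⟨c, rfl⟩ := e.surjective u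
    have hec : e c = fderiv ℝ (S.projCoord q₀ p₀) (extChartAt 𝓘(ℝ, EQ) q₀ q')
      (Φ (extChartAt 𝓘(ℝ, EQ) q₀ q') c) := rfl
    have hmem : ∑ a, c a • X a q' ∈ S.dist q' := by
      rw [hspan q' hN', Submodule.mem_span_range_iff_exists_fun]
      exact ⟨c, rfl⟩
    rw [ContinuousLinearMap.comp_apply, ContinuousLinearEquiv.coe_coe, e.symm_apply_apply, hec, hΦ',
      liftCoord_fderiv_projCoord hq' hp', S.hlift_dproj hmem]
  have hNn : N ∩ S.proj ⁻¹' (extChartAt 𝓘(ℝ, EM) p₀).source ∈ 𝓝 q :=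
    inter_mem hN (proj_source_mem_nhds hp)
  have hinv := (key q (mem_of_mem_nhds hNn) hq).1
  have hcd : ContDiffAt ℝ ∞ (fun y => (Φ y).comp (A y).inverse) (extChartAt 𝓘(ℝ, EQ) q₀ q) :=
    hΦs.clm_comp ((ContinuousLinearMap.IsInvertible.contDiffAt_map_inverse hinv).comp _ hA)
  exact hcd.congr_of_eventuallyEq (eventually_coord hq hNn fun q' h1 h2 => (key q' h1 h2).2)

variable (S)

/-! ## Curvature in charts -/

/-- The horizontal projection in charts. -/
noncomputable def horCoord (q₀ : Q) (p₀ : M) (y : EQ) : EQ →L[ℝ] EQ :=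
  (S.liftCoord q₀ p₀ y).comp (fderiv ℝ (S.projCoord q₀ p₀) y)

variable {S}

theorem horCoord_toCoord (hq : q ∈ (extChartAt 𝓘(ℝ, EQ) q₀).source)
    (hp : S.proj q ∈ (extChartAt 𝓘(ℝ, EM) p₀).source) (v : TangentSpace 𝓘(ℝ, EQ) q) :
    S.horCoord q₀ p₀ (extChartAt 𝓘(ℝ, EQ) q₀ q) (toCoord q₀ q v) =
      toCoord q₀ q (S.hlift q (S.dproj q v)) :=
  liftCoord_fderiv_projCoord hq hp v

theorem contDiffAt_horCoord (hq : q ∈ (extChartAt 𝓘(ℝ, EQ) q₀).source)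
    (hp : S.proj q ∈ (extChartAt 𝓘(ℝ, EM) p₀).source) :
    ContDiffAt ℝ ∞ (S.horCoord q₀ p₀) (extChartAt 𝓘(ℝ, EQ) q₀ q) :=
  (contDiffAt_liftCoord hq hp).clm_comp ((contDiffAt_projCoord hq hp).fderiv_right (by simp))

theorem horCoord_section (hq : q ∈ (extChartAt 𝓘(ℝ, EQ) q₀).source)
    (hp : S.proj q ∈ (extChartAt 𝓘(ℝ, EM) p₀).source) {X : (q : Q) → TangentSpace 𝓘(ℝ, EQ) q}
    (hX : ∀ᶠ x in 𝓝 q, X x ∈ S.dist x) :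
    ∀ᶠ y in 𝓝 (extChartAt 𝓘(ℝ, EQ) q₀ q),
      S.horCoord q₀ p₀ y (fieldRep q₀ X y) = fieldRep q₀ X y := by
  refine eventually_coord hq (inter_mem hX (proj_source_mem_nhds hp)) ?_
  rintro q' ⟨h1, h2⟩ hq'
  rw [fieldRep_extChartAt hq', horCoord_toCoord hq' h2, S.hlift_dproj h1]

theorem horCoord_idem (hq : q ∈ (extChartAt 𝓘(ℝ, EQ) q₀).source)
    (hp : S.proj q ∈ (extChartAt 𝓘(ℝ, EM) p₀).source) :
    ∀ᶠ y in 𝓝 (extChartAt 𝓘(ℝ, EQ) q₀ q),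
      ∀ a, S.horCoord q₀ p₀ y (S.horCoord q₀ p₀ y a) = S.horCoord q₀ p₀ y a := by
  refine eventually_coord hq (proj_source_mem_nhds hp) ?_
  intro q' h2 hq' a
  obtain ⟨v, rfl⟩ : ∃ v, toCoord q₀ q' v = a := ⟨_, toCoord_ofCoord hq' a⟩
  rw [horCoord_toCoord hq' h2, horCoord_toCoord hq' h2, dproj_hlift]

/-- This is `lieBracket_sub_proj` for the horizontal projection. It makes the vertical part of the
bracket depend only on the values of the two sections at the point. -/
theorem toCoord_vertProj_mlieBracket (hq : q ∈ (extChartAt 𝓘(ℝ, EQ) q₀).source)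
    (hp : S.proj q ∈ (extChartAt 𝓘(ℝ, EM) p₀).source) {X Z : (q : Q) → TangentSpace 𝓘(ℝ, EQ) q}
    (hXs : ContMDiffAt 𝓘(ℝ, EQ) 𝓘(ℝ, EQ).tangent ∞
      (fun x => (⟨x, X x⟩ : TangentBundle 𝓘(ℝ, EQ) Q)) q)
    (hZs : ContMDiffAt 𝓘(ℝ, EQ) 𝓘(ℝ, EQ).tangent ∞
      (fun x => (⟨x, Z x⟩ : TangentBundle 𝓘(ℝ, EQ) Q)) q)
    (hX : ∀ᶠ x in 𝓝 q, X x ∈ S.dist x) (hZ : ∀ᶠ x in 𝓝 q, Z x ∈ S.dist x) :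
    toCoord q₀ q (S.vertProj q (VectorField.mlieBracket 𝓘(ℝ, EQ) X Z q)) =
      curvForm (S.horCoord q₀ p₀) (extChartAt 𝓘(ℝ, EQ) q₀ q) (toCoord q₀ q (X q))
        (toCoord q₀ q (Z q)) := by
  have := FiniteDimensional.complete ℝ EQ
  rw [vertProj_apply, map_sub, ← horCoord_toCoord hq hp, toCoord_mlieBracket hq hXs hZs,
    ← fieldRep_extChartAt hq, ← fieldRep_extChartAt hq]
  exact lieBracket_sub_proj ((contDiffAt_horCoord hq hp).differentiableAt (by simp))
    (((contMDiffAt_iff_fieldRep hq).1 hXs).differentiableAt (by simp))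
    (((contMDiffAt_iff_fieldRep hq).1 hZs).differentiableAt (by simp))
    (horCoord_section hq hp hX) (horCoord_section hq hp hZ)

theorem fieldRep_hliftField (hq : q ∈ (extChartAt 𝓘(ℝ, EQ) q₀).source)
    (hp : S.proj q ∈ (extChartAt 𝓘(ℝ, EM) p₀).source)
    (X : (p : M) → TangentSpace 𝓘(ℝ, EM) p) :
    fieldRep q₀ (S.hliftField X) =ᶠ[𝓝 (extChartAt 𝓘(ℝ, EQ) q₀ q)]
      fun y => S.liftCoord q₀ p₀ y (fieldRep p₀ X (S.projCoord q₀ p₀ y)) := by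
  refine eventually_coord hq (proj_source_mem_nhds hp) ?_
  intro q' h2 hq'
  beta_reduce
  rw [fieldRep_extChartAt hq', liftCoord_apply hq', projCoord_apply hq', fieldRep_extChartAt h2,
    ofCoord_toCoord h2, hliftField]

theorem contMDiffAt_hliftField {X : (p : M) → TangentSpace 𝓘(ℝ, EM) p}
    (hX : ContMDiffAt 𝓘(ℝ, EM) 𝓘(ℝ, EM).tangent ∞
      (fun x => (⟨x, X x⟩ : TangentBundle 𝓘(ℝ, EM) M)) (S.proj q)) :
    ContMDiffAt 𝓘(ℝ, EQ) 𝓘(ℝ, EQ).tangent ∞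
      (fun x => (⟨x, S.hliftField X x⟩ : TangentBundle 𝓘(ℝ, EQ) Q)) q := by
  have hq : q ∈ (extChartAt 𝓘(ℝ, EQ) q).source := mem_extChartAt_source q
  have hp : S.proj q ∈ (extChartAt 𝓘(ℝ, EM) (S.proj q)).source := mem_extChartAt_source _
  rw [contMDiffAt_iff_fieldRep hq]
  refine ContDiffAt.congr_of_eventuallyEq ?_ (fieldRep_hliftField hq hp X)
  have h : ContDiffAt ℝ ∞ (fieldRep (S.proj q) X ∘ S.projCoord q (S.proj q))
      (extChartAt 𝓘(ℝ, EQ) q q) :=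
    ContDiffAt.comp _ (by rw [projCoord_apply hq]; exact (contMDiffAt_iff_fieldRep hp).1 hX)
      (contDiffAt_projCoord hq hp)
  exact (contDiffAt_liftCoord hq hp).clm_apply h

theorem hliftField_mem (X : (p : M) → TangentSpace 𝓘(ℝ, EM) p) (q : Q) :
    S.hliftField X q ∈ S.dist q := S.hlift_mem q _

theorem toCoord_curvature (hq : q ∈ (extChartAt 𝓘(ℝ, EQ) q₀).source)
    (hp : S.proj q ∈ (extChartAt 𝓘(ℝ, EM) p₀).source)
    (u v : TangentSpace 𝓘(ℝ, EM) (S.proj q)) :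
    toCoord q₀ q (S.curvature q u v) =
      curvForm (S.horCoord q₀ p₀) (extChartAt 𝓘(ℝ, EQ) q₀ q) (toCoord q₀ q (S.hlift q u))
        (toCoord q₀ q (S.hlift q v)) := by
  have hext : ∀ w : TangentSpace 𝓘(ℝ, EM) (S.proj q),
      ContMDiffAt 𝓘(ℝ, EM) 𝓘(ℝ, EM).tangent ∞
        (fun x => (⟨x, FiberBundle.extend EM w x⟩ : TangentBundle 𝓘(ℝ, EM) M)) (S.proj q) :=
    fun w => FiberBundle.contMDiffAt_extend 𝓘(ℝ, EM) EM w
  rw [curvature, toCoord_vertProj_mlieBracket hq hp (contMDiffAt_hliftField (hext u))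
    (contMDiffAt_hliftField (hext v)) (Eventually.of_forall (hliftField_mem _))
    (Eventually.of_forall (hliftField_mem _))]
  rw [hliftField, hliftField, FiberBundle.extend_apply_self, FiberBundle.extend_apply_self]

/-- By tensoriality the extensions used in `curvature` may be replaced by any horizontal fields with
the same values, in particular by invariant ones. -/
theorem vertProj_mlieBracket {X Z : (q : Q) → TangentSpace 𝓘(ℝ, EQ) q}
    (hXs : ContMDiffAt 𝓘(ℝ, EQ) 𝓘(ℝ, EQ).tangent ∞
      (fun x => (⟨x, X x⟩ : TangentBundle 𝓘(ℝ, EQ) Q)) q)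
    (hZs : ContMDiffAt 𝓘(ℝ, EQ) 𝓘(ℝ, EQ).tangent ∞
      (fun x => (⟨x, Z x⟩ : TangentBundle 𝓘(ℝ, EQ) Q)) q)
    (hX : ∀ᶠ x in 𝓝 q, X x ∈ S.dist x) (hZ : ∀ᶠ x in 𝓝 q, Z x ∈ S.dist x) :
    S.vertProj q (VectorField.mlieBracket 𝓘(ℝ, EQ) X Z q) =
      S.curvature q (S.dproj q (X q)) (S.dproj q (Z q)) := by
  have hq : q ∈ (extChartAt 𝓘(ℝ, EQ) q).source := mem_extChartAt_source q
  have hp : S.proj q ∈ (extChartAt 𝓘(ℝ, EM) (S.proj q)).source := mem_extChartAt_source _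
  apply toCoord_injective hq
  rw [toCoord_vertProj_mlieBracket hq hp hXs hZs hX hZ, toCoord_curvature hq hp,
    S.hlift_dproj hX.self_of_nhds, S.hlift_dproj hZ.self_of_nhds]

theorem curvature_add_left (q : Q) (u u' v : TangentSpace 𝓘(ℝ, EM) (S.proj q)) :
    S.curvature q (u + u') v = S.curvature q u v + S.curvature q u' v := by
  have hq : q ∈ (extChartAt 𝓘(ℝ, EQ) q).source := mem_extChartAt_source q
  have hp : S.proj q ∈ (extChartAt 𝓘(ℝ, EM) (S.proj q)).source := mem_extChartAt_source _
  apply toCoord_injective hq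
  rw [map_add, toCoord_curvature hq hp, toCoord_curvature hq hp, toCoord_curvature hq hp,
    hlift_add, map_add]
  simp only [curvForm, map_add, add_apply]
  abel

theorem curvature_smul_left (q : Q) (c : ℝ) (u v : TangentSpace 𝓘(ℝ, EM) (S.proj q)) :
    S.curvature q (c • u) v = c • S.curvature q u v := by
  have hq : q ∈ (extChartAt 𝓘(ℝ, EQ) q).source := mem_extChartAt_source q
  have hp : S.proj q ∈ (extChartAt 𝓘(ℝ, EM) (S.proj q)).source := mem_extChartAt_source _
  apply toCoord_injective hq
  rw [map_smul, toCoord_curvature hq hp, toCoord_curvature hq hp, hlift_smul, map_smul]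
  simp only [curvForm, map_smul, smul_apply, smul_sub]

theorem curvature_swap (q : Q) (u v : TangentSpace 𝓘(ℝ, EM) (S.proj q)) :
    S.curvature q u v = -S.curvature q v u := by
  have hq : q ∈ (extChartAt 𝓘(ℝ, EQ) q).source := mem_extChartAt_source q
  have hp : S.proj q ∈ (extChartAt 𝓘(ℝ, EM) (S.proj q)).source := mem_extChartAt_source _
  apply toCoord_injective hq
  rw [map_neg, toCoord_curvature hq hp, toCoord_curvature hq hp, curvForm, curvForm, neg_sub]

/-! ## The gyroscopic tensor -/

variable (S)

/-- The gyroscopic tensor as a bilinear map. -/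
noncomputable def gyroₗ (q : Q) : TangentSpace 𝓘(ℝ, EM) (S.proj q) →ₗ[ℝ]
    TangentSpace 𝓘(ℝ, EM) (S.proj q) →ₗ[ℝ] TangentSpace 𝓘(ℝ, EM) (S.proj q) :=
  LinearMap.mk₂ ℝ (fun u v => S.gyroscopicTensor q u v)
    (fun u u' v => by simp only [gyroscopicTensor, curvature_add_left, map_add])
    (fun c u v => by simp only [gyroscopicTensor, curvature_smul_left, map_smul])
    (fun u v v' => by
      simp only [gyroscopicTensor]
      rw [curvature_swap, curvature_add_left, curvature_swap q v u, curvature_swap q v' u, neg_add]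
      simp only [map_add, neg_neg])
    (fun c u v => by
      simp only [gyroscopicTensor]
      rw [curvature_swap, curvature_smul_left, curvature_swap q v u]
      simp only [map_smul, smul_neg, neg_neg])

theorem gyroₗ_apply (q : Q) (u v : TangentSpace 𝓘(ℝ, EM) (S.proj q)) :
    S.gyroₗ q u v = S.gyroscopicTensor q u v := rfl

theorem gyroscopicTensor_swap (q : Q) (u v : TangentSpace 𝓘(ℝ, EM) (S.proj q)) :
    S.gyroscopicTensor q u v = -S.gyroscopicTensor q v u := by
  simp only [gyroscopicTensor]
  rw [curvature_swap, map_neg, map_neg]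

theorem beta_eq_trace (q : Q) (Y : TangentSpace 𝓘(ℝ, EM) (S.proj q)) :
    S.beta q Y = LinearMap.trace ℝ _ ((S.gyroₗ q).flip Y) := by
  have : FiniteDimensional ℝ (TangentSpace 𝓘(ℝ, EM) (S.proj q)) :=
    inferInstanceAs (FiniteDimensional ℝ EM)
  rw [LinearMap.trace_eq_matrix_trace ℝ
    (Module.finBasis ℝ (TangentSpace 𝓘(ℝ, EM) (S.proj q))), Matrix.trace, beta]
  refine Finset.sum_congr rfl fun a _ => ?_
  rw [Matrix.diag_apply, LinearMap.toMatrix_apply]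
  rfl

/-- Pairing with a horizontal vector does not see the orthogonal projection. -/
theorem metricCurv_eq (q : Q) (u v w : TangentSpace 𝓘(ℝ, EM) (S.proj q)) :
    S.metricCurv q u v w = S.redMetric q u (S.gyroscopicTensor q v w) := by
  rw [metricCurv, redMetric, gyroscopicTensor, S.hlift_dproj (S.orthProj_mem q _),
    S.metric.symm, S.metric.symm q (S.hlift q u), S.metric_orthProj _ (S.hlift_mem q u)]

theorem redMetric_symm (q : Q) (u v : TangentSpace 𝓘(ℝ, EM) (S.proj q)) :
    S.redMetric q u v = S.redMetric q v u := S.metric.symm q _ _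

theorem redMetric_pos (q : Q) {u : TangentSpace 𝓘(ℝ, EM) (S.proj q)} (hu : u ≠ 0) :
    0 < S.redMetric q u u := by
  refine S.metric.pos q _ fun h => hu ?_
  rw [← S.dproj_hlift q u, h, map_zero]

theorem redMetric_add_left (q : Q) (u u' v : TangentSpace 𝓘(ℝ, EM) (S.proj q)) :
    S.redMetric q (u + u') v = S.redMetric q u v + S.redMetric q u' v := by
  simp only [redMetric, hlift_add, map_add, add_apply]

theorem redMetric_smul_left (q : Q) (c : ℝ) (u v : TangentSpace 𝓘(ℝ, EM) (S.proj q)) :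
    S.redMetric q (c • u) v = c * S.redMetric q u v := by
  simp only [redMetric, hlift_smul, map_smul, smul_apply, smul_eq_mul]

theorem redMetric_add_right (q : Q) (u v v' : TangentSpace 𝓘(ℝ, EM) (S.proj q)) :
    S.redMetric q u (v + v') = S.redMetric q u v + S.redMetric q u v' := by
  simp only [redMetric, hlift_add, map_add]

theorem redMetric_smul_right (q : Q) (c : ℝ) (u v : TangentSpace 𝓘(ℝ, EM) (S.proj q)) :
    S.redMetric q u (c • v) = c * S.redMetric q u v := by
  simp only [redMetric, hlift_smul, map_smul, smul_eq_mul]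

/-! ## Invariance under the group -/

variable {S}

theorem proj_smul (h : G) (q : Q) : S.proj (h • q) = S.proj q :=
  ((S.proj_eq_iff q (h • q)).2 ⟨h, rfl⟩).symm

variable (Q) in
/-- The tangent map of the action of `h`. -/
noncomputable def dact (h : G) (q : Q) :
    TangentSpace 𝓘(ℝ, EQ) q →L[ℝ] TangentSpace 𝓘(ℝ, EQ) (h • q) :=
  mfderiv 𝓘(ℝ, EQ) 𝓘(ℝ, EQ) (fun x : Q => h • x) q

theorem toCoord_dproj (hp : S.proj q ∈ (extChartAt 𝓘(ℝ, EM) p₀).source)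
    (v : TangentSpace 𝓘(ℝ, EQ) q) :
    toCoord p₀ (S.proj q) (S.dproj q v) =
      mfderiv 𝓘(ℝ, EQ) 𝓘(ℝ, EM) (fun q => extChartAt 𝓘(ℝ, EM) p₀ (S.proj q)) q v := by
  have hc := (contMDiffAt_extChartAt'' hp).mdifferentiableAt (by simp)
  have hπ := (S.proj_smooth.contMDiffAt (x := q)).mdifferentiableAt (by simp)
  rw [toCoord_eq_mfderiv hp]
  exact (DFunLike.congr_fun (mfderiv_comp (I := 𝓘(ℝ, EQ)) (I' := 𝓘(ℝ, EM))
    (I'' := 𝓘(ℝ, EM)) q hc hπ) v).symm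

/-- The derivative of π ∘ h = π. Components in a chart are compared because the tangent spaces at
`S.proj (h • q)` and `S.proj q` are different types. -/
theorem toCoord_dproj_dact (hp : S.proj q ∈ (extChartAt 𝓘(ℝ, EM) p₀).source) (h : G)
    (v : TangentSpace 𝓘(ℝ, EQ) q) :
    toCoord p₀ (S.proj (h • q)) (S.dproj (h • q) (dact Q h q v)) =
      toCoord p₀ (S.proj q) (S.dproj q v) := by
  have hp' : S.proj (h • q) ∈ (extChartAt 𝓘(ℝ, EM) p₀).source := by rwa [proj_smul]
  have hc := (contMDiffAt_extChartAt'' hp').mdifferentiableAt (by simp)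
  have hπ := (S.proj_smooth.contMDiffAt (x := h • q)).mdifferentiableAt (by simp)
  have ha := ((ContMDiffSMul.contMDiff_const_smul (I := 𝓘(ℝ, EG)) (I' := 𝓘(ℝ, EQ)) (n := ∞)
    (M := Q) h).contMDiffAt (x := q)).mdifferentiableAt
    (by simp)
  rw [toCoord_dproj hp', toCoord_dproj hp]
  have h2 := DFunLike.congr_fun (mfderiv_comp (I := 𝓘(ℝ, EQ)) (I' := 𝓘(ℝ, EQ))
    (I'' := 𝓘(ℝ, EM)) q (hc.comp _ hπ) ha) v
  refine h2.symm.trans ?_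
  have h3 : (extChartAt 𝓘(ℝ, EM) p₀ ∘ S.proj) ∘ (fun x : Q => h • x) =
      fun q => extChartAt 𝓘(ℝ, EM) p₀ (S.proj q) := by
    funext x
    simp [proj_smul]
  rw [h3]

/-- A lift is characterised by lying in the distribution and by its projection, and the action
respects both. -/
theorem dact_hlift (hp : S.proj q ∈ (extChartAt 𝓘(ℝ, EM) p₀).source) (h : G) (u : EM) :
    dact Q h q (S.hlift q (ofCoord p₀ (S.proj q) u)) =
      S.hlift (h • q) (ofCoord p₀ (S.proj (h • q)) u) := by
  have hp' : S.proj (h • q) ∈ (extChartAt 𝓘(ℝ, EM) p₀).source := by rwa [proj_smul]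
  refine S.eq_hlift ?_ (toCoord_injective hp' ?_)
  · rw [← S.dist_invariant]
    exact Submodule.mem_map_of_mem (S.hlift_mem q _)
  · rw [toCoord_dproj_dact hp, dproj_hlift, toCoord_ofCoord hp, toCoord_ofCoord hp']

theorem dact_vertProj (h : G) (v : TangentSpace 𝓘(ℝ, EQ) q) :
    dact Q h q (S.vertProj q v) = S.vertProj (h • q) (dact Q h q v) := by
  have hp : S.proj q ∈ (extChartAt 𝓘(ℝ, EM) (S.proj q)).source := mem_extChartAt_source _
  have hp' : S.proj (h • q) ∈ (extChartAt 𝓘(ℝ, EM) (S.proj q)).source := by rwa [proj_smul]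
  rw [vertProj_apply, vertProj_apply, map_sub, ← ofCoord_toCoord hp (S.dproj q v), dact_hlift hp,
    ← toCoord_dproj_dact hp, ofCoord_toCoord hp']

theorem isInvertible_dact (hs : ∀ k : G, ContMDiff 𝓘(ℝ, EQ) 𝓘(ℝ, EQ) ∞ (fun x : Q => k • x)) (h : G) (q : Q) : (dact (EQ := EQ) Q h q).IsInvertible := by
  have hh : ∀ (k : G) (x : Q), MDifferentiableAt 𝓘(ℝ, EQ) 𝓘(ℝ, EQ) (fun x : Q => k • x) x :=
    fun k x => ((hs k).contMDiffAt (x := x)).mdifferentiableAt (by simp)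
  have key : ∀ k l : G, l * k = 1 → ∀ (x y : Q), y = k • x → ∀ v : EQ,
      @Eq EQ (mfderiv 𝓘(ℝ, EQ) 𝓘(ℝ, EQ) (fun x : Q => l • x) y
        (mfderiv 𝓘(ℝ, EQ) 𝓘(ℝ, EQ) (fun x : Q => k • x) x v)) v := by
    rintro k l hkl x _ rfl v
    have h2 := DFunLike.congr_fun (mfderiv_comp (I := 𝓘(ℝ, EQ)) (I' := 𝓘(ℝ, EQ))
      (I'' := 𝓘(ℝ, EQ)) x (hh l (k • x)) (hh k x)) v
    refine Eq.trans h2.symm ?_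
    have h3 : (fun x : Q => l • x) ∘ (fun x : Q => k • x) = id := by
      funext x
      simp [smul_smul, hkl]
    rw [h3]
    exact DFunLike.congr_fun (mfderiv_id (I := 𝓘(ℝ, EQ)) (x := x)) v
  have h1 := key h h⁻¹ (by simp) q (h • q) rfl
  have h2 := key h⁻¹ h (by simp) (h • q) q (by simp)
  exact ⟨ContinuousLinearEquiv.equivOfInverse (dact Q h q)
    (mfderiv 𝓘(ℝ, EQ) 𝓘(ℝ, EQ) (fun x : Q => h⁻¹ • x) (h • q)) h1 h2, by ext; rfl⟩

/-- Invariant fields are their own pullbacks under the diffeomorphism h, and the bracket is natural.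
-/
theorem mlieBracket_smul (hs : ∀ k : G, ContMDiff 𝓘(ℝ, EQ) 𝓘(ℝ, EQ) ∞ (fun x : Q => k • x))
    {X Y : (q : Q) → TangentSpace 𝓘(ℝ, EQ) q} {h : G}
    (hXs : ContMDiffAt 𝓘(ℝ, EQ) 𝓘(ℝ, EQ).tangent ∞
      (fun x => (⟨x, X x⟩ : TangentBundle 𝓘(ℝ, EQ) Q)) (h • q))
    (hYs : ContMDiffAt 𝓘(ℝ, EQ) 𝓘(ℝ, EQ).tangent ∞
      (fun x => (⟨x, Y x⟩ : TangentBundle 𝓘(ℝ, EQ) Q)) (h • q))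
    (hX : ∀ᶠ x in 𝓝 q, dact Q h x (X x) = X (h • x))
    (hY : ∀ᶠ x in 𝓝 q, dact Q h x (Y x) = Y (h • x)) :
    VectorField.mlieBracket 𝓘(ℝ, EQ) X Y (h • q) =
      dact Q h q (VectorField.mlieBracket 𝓘(ℝ, EQ) X Y q) := by
  have := FiniteDimensional.complete ℝ EQ
  have hn : (2 : ℕ∞ω) ≤ ∞ := WithTop.coe_le_coe.2 le_top
  have hn' : (3 : ℕ∞ω) ≤ ∞ := WithTop.coe_le_coe.2 le_top
  have : IsManifold 𝓘(ℝ, EQ) (minSmoothness ℝ 2) Q :=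
    IsManifold.of_le (n := ∞) (by simpa using hn)
  have : IsManifold 𝓘(ℝ, EQ) (minSmoothness ℝ 3) Q :=
    IsManifold.of_le (n := ∞) (by simpa using hn')
  have key := VectorField.mpullback_mlieBracket (I := 𝓘(ℝ, EQ)) (I' := 𝓘(ℝ, EQ)) (n := ∞)
    (f := fun x : Q => h • x) (V := X) (W := Y) (x₀ := q)
    (hXs.mdifferentiableAt (by simp)) (hYs.mdifferentiableAt (by simp))
    (hs h).contMDiffAt (by simpa using hn)
  have hev : ∀ Z : (q : Q) → TangentSpace 𝓘(ℝ, EQ) q,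
      (∀ᶠ x in 𝓝 q, dact Q h x (Z x) = Z (h • x)) →
      VectorField.mpullback 𝓘(ℝ, EQ) 𝓘(ℝ, EQ) (fun x : Q => h • x) Z =ᶠ[𝓝 q] Z := by
    intro Z hZ
    filter_upwards [hZ] with x hx
    rw [VectorField.mpullback_apply, ← hx]
    obtain ⟨e, he⟩ := isInvertible_dact hs h x
    change (dact Q h x).inverse (dact Q h x (Z x)) = Z x
    rw [← he, ContinuousLinearMap.inverse_equiv]
    exact e.symm_apply_apply _
  rw [Filter.EventuallyEq.mlieBracket_vectorField_eq (hev X hX) (hev Y hY),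
    VectorField.mpullback_apply] at key
  rw [← key]
  obtain ⟨e, he⟩ := isInvertible_dact hs h q
  change _ = dact Q h q ((dact Q h q).inverse _)
  rw [← he, ContinuousLinearMap.inverse_equiv]
  exact (e.apply_symm_apply _).symm

/-- Horizontal lifts of coordinate fields are invariant and may be used to compute the curvature;
their bracket and its vertical part are then carried along by the action. -/
theorem dact_curvature (hp : S.proj q ∈ (extChartAt 𝓘(ℝ, EM) p₀).source) (h : G) (u v : EM) :
    dact Q h q (S.curvature q (ofCoord p₀ (S.proj q) u) (ofCoord p₀ (S.proj q) v)) =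
      S.curvature (h • q) (ofCoord p₀ (S.proj (h • q)) u) (ofCoord p₀ (S.proj (h • q)) v) := by
  have hp' : S.proj (h • q) ∈ (extChartAt 𝓘(ℝ, EM) p₀).source := by rwa [proj_smul]
  let X : EM → (q : Q) → TangentSpace 𝓘(ℝ, EQ) q := fun w => S.hliftField fun p => ofCoord p₀ p w
  have hs : ∀ q : Q, S.proj q ∈ (extChartAt 𝓘(ℝ, EM) p₀).source → ∀ w,
      ContMDiffAt 𝓘(ℝ, EQ) 𝓘(ℝ, EQ).tangent ∞
        (fun x => (⟨x, X w x⟩ : TangentBundle 𝓘(ℝ, EQ) Q)) q :=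
    fun q hq w => contMDiffAt_hliftField (contMDiffAt_ofCoord hq w)
  have hm : ∀ (q : Q) (w : EM), ∀ᶠ x in 𝓝 q, X w x ∈ S.dist x :=
    fun q w => Eventually.of_forall (hliftField_mem _)
  have hc : ∀ q : Q, S.proj q ∈ (extChartAt 𝓘(ℝ, EM) p₀).source →
      S.curvature q (ofCoord p₀ (S.proj q) u) (ofCoord p₀ (S.proj q) v) =
        S.vertProj q (VectorField.mlieBracket 𝓘(ℝ, EQ) (X u) (X v) q) := by
    intro q hq
    rw [vertProj_mlieBracket (hs q hq u) (hs q hq v) (hm q u) (hm q v)]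
    change _ = S.curvature q (S.dproj q (S.hlift q _)) (S.dproj q (S.hlift q _))
    rw [dproj_hlift, dproj_hlift]
  have hi : ∀ w, ∀ᶠ x in 𝓝 q, dact Q h x (X w x) = X w (h • x) := by
    intro w
    filter_upwards [proj_source_mem_nhds hp] with x hx using dact_hlift hx h w
  rw [hc q hp, hc _ hp', dact_vertProj, mlieBracket_smul (ContMDiffSMul.contMDiff_const_smul (I := 𝓘(ℝ, EG))) (hs _ hp' u) (hs _ hp' v) (hi u) (hi v)]

theorem redMetric_smul (hp : S.proj q ∈ (extChartAt 𝓘(ℝ, EM) p₀).source) (h : G) (u v : EM) :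
    S.redMetric (h • q) (ofCoord p₀ (S.proj (h • q)) u) (ofCoord p₀ (S.proj (h • q)) v) =
      S.redMetric q (ofCoord p₀ (S.proj q) u) (ofCoord p₀ (S.proj q) v) := by
  rw [redMetric, ← dact_hlift hp, ← dact_hlift hp]
  exact S.metric_invariant h q _ _

theorem metricCurv_smul (hp : S.proj q ∈ (extChartAt 𝓘(ℝ, EM) p₀).source) (h : G) (u v w : EM) :
    S.metricCurv (h • q) (ofCoord p₀ (S.proj (h • q)) u) (ofCoord p₀ (S.proj (h • q)) v)
        (ofCoord p₀ (S.proj (h • q)) w) =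
      S.metricCurv q (ofCoord p₀ (S.proj q) u) (ofCoord p₀ (S.proj q) v)
        (ofCoord p₀ (S.proj q) w) := by
  rw [metricCurv, ← dact_hlift hp, ← dact_curvature hp]
  exact S.metric_invariant h q _ _

variable (S)

/-! ## Rank at most two -/

/-- If u, v are independent they form a basis; writing T(u, v) = a u + b v, the trace of T(·, v) is
a and that of T(·, u) is -b. If they are dependent, both sides vanish. -/
theorem _root_.alternating_eq_of_finrank_le_two {V : Type*} [AddCommGroup V] [Module ℝ V]
    [FiniteDimensional ℝ V] (hV : Module.finrank ℝ V ≤ 2) (T : V →ₗ[ℝ] V →ₗ[ℝ] V)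
    (hT : ∀ u v, T u v = -T v u) (u v : V) :
    T u v = -(LinearMap.trace ℝ V (T.flip u)) • v + LinearMap.trace ℝ V (T.flip v) • u := by
  have h0 : ∀ w, T w w = 0 := fun w => by
    have h : (2 : ℝ) • T w w = 0 := by
      rw [two_smul]
      exact add_eq_zero_iff_eq_neg.2 (hT w w)
    simpa using h
  by_cases hli : LinearIndependent ℝ ![u, v]
  · have hcard : Fintype.card (Fin 2) = Module.finrank ℝ V :=
      le_antisymm (hli.fintype_card_le_finrank) (by simpa using hV)
    let b := basisOfLinearIndependentOfCardEqFinrank hli hcard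
    have hb0 : b 0 = u := by simp [b]
    have hb1 : b 1 = v := by simp [b]
    have htr : ∀ w, LinearMap.trace ℝ V (T.flip w) = b.repr (T u w) 0 + b.repr (T v w) 1 := by
      intro w
      rw [LinearMap.trace_eq_matrix_trace ℝ b, Matrix.trace, Fin.sum_univ_two]
      simp only [Matrix.diag_apply, LinearMap.toMatrix_apply, LinearMap.flip_apply, hb0, hb1]
    rw [htr, htr, h0, h0, hT v u]
    have h := b.sum_repr (T u v)
    rw [Fin.sum_univ_two, hb0, hb1] at h
    conv_lhs => rw [← h]
    simp
    abel
  · rw [LinearIndependent.pair_iff] at hli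
    push Not at hli
    obtain ⟨s, t, hst, hne⟩ := hli
    by_cases hs : s = 0
    · subst hs
      have hv : v = 0 := by simpa [hne rfl] using hst
      subst hv
      simp
    · obtain ⟨c, rfl⟩ : ∃ c : ℝ, u = c • v := by
        refine ⟨s⁻¹ * -t, ?_⟩
        rw [mul_smul, neg_smul, ← eq_neg_of_add_eq_zero_left hst, smul_smul, inv_mul_cancel₀ hs,
          one_smul]
      simp only [map_smul, LinearMap.smul_apply, h0, smul_zero, smul_smul, smul_eq_mul]
      rw [← add_smul, mul_comm]
      simp

theorem _root_.alternating_eq_zero_of_finrank_le_one {V : Type*} [AddCommGroup V] [Module ℝ V]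
    [FiniteDimensional ℝ V] (hV : Module.finrank ℝ V ≤ 1) (T : V →ₗ[ℝ] V →ₗ[ℝ] V)
    (hT : ∀ u v, T u v = -T v u) : T = 0 := by
  have h0 : ∀ w, T w w = 0 := fun w => by
    have h : (2 : ℝ) • T w w = 0 := by
      rw [two_smul]
      exact add_eq_zero_iff_eq_neg.2 (hT w w)
    simpa using h
  obtain ⟨e, he⟩ := finrank_le_one_iff.1 hV
  ext u v
  obtain ⟨a, rfl⟩ := he u
  obtain ⟨c, rfl⟩ := he v
  simp [h0]

theorem finrank_tangentSpace (p : M) :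
    Module.finrank ℝ (TangentSpace 𝓘(ℝ, EM) p) = Module.finrank ℝ EM := rfl

theorem gyroscopicTensor_eq (hdim : Module.finrank ℝ EM ≤ 2) (q : Q)
    (u v : TangentSpace 𝓘(ℝ, EM) (S.proj q)) :
    S.gyroscopicTensor q u v = -(S.beta q u) • v + S.beta q v • u := by
  have : FiniteDimensional ℝ (TangentSpace 𝓘(ℝ, EM) (S.proj q)) :=
    inferInstanceAs (FiniteDimensional ℝ EM)
  rw [beta_eq_trace, beta_eq_trace, ← gyroₗ_apply]
  exact alternating_eq_of_finrank_le_two hdim _ (fun u v => S.gyroscopicTensor_swap q u v) u v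

theorem beta_eq_zero (hdim : Module.finrank ℝ EM ≤ 1) (q : Q)
    (u : TangentSpace 𝓘(ℝ, EM) (S.proj q)) : S.beta q u = 0 := by
  have : FiniteDimensional ℝ (TangentSpace 𝓘(ℝ, EM) (S.proj q)) :=
    inferInstanceAs (FiniteDimensional ℝ EM)
  have h0 : S.gyroₗ q = 0 :=
    alternating_eq_zero_of_finrank_le_one hdim _ (fun u v => S.gyroscopicTensor_swap q u v)
  rw [beta_eq_trace, h0]
  exact map_zero (LinearMap.trace ℝ _)

theorem metricCurv_eq_beta (hdim : Module.finrank ℝ EM ≤ 2) (q : Q)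
    (u v w : TangentSpace 𝓘(ℝ, EM) (S.proj q)) :
    S.metricCurv q u v w = -S.beta q v * S.redMetric q u w + S.beta q w * S.redMetric q u v := by
  rw [metricCurv_eq, S.gyroscopicTensor_eq hdim, redMetric_add_right, redMetric_smul_right,
    redMetric_smul_right]

/-- The factor m - 1 is 1 when m = 2, and β = 0 when m is smaller. -/
theorem betaWedgeTheta_eq (hdim : Module.finrank ℝ EM ≤ 2) (q : Q)
    (u X Y : TangentSpace 𝓘(ℝ, EM) (S.proj q)) :
    S.betaWedgeTheta q u X Y =
      ((Module.finrank ℝ EM : ℝ) - 1) * S.betaWedgeTheta q u X Y := by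
  rcases hdim.lt_or_eq with h | h
  · rw [betaWedgeTheta, S.beta_eq_zero (Nat.lt_succ_iff.1 h), S.beta_eq_zero (Nat.lt_succ_iff.1 h)]
    simp
  · rw [h]
    norm_num

theorem betaXiOn (hdim : Module.finrank ℝ EM ≤ 2) (W : Set M) : S.BetaXiOn W := by
  intro q _ u X Y
  rw [S.betaWedgeTheta_eq hdim, Xi, S.metricCurv_eq_beta hdim, betaWedgeTheta]
  ring

theorem betaGammaOn (hdim : Module.finrank ℝ EM ≤ 2) (W : Set M) : S.BetaGammaOn W := by
  intro q _ u X Y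
  rw [S.betaWedgeTheta_eq hdim, gamma, S.metricCurv_eq_beta hdim, S.metricCurv_eq_beta hdim,
    S.metricCurv_eq_beta hdim, betaWedgeTheta, S.redMetric_symm q Y X, S.redMetric_symm q X u,
    S.redMetric_symm q Y u]
  ring

/-- After substituting the trace formula, the six terms of the cyclic sum cancel in pairs by
symmetry of the reduced metric. -/
theorem thetaZeroOn (hdim : Module.finrank ℝ EM ≤ 2) (W : Set M) : S.ThetaZeroOn W := by
  intro q _ X Y Z
  rw [Theta, S.metricCurv_eq_beta hdim, S.metricCurv_eq_beta hdim, S.metricCurv_eq_beta hdim,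
    S.redMetric_symm q Y X, S.redMetric_symm q Z X, S.redMetric_symm q Z Y]
  ring

/-! ## Coordinate expressions -/

variable {S}

theorem coordField_apply {p : M} (hp : p ∈ (extChartAt 𝓘(ℝ, EM) p₀).source) (w : EM) :
    coordField p₀ w p = ofCoord p₀ p w := by
  have h1 : ∀ w, toCoord p₀ p (ofCoord p₀ p w) = w := toCoord_ofCoord hp
  have h2 : ∀ v, ofCoord p₀ p (toCoord p₀ p v) = v := ofCoord_toCoord hp
  rw [toCoord_eq_mfderiv hp] at h1 h2
  exact DFunLike.congr_fun (ContinuousLinearMap.inverse_eq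
    (f := mfderiv 𝓘(ℝ, EM) 𝓘(ℝ, EM) (extChartAt 𝓘(ℝ, EM) p₀) p) (g := (ofCoord p₀ p : EM →L[ℝ] TangentSpace 𝓘(ℝ, EM) p))
    (ContinuousLinearMap.ext h1) (ContinuousLinearMap.ext h2)) w

theorem exists_smul_eq_fibrePoint (hp : S.proj q ∈ (extChartAt 𝓘(ℝ, EM) p₀).source) :
    ∃ h : G, h • q = S.fibrePoint p₀ (extChartAt 𝓘(ℝ, EM) p₀ (S.proj q)) := by
  rw [← S.proj_eq_iff, fibrePoint, (extChartAt 𝓘(ℝ, EM) p₀).left_inv hp,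
    Function.surjInv_eq S.proj_surjective]

theorem metricCoord_apply (hp : S.proj q ∈ (extChartAt 𝓘(ℝ, EM) p₀).source) (u w : EM) :
    S.metricCoord p₀ u w (extChartAt 𝓘(ℝ, EM) p₀ (S.proj q)) =
      S.redMetric q (ofCoord p₀ (S.proj q) u) (ofCoord p₀ (S.proj q) w) := by
  obtain ⟨h, hh⟩ := exists_smul_eq_fibrePoint hp
  have hp' : S.proj (h • q) ∈ (extChartAt 𝓘(ℝ, EM) p₀).source := by rwa [proj_smul]
  rw [metricCoord, coordVec, coordVec, ← hh, coordField_apply hp', coordField_apply hp',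
    redMetric_smul hp]

theorem gyroCoord_apply (hp : S.proj q ∈ (extChartAt 𝓘(ℝ, EM) p₀).source) (u v w : EM) :
    S.gyroCoord p₀ u v w (extChartAt 𝓘(ℝ, EM) p₀ (S.proj q)) =
      S.metricCurv q (ofCoord p₀ (S.proj q) u) (ofCoord p₀ (S.proj q) v)
        (ofCoord p₀ (S.proj q) w) := by
  obtain ⟨h, hh⟩ := exists_smul_eq_fibrePoint hp
  have hp' : S.proj (h • q) ∈ (extChartAt 𝓘(ℝ, EM) p₀).source := by rwa [proj_smul]
  rw [gyroCoord, coordVec, coordVec, coordVec, ← hh, coordField_apply hp', coordField_apply hp',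
    coordField_apply hp', ← metricCurv_eq, metricCurv_smul hp]

/-- The trace is invariant under conjugation by the chart, so it suffices that the coordinate
matrices of T(·, w) agree at two points of one fibre. -/
theorem betaCoord_apply (hp : S.proj q ∈ (extChartAt 𝓘(ℝ, EM) p₀).source) (w : EM) :
    S.betaCoord p₀ w (extChartAt 𝓘(ℝ, EM) p₀ (S.proj q)) =
      S.beta q (ofCoord p₀ (S.proj q) w) := by
  obtain ⟨h, hh⟩ := exists_smul_eq_fibrePoint hp
  have hp' : S.proj (h • q) ∈ (extChartAt 𝓘(ℝ, EM) p₀).source := by rwa [proj_smul]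
  have ht : ∀ {q : Q} (hq : S.proj q ∈ (extChartAt 𝓘(ℝ, EM) p₀).source),
      ∃ T : EM →ₗ[ℝ] EM, (∀ v, T v = toCoord p₀ (S.proj q) (S.gyroscopicTensor q
        (ofCoord p₀ (S.proj q) v) (ofCoord p₀ (S.proj q) w))) ∧
      S.beta q (ofCoord p₀ (S.proj q) w) = LinearMap.trace ℝ EM T := by
    intro q hq
    let e : TangentSpace 𝓘(ℝ, EM) (S.proj q) ≃ₗ[ℝ] EM :=
      { (toCoord p₀ (S.proj q)).toLinearMap with
        invFun := ofCoord p₀ (S.proj q)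
        left_inv := ofCoord_toCoord hq
        right_inv := toCoord_ofCoord hq }
    refine ⟨e.conj ((S.gyroₗ q).flip (ofCoord p₀ (S.proj q) w)), fun v => rfl, ?_⟩
    rw [LinearMap.trace_conj', beta_eq_trace]
  obtain ⟨T, hT, hTt⟩ := ht hp
  obtain ⟨T', hT', hTt'⟩ := ht hp'
  rw [betaCoord, coordVec, ← hh, coordField_apply hp', hTt, hTt']
  congr 1
  ext v
  -- Invariance is known for g(u, T(v, w)); definiteness of the reduced metric, tested on the
  -- difference `T v - T' v`, then gives invariance of T itself.
  have hκ : ∀ u, S.redMetric q (ofCoord p₀ (S.proj q) u) (ofCoord p₀ (S.proj q) (T v)) =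
      S.redMetric q (ofCoord p₀ (S.proj q) u) (ofCoord p₀ (S.proj q) (T' v)) := by
    intro u
    have h1 := metricCurv_smul hp h u v w
    rw [metricCurv_eq, metricCurv_eq, ← ofCoord_toCoord hp (S.gyroscopicTensor q _ _), ← hT,
      ← ofCoord_toCoord hp' (S.gyroscopicTensor (h • q) _ _), ← hT', redMetric_smul hp] at h1
    exact h1.symm
  by_contra hne
  have hne' : ofCoord p₀ (S.proj q) (T v - T' v) ≠ 0 := fun h0 => hne (by
    rw [eq_comm, ← sub_eq_zero, ← toCoord_ofCoord hp (T v - T' v), h0, map_zero])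
  have h3 := S.redMetric_pos q hne'
  have h4 := hκ (T v - T' v)
  have h5 : ofCoord p₀ (S.proj q) (T v) =
      ofCoord p₀ (S.proj q) (T v - T' v) + ofCoord p₀ (S.proj q) (T' v) := by
    rw [← map_add, sub_add_cancel]
  rw [h5, redMetric_add_right] at h4
  linarith

variable (S)

/-! ## Smoothness of the coordinate expressions -/

theorem exists_fibre_point {p₀ : M} {x : EM} (hx : x ∈ (extChartAt 𝓘(ℝ, EM) p₀).target) :
    ∃ q, S.proj q ∈ (extChartAt 𝓘(ℝ, EM) p₀).source ∧ extChartAt 𝓘(ℝ, EM) p₀ (S.proj q) = x := by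
  obtain ⟨q, hq⟩ := S.proj_surjective ((extChartAt 𝓘(ℝ, EM) p₀).symm x)
  refine ⟨q, ?_, ?_⟩ <;> rw [hq]
  · exact (extChartAt 𝓘(ℝ, EM) p₀).map_target hx
  · exact (extChartAt 𝓘(ℝ, EM) p₀).right_inv hx

variable {S}

/-- `fibrePoint` is an arbitrary choice with no continuity. Invariance allows it to be replaced by
the value of a smooth local section, and this is how smoothness of the coordinate expressions is
obtained. -/
theorem exists_fibre_section (hp : S.proj q ∈ (extChartAt 𝓘(ℝ, EM) p₀).source) :
    ∃ s : EM → EQ, ContDiffAt ℝ ∞ s (extChartAt 𝓘(ℝ, EM) p₀ (S.proj q)) ∧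
      s (extChartAt 𝓘(ℝ, EM) p₀ (S.proj q)) = extChartAt 𝓘(ℝ, EQ) q q ∧
      ∀ᶠ x in 𝓝 (extChartAt 𝓘(ℝ, EM) p₀ (S.proj q)),
        ∃ q' ∈ (extChartAt 𝓘(ℝ, EQ) q).source, S.proj q' ∈ (extChartAt 𝓘(ℝ, EM) p₀).source ∧
          s x = extChartAt 𝓘(ℝ, EQ) q q' ∧ extChartAt 𝓘(ℝ, EM) p₀ (S.proj q') = x := by
  have hq : q ∈ (extChartAt 𝓘(ℝ, EQ) q).source := mem_extChartAt_source q
  obtain ⟨s, hs, hs0, hsec⟩ := exists_local_section (contDiffAt_projCoord hq hp)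
    (fun u => ⟨_, fderiv_projCoord_liftCoord hq hp u⟩)
  rw [projCoord_apply hq] at hs hs0 hsec
  refine ⟨s, hs, hs0, ?_⟩
  have hev : ∀ᶠ y in 𝓝 (extChartAt 𝓘(ℝ, EQ) q q), ∃ q' ∈ (extChartAt 𝓘(ℝ, EQ) q).source,
      S.proj q' ∈ (extChartAt 𝓘(ℝ, EM) p₀).source ∧ y = extChartAt 𝓘(ℝ, EQ) q q' :=
    eventually_coord hq (proj_source_mem_nhds hp) fun q' h1 h2 => ⟨q', h2, h1, rfl⟩
  have hc : Tendsto s (𝓝 (extChartAt 𝓘(ℝ, EM) p₀ (S.proj q))) (𝓝 (extChartAt 𝓘(ℝ, EQ) q q)) := by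
    rw [← hs0]
    exact hs.continuousAt
  filter_upwards [hsec, hc.eventually hev] with x hx ⟨q', h1, h2, h3⟩
  refine ⟨q', h1, h2, h3, ?_⟩
  rw [← projCoord_apply h1, ← h3, hx]

theorem contDiffAt_metricRep (q₀ : Q) (hq : q ∈ (extChartAt 𝓘(ℝ, EQ) q₀).source) :
    ContDiffAt ℝ ∞ (metricRep q₀ S.metric.inner) (extChartAt 𝓘(ℝ, EQ) q₀ q) :=
  (contMDiffAt_iff_metricRep hq).1 (S.metric.contMDiff q)

theorem contDiffAt_metricCoord (hp : S.proj q ∈ (extChartAt 𝓘(ℝ, EM) p₀).source) (u w : EM) :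
    ContDiffAt ℝ ∞ (S.metricCoord p₀ u w) (extChartAt 𝓘(ℝ, EM) p₀ (S.proj q)) := by
  have hq : q ∈ (extChartAt 𝓘(ℝ, EQ) q).source := mem_extChartAt_source q
  obtain ⟨s, hs, hs0, hsec⟩ := exists_fibre_section hp
  have hL : ContDiffAt ℝ ∞ (S.liftCoord q p₀ ∘ s) (extChartAt 𝓘(ℝ, EM) p₀ (S.proj q)) :=
    ContDiffAt.comp _ (by rw [hs0]; exact contDiffAt_liftCoord hq hp) hs
  have hG : ContDiffAt ℝ ∞ (metricRep q S.metric.inner ∘ s)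
      (extChartAt 𝓘(ℝ, EM) p₀ (S.proj q)) :=
    ContDiffAt.comp _ (by rw [hs0]; exact contDiffAt_metricRep q hq) hs
  refine (Bil.contDiffAt_app hG (hL.clm_apply (contDiffAt_const (c := u)))
    (hL.clm_apply (contDiffAt_const (c := w)))).congr_of_eventuallyEq ?_
  filter_upwards [hsec] with x hx
  obtain ⟨q', h1, h2, h3, rfl⟩ := hx
  rw [metricCoord_apply h2, Function.comp_apply, Function.comp_apply, h3, liftCoord_apply h1,
    liftCoord_apply h1, metricRep_toCoord h1, redMetric]

theorem contDiffAt_gyroCoord (hp : S.proj q ∈ (extChartAt 𝓘(ℝ, EM) p₀).source) (u v w : EM) :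
    ContDiffAt ℝ ∞ (S.gyroCoord p₀ u v w) (extChartAt 𝓘(ℝ, EM) p₀ (S.proj q)) := by
  have hq : q ∈ (extChartAt 𝓘(ℝ, EQ) q).source := mem_extChartAt_source q
  obtain ⟨s, hs, hs0, hsec⟩ := exists_fibre_section hp
  have hL : ContDiffAt ℝ ∞ (S.liftCoord q p₀ ∘ s) (extChartAt 𝓘(ℝ, EM) p₀ (S.proj q)) :=
    ContDiffAt.comp _ (by rw [hs0]; exact contDiffAt_liftCoord hq hp) hs
  have hG : ContDiffAt ℝ ∞ (metricRep q S.metric.inner ∘ s)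
      (extChartAt 𝓘(ℝ, EM) p₀ (S.proj q)) :=
    ContDiffAt.comp _ (by rw [hs0]; exact contDiffAt_metricRep q hq) hs
  have hD : ContDiffAt ℝ ∞ (fderiv ℝ (S.horCoord q p₀) ∘ s)
      (extChartAt 𝓘(ℝ, EM) p₀ (S.proj q)) :=
    ContDiffAt.comp _ (by rw [hs0]; exact (contDiffAt_horCoord hq hp).fderiv_right (by simp)) hs
  have hK : ∀ a : EM, ContDiffAt ℝ ∞ (fun x => (S.liftCoord q p₀ ∘ s) x a)
      (extChartAt 𝓘(ℝ, EM) p₀ (S.proj q)) := fun a => hL.clm_apply contDiffAt_const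
  refine (Bil.contDiffAt_app hG (hK u) (((hD.clm_apply (hK v)).clm_apply (hK w)).sub
    ((hD.clm_apply (hK w)).clm_apply (hK v)))).congr_of_eventuallyEq ?_
  filter_upwards [hsec] with x hx
  obtain ⟨q', h1, h2, h3, rfl⟩ := hx
  rw [gyroCoord_apply h2, metricCurv, Function.comp_apply, Function.comp_apply,
    Function.comp_apply, h3, liftCoord_apply h1, liftCoord_apply h1, liftCoord_apply h1]
  rw [← curvForm.eq_1, ← toCoord_curvature h1 h2, metricRep_toCoord h1]

/-! ## The reduced metric in coordinates -/

variable (S)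

theorem coordVec_add (p₀ : M) (x u w : EM) :
    S.coordVec p₀ x (u + w) = S.coordVec p₀ x u + S.coordVec p₀ x w :=
  map_add (mfderiv 𝓘(ℝ, EM) 𝓘(ℝ, EM) (extChartAt 𝓘(ℝ, EM) p₀) _).inverse u w

theorem coordVec_smul (p₀ : M) (x w : EM) (c : ℝ) :
    S.coordVec p₀ x (c • w) = c • S.coordVec p₀ x w :=
  map_smul (mfderiv 𝓘(ℝ, EM) 𝓘(ℝ, EM) (extChartAt 𝓘(ℝ, EM) p₀) _).inverse c w

/-- The reduced metric in coordinates, as a bilinear form. -/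
noncomputable def baseMetric (p₀ : M) (x : EM) : Bil EM :=
  LinearMap.toContinuousLinearMap (LinearMap.toContinuousLinearMap.toLinearMap ∘ₗ
    LinearMap.mk₂ ℝ (fun u w => S.metricCoord p₀ u w x)
      (fun u u' w => by rw [metricCoord, coordVec_add, redMetric_add_left]; rfl)
      (fun c u w => by rw [metricCoord, coordVec_smul, redMetric_smul_left]; rfl)
      (fun u w w' => by rw [metricCoord, coordVec_add, redMetric_add_right]; rfl)
      (fun c u w => by rw [metricCoord, coordVec_smul, redMetric_smul_right]; rfl))

theorem baseMetric_apply (p₀ : M) (x u w : EM) :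
    S.baseMetric p₀ x u w = S.metricCoord p₀ u w x := rfl

theorem baseMetric_symm (p₀ : M) (x u w : EM) :
    S.baseMetric p₀ x u w = S.baseMetric p₀ x w u := S.redMetric_symm _ _ _

/-- `β` in coordinates, as a linear form. -/
noncomputable def baseBeta (p₀ : M) (x : EM) : EM →L[ℝ] ℝ :=
  LinearMap.toContinuousLinearMap
    { toFun := fun w => S.betaCoord p₀ w x
      map_add' := fun u w => by
        simp only [betaCoord, coordVec_add, beta_eq_trace, map_add]
      map_smul' := fun c w => by
        simp only [betaCoord, coordVec_smul, beta_eq_trace, map_smul, RingHom.id_apply] }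

theorem baseBeta_apply (p₀ : M) (x w : EM) : S.baseBeta p₀ x w = S.betaCoord p₀ w x := rfl

variable {S} {x : EM}

theorem contDiffAt_baseMetric (hx : x ∈ (extChartAt 𝓘(ℝ, EM) p₀).target) :
    ContDiffAt ℝ ∞ (S.baseMetric p₀) x := by
  obtain ⟨q, hp, rfl⟩ := S.exists_fibre_point hx
  exact Bil.contDiffAt_of_app fun u w => contDiffAt_metricCoord hp u w

theorem fderiv_baseMetric (hx : x ∈ (extChartAt 𝓘(ℝ, EM) p₀).target) (u w a : EM) :
    fderiv ℝ (S.metricCoord p₀ u w) x a = fderiv ℝ (S.baseMetric p₀) x a u w := by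
  have h := Bil.fderiv_app ((contDiffAt_baseMetric (S := S) hx).differentiableAt (by simp))
    (differentiableAt_const (𝕜 := ℝ) u) (differentiableAt_const (𝕜 := ℝ) w) a
  change fderiv ℝ (fun y => S.baseMetric p₀ y u w) x a = _
  simpa using h

theorem baseMetric_pos (hx : x ∈ (extChartAt 𝓘(ℝ, EM) p₀).target) {u : EM} (hu : u ≠ 0) :
    0 < S.baseMetric p₀ x u u := by
  obtain ⟨q, hp, rfl⟩ := S.exists_fibre_point hx
  rw [baseMetric_apply, metricCoord_apply hp]
  refine S.redMetric_pos q fun h => hu ?_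
  rw [← toCoord_ofCoord hp u, h, map_zero]

theorem gyroCoord_eq_beta (hdim : Module.finrank ℝ EM ≤ 2)
    (hx : x ∈ (extChartAt 𝓘(ℝ, EM) p₀).target) (u v w : EM) :
    S.gyroCoord p₀ u v w x =
      -S.baseBeta p₀ x v * S.baseMetric p₀ x u w + S.baseBeta p₀ x w * S.baseMetric p₀ x u v := by
  obtain ⟨q, hp, rfl⟩ := S.exists_fibre_point hx
  rw [gyroCoord_apply hp, S.metricCurv_eq_beta hdim, baseBeta_apply, baseBeta_apply,
    baseMetric_apply, baseMetric_apply, metricCoord_apply hp, metricCoord_apply hp,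
    betaCoord_apply hp, betaCoord_apply hp]

theorem baseBeta_eq_zero (hdim : Module.finrank ℝ EM ≤ 1) (x : EM) : S.baseBeta p₀ x = 0 := by
  ext w
  exact S.beta_eq_zero hdim _ _

/-- For a basis v, w the numbers g(v, T(v, w)) and g(w, T(v, w)) are linear in β(v), β(w) with
metric coefficients. Eliminating β(w) expresses β(v) through functions already known to be smooth,
the denominator being the Gram determinant. -/
theorem contDiffAt_betaCoord (hdim : Module.finrank ℝ EM ≤ 2)
    (hx : x ∈ (extChartAt 𝓘(ℝ, EM) p₀).target) (v : EM) :
    ContDiffAt ℝ ∞ (S.betaCoord p₀ v) x := by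
  rcases hdim.lt_or_eq with h | h
  · have h0 : S.betaCoord p₀ v = fun _ => 0 := funext fun x =>
      S.beta_eq_zero (Nat.lt_succ_iff.1 h) _ _
    rw [h0]
    exact contDiffAt_const
  by_cases hv : v = 0
  · have h0 : S.betaCoord p₀ v = fun _ => 0 := funext fun x => by
      rw [← baseBeta_apply, hv, map_zero]
    rw [h0]
    exact contDiffAt_const
  obtain ⟨w, hw⟩ := exists_linearIndependent_pair_of_one_lt_finrank (R := ℝ) (by omega) hv
  have hne : S.baseMetric p₀ x v v * S.baseMetric p₀ x w w - S.baseMetric p₀ x v w ^ 2 ≠ 0 := by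
    have hg := baseMetric_pos (S := S) hx hv
    -- The component of w orthogonal to v, scaled by g(v, v); its squared length is g(v, v) times
    -- the Gram determinant.
    have hz : S.baseMetric p₀ x v v • w - S.baseMetric p₀ x v w • v ≠ 0 := by
      intro h0
      rw [LinearIndependent.pair_iff] at hw
      have := (hw (-S.baseMetric p₀ x v w) (S.baseMetric p₀ x v v)
        (by rw [neg_smul, neg_add_eq_sub, h0])).2
      exact hg.ne' this
    have hp := baseMetric_pos (S := S) hx hz
    have he : ∀ a b : EM, ∀ s t : ℝ, S.baseMetric p₀ x (s • a - t • b) (s • a - t • b) =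
        s * s * S.baseMetric p₀ x a a - 2 * (s * t) * S.baseMetric p₀ x b a
          + t * t * S.baseMetric p₀ x b b := by
      intro a b s t
      simp only [map_sub, map_smul, sub_apply, smul_apply, smul_eq_mul]
      rw [S.baseMetric_symm p₀ x a b]
      ring
    rw [he w v] at hp
    intro h0
    have : (0 : ℝ) < S.baseMetric p₀ x v v *
      (S.baseMetric p₀ x v v * S.baseMetric p₀ x w w - S.baseMetric p₀ x v w ^ 2) := by linarith
    rw [h0, mul_zero] at this
    exact this.false
  have hev : S.betaCoord p₀ v =ᶠ[𝓝 x] fun x =>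
      (S.metricCoord p₀ v w x * S.gyroCoord p₀ v v w x
        - S.metricCoord p₀ v v x * S.gyroCoord p₀ w v w x) /
      (S.metricCoord p₀ v v x * S.metricCoord p₀ w w x - S.metricCoord p₀ v w x ^ 2) := by
    have hc : ContinuousAt (fun x => S.baseMetric p₀ x v v * S.baseMetric p₀ x w w
        - S.baseMetric p₀ x v w ^ 2) x := by
      have hm : ∀ a b, ContinuousAt (fun x => S.baseMetric p₀ x a b) x := fun a b =>
        (Bil.contDiffAt_app (contDiffAt_baseMetric hx) contDiffAt_const
          contDiffAt_const).continuousAt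
      exact ((hm v v).mul (hm w w)).sub ((hm v w).pow 2)
    filter_upwards [(isOpen_extChartAt_target p₀).mem_nhds hx, hc.eventually_ne hne] with x hx hne
    rw [gyroCoord_eq_beta hdim hx, gyroCoord_eq_beta hdim hx]
    simp only [← baseMetric_apply, ← baseBeta_apply]
    rw [eq_div_iff hne, S.baseMetric_symm p₀ x w v]
    ring
  obtain ⟨q, hp, rfl⟩ := S.exists_fibre_point hx
  refine ContDiffAt.congr_of_eventuallyEq ?_ hev
  have hm := fun a b => contDiffAt_metricCoord hp a b
  have hk := fun a b c => contDiffAt_gyroCoord hp a b c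
  exact (((hm v w).mul (hk v v w)).sub ((hm v v).mul (hk w v w))).div
    (((hm v v).mul (hm w w)).sub ((hm v w).pow 2)) hne

theorem contDiffAt_baseBeta (hdim : Module.finrank ℝ EM ≤ 2)
    (hx : x ∈ (extChartAt 𝓘(ℝ, EM) p₀).target) : ContDiffAt ℝ ∞ (S.baseBeta p₀) x :=
  Bil.contDiffAt_clm_of_apply fun w => contDiffAt_betaCoord hdim hx w

theorem fderiv_betaCoord (hdim : Module.finrank ℝ EM ≤ 2)
    (hx : x ∈ (extChartAt 𝓘(ℝ, EM) p₀).target) (u w : EM) :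
    fderiv ℝ (S.betaCoord p₀ w) x u = fderiv ℝ (S.baseBeta p₀) x u w := by
  have h := ((contDiffAt_baseBeta (S := S) hdim hx).differentiableAt (by simp)).hasFDerivAt
  have h2 := (h.clm_apply (hasFDerivAt_const w x)).fderiv
  change fderiv ℝ (fun x => S.baseBeta p₀ x w) x u = _
  rw [h2]
  simp

variable (S)

/-! ## Potentials of `β` -/

theorem _root_.TangentCoord.mvfderiv_comp_extChartAt {F : Type*} [NormedAddCommGroup F]
    [NormedSpace ℝ F] {p₀ p : M} (hp : p ∈ (extChartAt 𝓘(ℝ, EM) p₀).source) {f : EM → F}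
    (hf : DifferentiableAt ℝ f (extChartAt 𝓘(ℝ, EM) p₀ p)) (v : TangentSpace 𝓘(ℝ, EM) p) :
    MDifferentiableAt 𝓘(ℝ, EM) 𝓘(ℝ, F) (fun p => f (extChartAt 𝓘(ℝ, EM) p₀ p)) p ∧
    mvfderiv 𝓘(ℝ, EM) (fun p => f (extChartAt 𝓘(ℝ, EM) p₀ p)) p v =
      fderiv ℝ f (extChartAt 𝓘(ℝ, EM) p₀ p) (toCoord p₀ p v) := by
  have hm : MDifferentiableAt 𝓘(ℝ, EM) 𝓘(ℝ, F) (fun p => f (extChartAt 𝓘(ℝ, EM) p₀ p)) p :=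
    MDifferentiableAt.comp (g := f) p hf.mdifferentiableAt
      ((contMDiffAt_extChartAt'' hp).mdifferentiableAt (by simp))
  refine ⟨hm, ?_⟩
  rw [mvfderiv_eq_fderiv hp hm]
  congr 1
  apply Filter.EventuallyEq.fderiv_eq
  filter_upwards [target_mem_nhds hp] with y hy
  rw [(extChartAt 𝓘(ℝ, EM) p₀).right_inv hy]

variable {S}

/-- Symmetry of the second derivative. Differentiability of φ suffices, because its derivative β is
already known to be smooth. -/
theorem betaClosedOn_of_potential (hdim : Module.finrank ℝ EM ≤ 2) {W : Set M}
    (h : ∀ p ∈ W, ∃ φ : M → ℝ, ∃ U ∈ 𝓝 p, ∀ q, S.proj q ∈ U →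
      MDifferentiableAt 𝓘(ℝ, EM) 𝓘(ℝ, ℝ) φ (S.proj q) ∧
      ∀ u, S.beta q u = mvfderiv 𝓘(ℝ, EM) φ (S.proj q) u) : S.BetaClosedOn W := by
  intro p₀ x hx hxW u w
  obtain ⟨φ, U, hU, hφ⟩ := h _ hxW
  rw [fderiv_betaCoord hdim hx, fderiv_betaCoord hdim hx]
  refine second_derivative_symmetric_of_eventually
    (f := fun y => φ ((extChartAt 𝓘(ℝ, EM) p₀).symm y)) (f' := S.baseBeta p₀) ?_
    ((contDiffAt_baseBeta hdim hx).differentiableAt (by simp)).hasFDerivAt u w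
  have hc : Tendsto (extChartAt 𝓘(ℝ, EM) p₀).symm (𝓝 x) (𝓝 ((extChartAt 𝓘(ℝ, EM) p₀).symm x)) := by
    have := continuousAt_symm ((extChartAt 𝓘(ℝ, EM) p₀).map_target hx)
    rwa [(extChartAt 𝓘(ℝ, EM) p₀).right_inv hx] at this
  filter_upwards [(isOpen_extChartAt_target p₀).mem_nhds hx, hc.eventually hU] with y hy hyU
  obtain ⟨q, hp, rfl⟩ := S.exists_fibre_point hy
  rw [(extChartAt 𝓘(ℝ, EM) p₀).left_inv hp] at hyU
  obtain ⟨h1, h2⟩ := hφ q hyU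
  have hd : DifferentiableAt ℝ (fun y => φ ((extChartAt 𝓘(ℝ, EM) p₀).symm y))
      (extChartAt 𝓘(ℝ, EM) p₀ (S.proj q)) := by
    rw [← mdifferentiableAt_iff_differentiableAt]
    refine MDifferentiableAt.comp (g := φ) (I' := 𝓘(ℝ, EM)) _ ?_
      ((contMDiffAt_extChartAt_symm' hp).mdifferentiableAt (by simp))
    rwa [(extChartAt 𝓘(ℝ, EM) p₀).left_inv hp]
  convert! hd.hasFDerivAt using 1
  ext a
  rw [baseBeta_apply, betaCoord_apply hp, h2, mvfderiv_eq_fderiv hp h1, toCoord_ofCoord hp]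

/-- The Poincaré lemma on a ball in the chart; the potential is smooth because its derivative is. -/
theorem exists_potential (hdim : Module.finrank ℝ EM ≤ 2) {W : Set M} (hW : IsOpen W)
    (h : S.BetaClosedOn W) {p : M} (hpW : p ∈ W) :
    ∃ U : Set M, IsOpen U ∧ p ∈ U ∧ U ⊆ W ∩ (extChartAt 𝓘(ℝ, EM) p).source ∧ ∃ φ : M → ℝ,
      ContMDiffOn 𝓘(ℝ, EM) 𝓘(ℝ, ℝ) ∞ φ U ∧
      ∀ q, S.proj q ∈ U → ∀ u, S.beta q u = mvfderiv 𝓘(ℝ, EM) φ (S.proj q) u := by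
  have hp : p ∈ (extChartAt 𝓘(ℝ, EM) p).source := mem_extChartAt_source p
  have hO : IsOpen ((extChartAt 𝓘(ℝ, EM) p).target ∩ (extChartAt 𝓘(ℝ, EM) p).symm ⁻¹' W) :=
    (continuousOn_extChartAt_symm p).isOpen_inter_preimage (isOpen_extChartAt_target p) hW
  obtain ⟨r, hr, hB⟩ := Metric.isOpen_iff.1 hO (extChartAt 𝓘(ℝ, EM) p p)
    ⟨(extChartAt 𝓘(ℝ, EM) p).map_source hp, by
      rwa [mem_preimage, (extChartAt 𝓘(ℝ, EM) p).left_inv hp]⟩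
  set B := Metric.ball (extChartAt 𝓘(ℝ, EM) p p) r with hBdef
  have hs : ∀ x ∈ B, ContDiffAt ℝ ∞ (S.baseBeta p) x := fun x hx =>
    contDiffAt_baseBeta hdim (hB hx).1
  have hd : DifferentiableOn ℝ (S.baseBeta p) B := fun x hx =>
    ((hs x hx).differentiableAt (by simp)).differentiableWithinAt
  obtain ⟨f, hf⟩ := (convex_ball _ r).exists_forall_hasFDerivAt_of_fderiv_symmetric
    Metric.isOpen_ball hd
    (fun x hx u w => by
      rw [← fderiv_betaCoord hdim (hB hx).1, ← fderiv_betaCoord hdim (hB hx).1]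
      exact h p x (hB hx).1 (hB hx).2 u w)
  have hfs : ContDiffOn ℝ ∞ f B := by
    rw [contDiffOn_infty_iff_fderiv_of_isOpen Metric.isOpen_ball]
    exact ⟨fun x hx => (hf x hx).differentiableAt.differentiableWithinAt,
      ContDiffOn.congr (fun x hx => (hs x hx).contDiffWithinAt) fun x hx => (hf x hx).fderiv⟩
  refine ⟨(extChartAt 𝓘(ℝ, EM) p).source ∩ extChartAt 𝓘(ℝ, EM) p ⁻¹' B,
    (continuousOn_extChartAt p).isOpen_inter_preimage (isOpen_extChartAt_source p)
      Metric.isOpen_ball, ⟨hp, Metric.mem_ball_self hr⟩, ?_, fun p' => f (extChartAt 𝓘(ℝ, EM) p p'),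
      ?_, ?_⟩
  · rintro p' ⟨h1, h2⟩
    have := (hB h2).2
    rw [mem_preimage, (extChartAt 𝓘(ℝ, EM) p).left_inv h1] at this
    exact ⟨this, h1⟩
  · rintro p' ⟨h1, h2⟩
    exact (ContMDiffAt.comp (g := f) p'
      (hfs.contDiffAt (Metric.isOpen_ball.mem_nhds h2)).contMDiffAt
      (contMDiffAt_extChartAt'' h1)).contMDiffWithinAt
  · rintro q ⟨h1, h2⟩ u
    rw [(mvfderiv_comp_extChartAt h1 (hf _ h2).differentiableAt u).2, (hf _ h2).fderiv,
      baseBeta_apply, betaCoord_apply h1, ofCoord_toCoord h1]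

theorem locallyPhiSimple_of_closed (hdim : Module.finrank ℝ EM ≤ 2) {W : Set M} (hW : IsOpen W)
    (h : S.BetaClosedOn W) : S.LocallyPhiSimple W := by
  intro p hp
  obtain ⟨U, hU, hpU, -, φ, hφ, hβ⟩ := exists_potential hdim hW h hp
  refine ⟨U, hU, hpU, φ, hφ, fun q hq u v => ?_⟩
  rw [S.gyroscopicTensor_eq hdim, hβ q hq, hβ q hq]

theorem _root_.TangentCoord.mdifferentiableAt_of_contMDiffOn {φ : M → ℝ} {U : Set M}
    (hφ : ContMDiffOn 𝓘(ℝ, EM) 𝓘(ℝ, ℝ) ∞ φ U) (hU : IsOpen U) {p : M} (hp : p ∈ U) :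
    MDifferentiableAt 𝓘(ℝ, EM) 𝓘(ℝ, ℝ) φ p :=
  (hφ.contMDiffAt (hU.mem_nhds hp)).mdifferentiableAt (by simp)

theorem closed_of_locallyPhiSimple (hdim : Module.finrank ℝ EM ≤ 2) {W : Set M}
    (h : S.LocallyPhiSimple W) : S.BetaClosedOn W := by
  -- In dimension at most one every φ satisfies the identity, so the given φ says nothing about β
  -- and is replaced by the potential 0.
  rcases hdim.lt_or_eq with hlt | heq
  · refine betaClosedOn_of_potential hdim fun p _ => ⟨fun _ => 0, univ, univ_mem, fun q _ =>
      ⟨mdifferentiableAt_const, fun u => ?_⟩⟩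
    rw [S.beta_eq_zero (Nat.lt_succ_iff.1 hlt)]
    exact (DFunLike.congr_fun (mfderiv_const (I := 𝓘(ℝ, EM)) (I' := 𝓘(ℝ, ℝ)) (c := (0 : ℝ))
      (x := S.proj q)) u).symm
  refine betaClosedOn_of_potential hdim fun p hp => ?_
  obtain ⟨U, hU, hpU, φ, hφ, hs⟩ := h p hp
  refine ⟨φ, U, hU.mem_nhds hpU, fun q hq =>
    ⟨mdifferentiableAt_of_contMDiffOn hφ hU hq, fun u => ?_⟩⟩
  by_cases hu : u = 0
  · rw [hu, map_zero, beta_eq_trace, map_zero, map_zero]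
  have : FiniteDimensional ℝ (TangentSpace 𝓘(ℝ, EM) (S.proj q)) :=
    inferInstanceAs (FiniteDimensional ℝ EM)
  obtain ⟨v, hv⟩ := exists_linearIndependent_pair_of_one_lt_finrank (R := ℝ)
    (by rw [finrank_tangentSpace]; omega) hu
  have h1 := hs q hq u v
  rw [S.gyroscopicTensor_eq hdim] at h1
  rw [LinearIndependent.pair_iff] at hv
  have h2 := (hv (S.beta q v - mvfderiv 𝓘(ℝ, EM) φ (S.proj q) v)
    (mvfderiv 𝓘(ℝ, EM) φ (S.proj q) u - S.beta q u) (by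
      rw [sub_smul, sub_smul]
      rw [← sub_eq_zero] at h1
      rw [← h1, neg_smul, neg_smul]
      abel)).2
  linarith

end ChaplyginSystem

/-! ## Determinants and traces -/

section Volume

variable {E : Type*} [NormedAddCommGroup E] [NormedSpace ℝ E]
  {F : Type*} [NormedAddCommGroup F] [NormedSpace ℝ F]

/-- In the Leibniz expansion a nontrivial permutation moves at least two indices, so after
differentiating one factor an off-diagonal entry of the identity is still present. Only the trace
survives. -/
theorem hasFDerivAt_det_of_eq_one {n : Type*} [Fintype n] [DecidableEq n] {A : E → Matrix n n ℝ}
    {A' : n → n → E →L[ℝ] ℝ} {x : E} (hA : ∀ i j, HasFDerivAt (fun x => A x i j) (A' i j) x)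
    (h1 : A x = 1) : HasFDerivAt (fun x => (A x).det) (∑ i, A' i i) x := by
  have h := HasFDerivAt.fun_sum (u := Finset.univ) (x := x) fun (τ : Equiv.Perm n) _ =>
    (HasFDerivAt.finsetProd (u := Finset.univ) (x := x)
      fun i _ => hA (τ i) i).const_mul ((Equiv.Perm.sign τ : ℤ) : ℝ)
  have hfun : (fun x => (A x).det) =
      fun x => ∑ τ : Equiv.Perm n, ((Equiv.Perm.sign τ : ℤ) : ℝ) * ∏ i, A x (τ i) i :=
    funext fun x => Matrix.det_apply' _
  rw [hfun]
  convert! h using 1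
  rw [Finset.sum_eq_single (1 : Equiv.Perm n)]
  · simp [h1]
  · intro τ _ hτ
    rw [Finset.sum_eq_zero, smul_zero]
    intro i _
    -- By injectivity, a permutation fixing every index other than `i` also fixes `i`.
    obtain ⟨j, hji, hj⟩ : ∃ j, j ≠ i ∧ τ j ≠ j := by
      by_contra! hfix
      refine hτ (Equiv.ext fun j => ?_)
      by_cases hji : j = i
      · subst hji
        by_contra hne
        exact hne (τ.injective (hfix _ hne))
      · exact hfix j hji
    rw [Finset.prod_eq_zero (Finset.mem_erase.2 ⟨hji, Finset.mem_univ j⟩), zero_smul]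
    rw [h1, Matrix.one_apply_ne hj]
  · simp

namespace Bil

variable [FiniteDimensional ℝ F]

/-- A bilinear form as an algebraic bilinear form. -/
noncomputable def toBilinForm (γ : Bil F) : LinearMap.BilinForm ℝ F :=
  LinearMap.mk₂ ℝ (fun u v => γ u v) (by simp) (by simp) (by simp) (by simp)

theorem toBilinForm_apply (γ : Bil F) (u v : F) : γ.toBilinForm u v = γ u v := rfl

theorem exists_orthonormal_basis (γ : Bil F) (hs : ∀ u v, γ u v = γ v u)
    (hpos : ∀ u, u ≠ 0 → 0 < γ u u) :
    ∃ b : Module.Basis (Fin (Module.finrank ℝ F)) ℝ F, ∀ i j,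
      γ (b i) (b j) = if i = j then 1 else 0 := by
  obtain ⟨v, hv⟩ := LinearMap.BilinForm.exists_orthogonal_basis (B := γ.toBilinForm)
    ⟨fun u v => hs u v⟩
  have hp : ∀ i, 0 < γ (v i) (v i) := fun i => hpos _ (v.ne_zero i)
  refine ⟨v.isUnitSMul (w := fun i => (√(γ (v i) (v i)))⁻¹)
    fun i => (inv_ne_zero (Real.sqrt_pos.2 (hp i)).ne').isUnit, fun i j => ?_⟩
  rw [Module.Basis.isUnitSMul_apply, Module.Basis.isUnitSMul_apply, map_smul, map_smul, smul_apply,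
    smul_eq_mul, smul_eq_mul]
  split_ifs with h
  · subst h
    have h2 := Real.sqrt_pos.2 (hp i)
    have h3 := Real.mul_self_sqrt (hp i).le
    field_simp
    nlinarith
  · have : γ (v i) (v j) = 0 := hv h
    rw [this, mul_zero, mul_zero]

variable {γ : Bil F} {b : Module.Basis (Fin (Module.finrank ℝ F)) ℝ F}

theorem repr_of_orthonormal (hb : ∀ i j, γ (b i) (b j) = if i = j then 1 else 0) (u : F)
    (i : Fin (Module.finrank ℝ F)) : b.repr u i = γ u (b i) := by
  conv_rhs => rw [← b.sum_repr u]
  rw [map_sum, sum_apply]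
  simp [hb]

theorem trace_of_orthonormal (hb : ∀ i j, γ (b i) (b j) = if i = j then 1 else 0)
    (f : F →ₗ[ℝ] F) : LinearMap.trace ℝ F f = ∑ i, γ (f (b i)) (b i) := by
  rw [LinearMap.trace_eq_matrix_trace ℝ b, Matrix.trace]
  refine Finset.sum_congr rfl fun i _ => ?_
  rw [Matrix.diag_apply, LinearMap.toMatrix_apply, repr_of_orthonormal hb]

/-- The Gram determinant of a bilinear form in a fixed basis. -/
noncomputable def gramDet (γ : Bil F) : ℝ :=
  (LinearMap.BilinForm.toMatrix (Module.finBasis ℝ F) γ.toBilinForm).det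

theorem gramDet_eq (b : Module.Basis (Fin (Module.finrank ℝ F)) ℝ F) (γ : Bil F) :
    γ.gramDet = (b.toMatrix (Module.finBasis ℝ F)).det ^ 2 *
      (LinearMap.BilinForm.toMatrix b γ.toBilinForm).det := by
  rw [gramDet, ← LinearMap.BilinForm.toMatrix_mul_basis_toMatrix (b := b), Matrix.det_mul,
    Matrix.det_mul, Matrix.det_transpose]
  ring

theorem toMatrix_of_orthonormal (hb : ∀ i j, γ (b i) (b j) = if i = j then 1 else 0) :
    LinearMap.BilinForm.toMatrix b γ.toBilinForm = 1 := by
  ext i j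
  rw [LinearMap.BilinForm.toMatrix_apply, toBilinForm_apply, hb, Matrix.one_apply]

theorem gramDet_pos (hb : ∀ i j, γ (b i) (b j) = if i = j then 1 else 0) : 0 < γ.gramDet := by
  rw [gramDet_eq b, toMatrix_of_orthonormal hb, Matrix.det_one, mul_one]
  have h : IsUnit (b.toMatrix (Module.finBasis ℝ F)).det := by
    rw [← Module.Basis.det_apply]
    exact b.isUnit_det (Module.finBasis ℝ F)
  exact pow_two_pos_of_ne_zero h.ne_zero

/-- Jacobi's formula. The basis is orthonormal at `x` only and is kept fixed; changing to it
multiplies the determinant by a constant and makes the Gram matrix the identity at `x`. -/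
theorem fderiv_gramDet {γ : E → Bil F} {x : E} (hγ : DifferentiableAt ℝ γ x)
    (hb : ∀ i j, γ x (b i) (b j) = if i = j then 1 else 0) :
    DifferentiableAt ℝ (fun x => (γ x).gramDet) x ∧ ∀ v,
      fderiv ℝ (fun x => (γ x).gramDet) x v =
        (γ x).gramDet * ∑ i, fderiv ℝ γ x v (b i) (b i) := by
  have hd : ∀ u w, DifferentiableAt ℝ (fun x => γ x u w) x := fun u w =>
    ((show DifferentiableAt ℝ (fun x => (γ x).app) x from hγ).clm_apply
      (differentiableAt_const u)).clm_apply (differentiableAt_const w)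
  have h := (hasFDerivAt_det_of_eq_one
    (A := fun x => LinearMap.BilinForm.toMatrix b (γ x).toBilinForm)
    (A' := fun i j => fderiv ℝ (fun x => γ x (b i) (b j)) x)
    (fun i j => by
      simp only [LinearMap.BilinForm.toMatrix_apply, toBilinForm_apply]
      exact (hd (b i) (b j)).hasFDerivAt)
    (toMatrix_of_orthonormal hb)).const_mul ((b.toMatrix (Module.finBasis ℝ F)).det ^ 2)
  have hfun : (fun x => (γ x).gramDet) = fun x => (b.toMatrix (Module.finBasis ℝ F)).det ^ 2 *
      (LinearMap.BilinForm.toMatrix b (γ x).toBilinForm).det := funext fun x => gramDet_eq b _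
  rw [hfun]
  refine ⟨h.differentiableAt, fun v => ?_⟩
  rw [h.fderiv, gramDet_eq b (γ x), toMatrix_of_orthonormal hb, Matrix.det_one, mul_one, smul_apply, sum_apply, smul_eq_mul]
  congr 1
  refine Finset.sum_congr rfl fun i _ => ?_
  rw [Bil.fderiv_app hγ (differentiableAt_const _) (differentiableAt_const _)]
  simp

theorem contDiffAt_gramDet {γ : E → Bil F} {x : E} {n : ℕ∞ω} (hγ : ContDiffAt ℝ n γ x) :
    ContDiffAt ℝ n (fun x => (γ x).gramDet) x := by
  simp only [gramDet, Matrix.det_apply', LinearMap.BilinForm.toMatrix_apply, toBilinForm_apply]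
  exact ContDiffAt.sum fun τ _ => contDiffAt_const.mul (contDiffAt_prod fun i _ =>
    Bil.contDiffAt_app hγ contDiffAt_const contDiffAt_const)

end Bil

/-! ## Lie derivatives of volume forms -/

theorem trace_prod_eq [FiniteDimensional ℝ E] [FiniteDimensional ℝ F] (f : E × F →ₗ[ℝ] E × F) :
    LinearMap.trace ℝ (E × F) f =
      LinearMap.trace ℝ E (LinearMap.fst ℝ E F ∘ₗ f ∘ₗ LinearMap.inl ℝ E F) +
      LinearMap.trace ℝ F (LinearMap.snd ℝ E F ∘ₗ f ∘ₗ LinearMap.inr ℝ E F) := by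
  rw [← LinearMap.comp_assoc, ← LinearMap.comp_assoc, LinearMap.trace_comp_comm',
    LinearMap.trace_comp_comm' (LinearMap.inr ℝ E F), ← map_add]
  congr 1
  ext <;> simp

/-- The derivation of alternating forms induced by an endomorphism, as a multilinear map. -/
noncomputable def multilinearDeriv {ι V : Type*} [Fintype ι] [DecidableEq ι] [AddCommGroup V]
    [Module ℝ V] (σ : V [⋀^ι]→ₗ[ℝ] ℝ) (f : V →ₗ[ℝ] V) : MultilinearMap ℝ (fun _ : ι => V) ℝ :=
  ∑ i, σ.toMultilinearMap.compLinearMap (Function.update (fun _ => LinearMap.id) i f)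

theorem multilinearDeriv_apply {ι V : Type*} [Fintype ι] [DecidableEq ι] [AddCommGroup V]
    [Module ℝ V] (σ : V [⋀^ι]→ₗ[ℝ] ℝ) (f : V →ₗ[ℝ] V) (w : ι → V) :
    multilinearDeriv σ f w = ∑ i, σ (Function.update w i (f (w i))) := by
  rw [multilinearDeriv, sum_apply]
  refine Finset.sum_congr rfl fun i _ => ?_
  rw [MultilinearMap.compLinearMap_apply]
  change σ _ = _
  congr 1
  funext j
  by_cases hji : j = i
  · subst hji
    simp
  · simp [hji]

/-- The derivation of alternating forms induced by an endomorphism. -/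
noncomputable def alternatingDeriv {ι V : Type*} [Fintype ι] [DecidableEq ι] [AddCommGroup V]
    [Module ℝ V] (σ : V [⋀^ι]→ₗ[ℝ] ℝ) (f : V →ₗ[ℝ] V) : V [⋀^ι]→ₗ[ℝ] ℝ :=
  { multilinearDeriv σ f with
    map_eq_zero_of_eq' := by
      intro w k l hkl hne
      change multilinearDeriv σ f w = 0
      -- With equal vectors in places k and l, the terms altering any other place vanish, and the
      -- two remaining ones differ by a transposition.
      rw [multilinearDeriv_apply, Fintype.sum_eq_add k l hne]
      · have h : Function.update w l (f (w l)) =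
            Function.update w k (f (w k)) ∘ Equiv.swap k l := by
          funext j
          rw [Function.comp_apply]
          by_cases hjl : j = l
          · subst hjl
            rw [Equiv.swap_apply_right, Function.update_self, Function.update_self, hkl]
          by_cases hjk : j = k
          · subst hjk
            rw [Equiv.swap_apply_left, Function.update_of_ne hne, Function.update_of_ne hne.symm,
              hkl]
          · rw [Equiv.swap_apply_of_ne_of_ne hjk hjl, Function.update_of_ne hjl,
              Function.update_of_ne hjk]
        rw [h, σ.map_swap _ hne, add_neg_cancel]
      · rintro i ⟨hik, hil⟩
        refine σ.map_eq_zero_of_eq _ ?_ hne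
        rw [Function.update_of_ne hik.symm, Function.update_of_ne hil.symm, hkl] }

theorem alternatingDeriv_apply {ι V : Type*} [Fintype ι] [DecidableEq ι] [AddCommGroup V]
    [Module ℝ V] (σ : V [⋀^ι]→ₗ[ℝ] ℝ) (f : V →ₗ[ℝ] V) (w : ι → V) :
    alternatingDeriv σ f w = ∑ i, σ (Function.update w i (f (w i))) :=
  multilinearDeriv_apply σ f w

/-- Two top-degree alternating forms agree once they agree on injective families of basis vectors.
Each such family is a reindexed basis, where `sum_alternating_update` applies. -/
theorem alternatingDeriv_eq {ι V : Type*} [Fintype ι] [DecidableEq ι] [AddCommGroup V]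
    [Module ℝ V] (b : Module.Basis ι ℝ V) (σ : V [⋀^ι]→ₗ[ℝ] ℝ) (f : V →ₗ[ℝ] V) :
    alternatingDeriv σ f = LinearMap.trace ℝ V f • σ := by
  refine b.ext_alternating fun v hv => ?_
  have h := sum_alternating_update
    (b.reindex (Equiv.ofBijective v (Finite.injective_iff_bijective.1 hv)).symm) σ f
  have hb : ⇑(b.reindex (Equiv.ofBijective v (Finite.injective_iff_bijective.1 hv)).symm) =
      fun i => b (v i) := by
    funext i
    simp
  rw [hb] at h
  rw [alternatingDeriv_apply, h, AlternatingMap.smul_apply, smul_eq_mul]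

/-- In top degree the second part of the Lie derivative is multiplication by the divergence of Γ. -/
theorem formLieDeriv_eq [FiniteDimensional ℝ E] {k : ℕ} (b : Module.Basis (Fin k) ℝ E) (Γ : E → E)
    (σ : E → E [⋀^Fin k]→L[ℝ] ℝ) (z : E) (w : Fin k → E) :
    formLieDeriv Γ σ z w = fderiv ℝ σ z (Γ z) w +
      LinearMap.trace ℝ E (fderiv ℝ Γ z).toLinearMap * σ z w := by
  rw [formLieDeriv]
  congr 1
  have h := DFunLike.congr_fun (alternatingDeriv_eq b (σ z).toAlternatingMap
    (fderiv ℝ Γ z).toLinearMap) w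
  rw [alternatingDeriv_apply, AlternatingMap.smul_apply] at h
  exact h

/-- The determinant in a basis, as a continuous alternating form. -/
noncomputable def basisDet [FiniteDimensional ℝ E] {k : ℕ} (b : Module.Basis (Fin k) ℝ E) :
    E [⋀^Fin k]→L[ℝ] ℝ :=
  { b.det with
    cont := by
      change Continuous fun w => b.det w
      simp only [Module.Basis.det_apply]
      refine Continuous.matrix_det (continuous_matrix fun i j => ?_)
      exact (LinearMap.continuous_of_finiteDimensional (b.coord i)).comp (continuous_apply j) }

theorem basisDet_self [FiniteDimensional ℝ E] {k : ℕ} (b : Module.Basis (Fin k) ℝ E) :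
    basisDet b b = 1 := b.det_self

theorem formLieDeriv_smul_const [FiniteDimensional ℝ E] {k : ℕ} (b : Module.Basis (Fin k) ℝ E)
    (Γ : E → E) (σ : E [⋀^Fin k]→L[ℝ] ℝ) {ρ : E → ℝ} {z : E} (hρ : DifferentiableAt ℝ ρ z)
    (w : Fin k → E) :
    formLieDeriv Γ (fun z => ρ z • σ) z w =
      (fderiv ℝ ρ z (Γ z) + LinearMap.trace ℝ E (fderiv ℝ Γ z).toLinearMap * ρ z) * σ w := by
  have h : HasFDerivAt (fun z => ρ z • σ) _ z := hρ.hasFDerivAt.smul_const σ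
  rw [formLieDeriv_eq b, h.fderiv]
  change fderiv ℝ ρ z (Γ z) * σ w + _ * (ρ z * σ w) = _
  ring

theorem formLieDeriv_eq_apply [FiniteDimensional ℝ E] {k : ℕ} (b : Module.Basis (Fin k) ℝ E)
    (Γ : E → E) {σ : E → E [⋀^Fin k]→L[ℝ] ℝ} {z : E} (hσ : DifferentiableAt ℝ σ z) (w : Fin k → E) :
    DifferentiableAt ℝ (fun z => σ z w) z ∧ formLieDeriv Γ σ z w =
      fderiv ℝ (fun z => σ z w) z (Γ z) +
        LinearMap.trace ℝ E (fderiv ℝ Γ z).toLinearMap * σ z w := by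
  have h : HasFDerivAt (fun z => σ z w)
      ((ContinuousAlternatingMap.apply ℝ E ℝ w).comp (fderiv ℝ σ z)) z :=
    (ContinuousAlternatingMap.apply ℝ E ℝ w).hasFDerivAt.comp z hσ.hasFDerivAt
  refine ⟨h.differentiableAt, ?_⟩
  rw [formLieDeriv_eq b, h.fderiv]
  rfl

end Volume

/-! ## Gyroscopic geodesic equations in a chart -/

section GyroscopicSpray

variable {E : Type*} [NormedAddCommGroup E] [NormedSpace ℝ E] [FiniteDimensional ℝ E]

namespace Bil

theorem isInvertible_app {γ : Bil E} (hpos : ∀ u, u ≠ 0 → 0 < γ u u) : γ.app.IsInvertible := by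
  have hinj : Function.Injective γ.app := by
    intro u v huv
    by_contra hne
    have h := hpos (u - v) (sub_ne_zero.2 hne)
    have h0 : γ (u - v) = 0 := by rw [map_sub, huv, sub_self]
    rw [h0] at h
    exact h.false
  have hfin : Module.finrank ℝ E = Module.finrank ℝ (E →L[ℝ] ℝ) := by
    rw [← LinearEquiv.finrank_eq (LinearMap.toContinuousLinearMap (𝕜 := ℝ) (E := E) (F' := ℝ))]
    exact (Subspace.dual_finrank_eq (K := ℝ) (V := E)).symm
  have hsurj : Function.Surjective γ.app :=
    (LinearMap.injective_iff_surjective_of_finrank_eq_finrank (f := γ.app.toLinearMap) hfin).1 hinj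
  exact ⟨(LinearEquiv.ofBijective γ.app.toLinearMap ⟨hinj, hsurj⟩).toContinuousLinearEquiv,
    ContinuousLinearMap.ext fun _ => rfl⟩

theorem app_inverse {γ : Bil E} (hpos : ∀ u, u ≠ 0 → 0 < γ u u) (l : E →L[ℝ] ℝ) :
    γ (γ.app.inverse l) = l := by
  obtain ⟨e, he⟩ := isInvertible_app hpos
  rw [← he, ContinuousLinearMap.inverse_equiv]
  exact e.apply_symm_apply l

theorem inverse_app {γ : Bil E} (hpos : ∀ u, u ≠ 0 → 0 < γ u u) (a : E) :
    γ.app.inverse (γ a) = a := by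
  obtain ⟨e, he⟩ := isInvertible_app hpos
  rw [← he, ContinuousLinearMap.inverse_equiv]
  exact e.symm_apply_apply a

end Bil

variable (g : E → Bil E) (β : E → E →L[ℝ] ℝ)

/-- The force covector: `A x v` is the acceleration when `g x (A x v) = gyroForce g β x v`. -/
noncomputable def gyroForce (x v : E) : E →L[ℝ] ℝ :=
  -(fderiv ℝ g x v v) + (1 / 2 : ℝ) • LinearMap.toContinuousLinearMap
      { toFun := fun w => fderiv ℝ g x w v v
        map_add' := fun a b => by simp
        map_smul' := fun c a => by simp }
    - β x v • g x v + g x v v • β x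

theorem gyroForce_apply (x v w : E) : gyroForce g β x v w =
    -(fderiv ℝ g x v v w) + (1 / 2) * fderiv ℝ g x w v v - β x v * g x v w + g x v v * β x w := rfl

/-- `A` solves the geodesic equations of `g` with the gyroscopic force of `β` on `V`. -/
def IsGyroscopicSprayOn (V : Set E) (A : E → E → E) : Prop :=
  ∀ x ∈ V, ∀ v, g x (A x v) = gyroForce g β x v

variable {g β} {V : Set E} {A : E → E → E}

/-- A smooth Riemannian metric and a smooth one-form on an open set. -/
structure IsGyroscopicSystemOn (g : E → Bil E) (β : E → E →L[ℝ] ℝ) (V : Set E) : Prop where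
  isOpen : IsOpen V
  metric_smooth : ∀ x ∈ V, ContDiffAt ℝ ∞ g x
  form_smooth : ∀ x ∈ V, ContDiffAt ℝ ∞ β x
  symm : ∀ x ∈ V, ∀ u w, g x u w = g x w u
  pos : ∀ x ∈ V, ∀ u, u ≠ 0 → 0 < g x u u

theorem IsGyroscopicSystemOn.exists_spray (S : IsGyroscopicSystemOn g β V) :
    ∃ A, IsGyroscopicSprayOn g β V A :=
  ⟨fun x v => (g x).app.inverse (gyroForce g β x v), fun x hx _ => Bil.app_inverse (S.pos x hx) _⟩

/-- The force is homogeneous of degree two in the velocity. -/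
theorem IsGyroscopicSystemOn.smul (S : IsGyroscopicSystemOn g β V)
    (hA : IsGyroscopicSprayOn g β V A) {x : E} (hx : x ∈ V) (t : ℝ) (v : E) :
    A x (t • v) = t ^ 2 • A x v := by
  rw [← Bil.inverse_app (S.pos x hx) (A x (t • v)), ← Bil.inverse_app (S.pos x hx) (t ^ 2 • A x v),
    map_smul, hA x hx, hA x hx]
  congr 1
  ext w
  simp only [gyroForce_apply, smul_apply, map_smul, smul_eq_mul, Bil.smul_app]
  ring

theorem IsGyroscopicSystemOn.contDiffAt (S : IsGyroscopicSystemOn g β V)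
    (hA : IsGyroscopicSprayOn g β V A) {x : E} (hx : x ∈ V) (v : E) :
    ContDiffAt ℝ ∞ (fun z : E × E => A z.1 z.2) (x, v) := by
  have := FiniteDimensional.complete ℝ E
  have hg' : ContDiffAt ℝ ∞ (fun z : E × E => g z.1) (x, v) :=
    ContDiffAt.comp (g := g) (x, v) (S.metric_smooth x hx) contDiffAt_fst
  have hd : ContDiffAt ℝ ∞ (fun z : E × E => fderiv ℝ g z.1) (x, v) :=
    ContDiffAt.comp (g := fderiv ℝ g) (x, v) ((S.metric_smooth x hx).fderiv_right (by simp)) contDiffAt_fst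
  have hβ' : ContDiffAt ℝ ∞ (fun z : E × E => β z.1) (x, v) :=
    ContDiffAt.comp (g := β) (x, v) (S.form_smooth x hx) contDiffAt_fst
  have h2 : ContDiffAt ℝ ∞ (fun z : E × E => z.2) (x, v) := contDiffAt_snd
  have hc : ∀ w : E, ContDiffAt ℝ ∞ (fun _ : E × E => w) (x, v) := fun _ => contDiffAt_const
  have hF : ContDiffAt ℝ ∞ (fun z : E × E => gyroForce g β z.1 z.2) (x, v) := by
    refine Bil.contDiffAt_clm_of_apply fun w => ?_
    simp only [gyroForce_apply]
    exact (((Bil.contDiffAt_app (hd.clm_apply h2) h2 (hc w)).neg.add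
      (contDiffAt_const.mul (Bil.contDiffAt_app (hd.clm_apply (hc w)) h2 h2))).sub
      ((hβ'.clm_apply h2).mul (Bil.contDiffAt_app hg' h2 (hc w)))).add
      ((Bil.contDiffAt_app hg' h2 h2).mul (hβ'.clm_apply (hc w)))
  have hinv : ContDiffAt ℝ ∞ (fun z : E × E => (g z.1).app.inverse) (x, v) :=
    ContDiffAt.comp (g := ContinuousLinearMap.inverse) (f := fun z : E × E => (g z.1).app) (x, v)
      (ContinuousLinearMap.IsInvertible.contDiffAt_map_inverse (Bil.isInvertible_app (S.pos x hx)))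
      hg'
  refine (hinv.clm_apply hF).congr_of_eventuallyEq ?_
  filter_upwards [(S.isOpen.prod isOpen_univ).mem_nhds (show (x, v) ∈ V ×ˢ univ from ⟨hx, trivial⟩)]
    with z hz
  rw [← hA z.1 hz.1, Bil.inverse_app (S.pos z.1 hz.1)]

theorem IsGyroscopicSystemOn.fderiv_symm (S : IsGyroscopicSystemOn g β V) {x : E} (hx : x ∈ V)
    (a u w : E) : fderiv ℝ g x a u w = fderiv ℝ g x a w u := by
  have hd := (S.metric_smooth x hx).differentiableAt (by simp)
  have h : ∀ u w : E, fderiv ℝ (fun x => g x u w) x a = fderiv ℝ g x a u w := fun u w => by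
    rw [Bil.fderiv_app hd (differentiableAt_const u) (differentiableAt_const w)]
    simp
  rw [← h, ← h]
  congr 1
  apply Filter.EventuallyEq.fderiv_eq
  filter_upwards [S.isOpen.mem_nhds hx] with y hy using S.symm y hy u w

/-- Only the velocity block of the derivative contributes. In its trace the terms with a derivative
of g along a basis vector cancel, the derivative along v remains, and the two gyroscopic terms
contribute -m β(v) and β(v). -/
theorem IsGyroscopicSystemOn.trace_fderiv (S : IsGyroscopicSystemOn g β V)
    (hA : IsGyroscopicSprayOn g β V A) {x : E} (hx : x ∈ V) (v : E)
    {b : Module.Basis (Fin (Module.finrank ℝ E)) ℝ E}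
    (hb : ∀ i j, g x (b i) (b j) = if i = j then 1 else 0) :
    LinearMap.trace ℝ (E × E) (fderiv ℝ (fun z : E × E => (z.2, A z.1 z.2)) (x, v)).toLinearMap =
      (1 - (Module.finrank ℝ E : ℝ)) * β x v - ∑ i, fderiv ℝ g x v (b i) (b i) := by
  have hAd : HasFDerivAt (fun z : E × E => A z.1 z.2) _ (x, v) :=
    ((S.contDiffAt hA hx v).differentiableAt (by simp)).hasFDerivAt
  have hΓ : HasFDerivAt (fun z : E × E => (z.2, A z.1 z.2)) _ (x, v) :=
    hasFDerivAt_snd.prodMk hAd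
  rw [hΓ.fderiv, trace_prod_eq]
  set L := fderiv ℝ (fun z : E × E => A z.1 z.2) (x, v) with hL
  have h1 : LinearMap.fst ℝ E E ∘ₗ ((ContinuousLinearMap.snd ℝ E E).prod L).toLinearMap ∘ₗ
      LinearMap.inl ℝ E E = 0 := by
    ext u
    simp
  rw [h1, map_zero, zero_add, Bil.trace_of_orthonormal hb]
  have hi : HasFDerivAt (fun v => ((x, v) : E × E)) (ContinuousLinearMap.inr ℝ E E) v :=
    hasFDerivAt_prodMk_right x v
  have hAv : HasFDerivAt (fun v => A x v) (L.comp (ContinuousLinearMap.inr ℝ E E)) v :=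
    HasFDerivAt.comp (g := fun z : E × E => A z.1 z.2) v hAd hi
  have hid : HasFDerivAt (fun v : E => v) (ContinuousLinearMap.id ℝ E) v := hasFDerivAt_id v
  -- Both sides of g(A(v), w) = force(v)(w) are differentiated in v in the direction e.
  have key : ∀ e w, g x (L (0, e)) w =
      -(fderiv ℝ g x e v w) - fderiv ℝ g x v e w + fderiv ℝ g x w v e
        - β x e * g x v w - β x v * g x e w + 2 * (g x v e * β x w) := by
    intro e w
    have hl : HasFDerivAt (fun v => g x (A x v) w) _ v :=
      ((g x).app.flip w).hasFDerivAt.comp v hAv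
    have hbil : ∀ γ : Bil E, HasFDerivAt (fun v => γ v w) (γ.app.flip w) v := fun γ =>
      (γ.app.flip w).hasFDerivAt
    have hquad : ∀ γ : Bil E, HasFDerivAt (fun v => γ v v) (γ.app v + γ.app.flip v) v := fun γ => by
      have := (γ.app.hasFDerivAt (x := v)).clm_apply hid
      convert! this using 1
    have hd : HasFDerivAt (fun v => fderiv ℝ g x v v w) _ v :=
      (((show E →L[ℝ] E →L[ℝ] E →L[ℝ] ℝ from fderiv ℝ g x).hasFDerivAt (x := v)).clm_apply
        hid).clm_apply (hasFDerivAt_const w v)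
    have hr : HasFDerivAt (fun v => gyroForce g β x v w) _ v :=
      ((hd.neg.add ((hquad (fderiv ℝ g x w)).const_mul (1 / 2))).sub
        ((β x).hasFDerivAt.mul (hbil (g x)))).add ((hquad (g x)).mul_const (β x w))
    have hEq : (fun v => g x (A x v) w) = fun v => gyroForce g β x v w := funext fun v => by
      rw [hA x hx]
    rw [hEq] at hl
    have h := DFunLike.congr_fun (hl.unique hr) e
    simp only [add_apply, sub_apply, neg_apply, smul_apply, smul_eq_mul,
      ContinuousLinearMap.comp_apply, zero_apply, map_zero] at h
    change g x (L (0, e)) w = -(0 + (fderiv ℝ g x v e w + fderiv ℝ g x e v w)) +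
      1 / 2 * (fderiv ℝ g x w v e + fderiv ℝ g x w e v) -
      (β x v * g x e w + g x v w * β x e) + β x w * (g x v e + g x e v) at h
    rw [S.symm x hx e v, S.fderiv_symm hx w e v] at h
    linarith
  have hβ : ∑ i, g x v (b i) * β x (b i) = β x v := by
    conv_rhs => rw [← b.sum_repr v, map_sum]
    refine Finset.sum_congr rfl fun i _ => ?_
    rw [map_smul, Bil.repr_of_orthonormal hb, smul_eq_mul]
  have hsum : ∀ i, g x (L (0, b i)) (b i) =
      -(fderiv ℝ g x v (b i) (b i)) - β x v + g x v (b i) * β x (b i) := by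
    intro i
    rw [key, hb, if_pos rfl]
    ring
  change ∑ i, g x (L (0, b i)) (b i) = _
  simp only [hsum]
  rw [Finset.sum_add_distrib, hβ, Finset.sum_sub_distrib, Finset.sum_neg_distrib, Finset.sum_const,
    Finset.card_univ, Fintype.card_fin, nsmul_eq_mul]
  ring

end GyroscopicSpray

/-! ### Invariant volumes and potentials of the gyroscopic one-form -/

section InvariantVolume

variable {E : Type*} [NormedAddCommGroup E] [NormedSpace ℝ E] [FiniteDimensional ℝ E]
  {g : E → Bil E} {β : E → E →L[ℝ] ℝ} {V : Set E} {A : E → E → E}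

variable (E) in
/-- A basis of the space of positions and velocities. -/
noncomputable def phaseBasis : Module.Basis (Fin (2 * Module.finrank ℝ E)) ℝ (E × E) :=
  Module.finBasisOfFinrankEq ℝ (E × E) (by rw [Module.finrank_prod, two_mul])

namespace IsGyroscopicSystemOn

theorem exists_orthonormal (S : IsGyroscopicSystemOn g β V) {x : E} (hx : x ∈ V) :
    ∃ b : Module.Basis (Fin (Module.finrank ℝ E)) ℝ E, ∀ i j,
      g x (b i) (b j) = if i = j then 1 else 0 :=
  (g x).exists_orthonormal_basis (S.symm x hx) (S.pos x hx)

theorem gramDet_pos (S : IsGyroscopicSystemOn g β V) {x : E} (hx : x ∈ V) : 0 < (g x).gramDet := by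
  obtain ⟨b, hb⟩ := S.exists_orthonormal hx
  exact Bil.gramDet_pos hb

/-- The logarithmic derivative of det g cancels the metric part of the divergence. The hypothesis
`hm` covers m = 2 and β = 0 at once and turns (1 - m) β into -β. -/
theorem trace_add_gramDet (S : IsGyroscopicSystemOn g β V) (hA : IsGyroscopicSprayOn g β V A)
    (hm : ∀ x ∈ V, ∀ v, (Module.finrank ℝ E : ℝ) * β x v = 2 * β x v) {x : E} (hx : x ∈ V) (v : E) :
    fderiv ℝ (fun x => (g x).gramDet) x v + LinearMap.trace ℝ (E × E)
        (fderiv ℝ (fun z : E × E => (z.2, A z.1 z.2)) (x, v)).toLinearMap * (g x).gramDet =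
      -(β x v * (g x).gramDet) := by
  obtain ⟨b, hb⟩ := S.exists_orthonormal hx
  rw [S.trace_fderiv hA hx v hb,
    (Bil.fderiv_gramDet ((S.metric_smooth x hx).differentiableAt (by simp)) hb).2, sub_mul, sub_mul,
    hm x hx]
  ring

theorem differentiableAt_gramDet (S : IsGyroscopicSystemOn g β V) {x : E} (hx : x ∈ V) :
    DifferentiableAt ℝ (fun x => (g x).gramDet) x :=
  (Bil.contDiffAt_gramDet (S.metric_smooth x hx)).differentiableAt (by simp)

theorem exists_invariant_volume (S : IsGyroscopicSystemOn g β V) (hA : IsGyroscopicSprayOn g β V A)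
    (hm : ∀ x ∈ V, ∀ v, (Module.finrank ℝ E : ℝ) * β x v = 2 * β x v) {φ : E → ℝ}
    (hφs : ContDiffOn ℝ ∞ φ V) (hφ : ∀ x ∈ V, HasFDerivAt φ (β x) x) :
    ∃ σ : E × E → (E × E) [⋀^Fin (2 * Module.finrank ℝ E)]→L[ℝ] ℝ,
      ContDiffOn ℝ ∞ σ (V ×ˢ univ) ∧
      (∀ z ∈ V ×ˢ (univ : Set E), σ z ≠ 0 ∧
        ∀ w, formLieDeriv (fun y : E × E => (y.2, A y.1 y.2)) σ z w = 0) ∧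
      ∀ x v, σ (x, v) = σ (x, 0) := by
  let c := phaseBasis E
  -- The factor e^φ compensates the -β left over in `trace_add_gramDet`.
  let ρ : E → ℝ := fun x => (g x).gramDet * Real.exp (φ x)
  refine ⟨fun z => ρ z.1 • basisDet c, ?_, ?_, fun x v => rfl⟩
  · have hρ : ContDiffOn ℝ ∞ ρ V := fun x hx =>
      ((Bil.contDiffAt_gramDet (S.metric_smooth x hx)).contDiffWithinAt).mul (hφs x hx).exp
    exact (ContDiffOn.comp (g := ρ) hρ contDiffOn_fst fun z hz => hz.1).smul contDiffOn_const
  · rintro ⟨x, v⟩ ⟨hx, -⟩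
    have hpos : 0 < ρ x := mul_pos (S.gramDet_pos hx) (Real.exp_pos _)
    refine ⟨fun h0 => ?_, fun w => ?_⟩
    · have h1 := DFunLike.congr_fun h0 (⇑c)
      change ρ x * basisDet c c = 0 at h1
      rw [basisDet_self, mul_one] at h1
      exact hpos.ne' h1
    · have hρ := (S.differentiableAt_gramDet hx).hasFDerivAt.mul (hφ x hx).exp
      have hρ' : HasFDerivAt (fun z : E × E => ρ z.1) _ (x, v) :=
        HasFDerivAt.comp (g := ρ) (x, v) hρ hasFDerivAt_fst
      rw [formLieDeriv_smul_const c _ _ hρ'.differentiableAt, hρ'.fderiv]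
      have h := S.trace_add_gramDet hA hm hx v
      have h2 : (g x).gramDet * (Real.exp (φ x) * β x v) + Real.exp (φ x) *
          fderiv ℝ (fun x => (g x).gramDet) x v + LinearMap.trace ℝ (E × E)
          (fderiv ℝ (fun z : E × E => (z.2, A z.1 z.2)) (x, v)).toLinearMap *
          ((g x).gramDet * Real.exp (φ x)) = 0 := by
        linear_combination Real.exp (φ x) * h
      exact mul_eq_zero_of_left h2 _

/-- Invariance says that Γ F = β(v) for the logarithm F of the density relative to det g. The
density may depend on the velocity; homogeneity of the acceleration removes this dependence in the
limit of zero velocity. -/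
theorem exists_potential_of_invariant_volume (S : IsGyroscopicSystemOn g β V)
    (hA : IsGyroscopicSprayOn g β V A)
    (hm : ∀ x ∈ V, ∀ v, (Module.finrank ℝ E : ℝ) * β x v = 2 * β x v)
    {σ : E × E → (E × E) [⋀^Fin (2 * Module.finrank ℝ E)]→L[ℝ] ℝ}
    (hσ : ContDiffOn ℝ ∞ σ (V ×ˢ univ))
    (hinv : ∀ z ∈ V ×ˢ (univ : Set E), σ z ≠ 0 ∧
      ∀ w, formLieDeriv (fun y : E × E => (y.2, A y.1 y.2)) σ z w = 0) :
    ∃ f : E → ℝ, ∀ x ∈ V, HasFDerivAt f (β x) x := by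
  let c := phaseBasis E
  -- `Real.log` is log|·|, so the sign of the density is irrelevant.
  let F : E × E → ℝ := fun z => Real.log (σ z c) - Real.log (g z.1).gramDet
  have hO : IsOpen (V ×ˢ (univ : Set E)) := S.isOpen.prod isOpen_univ
  have hne : ∀ z ∈ V ×ˢ (univ : Set E), σ z c ≠ 0 := by
    intro z hz h0
    refine (hinv z hz).1 (ContinuousAlternatingMap.toAlternatingMap_injective ?_)
    have h1 := (σ z).toAlternatingMap.eq_smul_basis_det c
    rw [h1]
    change σ z c • c.det = _
    rw [h0, zero_smul]
    rfl
  have hFs : ∀ z ∈ V ×ˢ (univ : Set E), ContDiffAt ℝ ∞ F z := by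
    intro z hz
    have h1 : ContDiffAt ℝ ∞ (fun z => σ z c) z :=
      (ContinuousAlternatingMap.apply ℝ (E × E) ℝ ⇑c).contDiff.contDiffAt.comp z
        (hσ.contDiffAt (hO.mem_nhds hz))
    have h2 : ContDiffAt ℝ ∞ (fun z : E × E => (g z.1).gramDet) z :=
      ContDiffAt.comp (g := fun x => (g x).gramDet) z
        (Bil.contDiffAt_gramDet (S.metric_smooth z.1 hz.1)) contDiffAt_fst
    exact (h1.log (hne z hz)).sub (h2.log (S.gramDet_pos hz.1).ne')
  have key : ∀ x ∈ V, ∀ v, fderiv ℝ F (x, v) (v, A x v) = β x v := by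
    intro x hx v
    have hz : (x, v) ∈ V ×ˢ (univ : Set E) := ⟨hx, trivial⟩
    obtain ⟨hd, h1⟩ := formLieDeriv_eq_apply c (fun y : E × E => (y.2, A y.1 y.2))
      ((hσ.contDiffAt (hO.mem_nhds hz)).differentiableAt (by simp)) ⇑c
    rw [(hinv _ hz).2] at h1
    have h2 : HasFDerivAt (fun z : E × E => (g z.1).gramDet) _ (x, v) :=
      HasFDerivAt.comp (g := fun x => (g x).gramDet) (x, v)
        (S.differentiableAt_gramDet hx).hasFDerivAt hasFDerivAt_fst
    have hF : HasFDerivAt F _ (x, v) :=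
      (hd.hasFDerivAt.log (hne _ hz)).sub (h2.log (S.gramDet_pos hx).ne')
    have h3 := S.trace_add_gramDet hA hm hx v
    rw [hF.fderiv]
    change (σ (x, v) c)⁻¹ * fderiv ℝ (fun z => σ z c) (x, v) (v, A x v) -
      ((g x).gramDet)⁻¹ * fderiv ℝ (fun x => (g x).gramDet) x v = β x v
    rw [eq_neg_of_add_eq_zero_left h1.symm, eq_sub_of_add_eq h3]
    have h4 := hne _ hz
    have h5 := (S.gramDet_pos hx).ne'
    change σ (x, v) c ≠ 0 at h4
    field_simp
    ring
  refine ⟨fun x => F (x, 0), fun x hx => ?_⟩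
  have hz : (x, (0 : E)) ∈ V ×ˢ (univ : Set E) := ⟨hx, trivial⟩
  have hd : HasFDerivAt (fun x => F (x, 0)) _ x :=
    HasFDerivAt.comp (g := F) x ((hFs _ hz).differentiableAt (by simp)).hasFDerivAt
      (hasFDerivAt_prodMk_left x (0 : E))
  convert! hd using 1
  ext v
  -- At velocity t v the field is (t v, t² A) = t (v, t A), so a factor t cancels on both sides.
  have hscale : ∀ᶠ t : ℝ in 𝓝[≠] 0, fderiv ℝ F (x, t • v) (v, t • A x v) = β x v := by
    filter_upwards [self_mem_nhdsWithin] with t ht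
    have h1 := key x hx (t • v)
    rw [S.smul hA hx, map_smul] at h1
    have h2 : ((t • v, t ^ 2 • A x v) : E × E) = t • (v, t • A x v) := by
      rw [Prod.smul_mk, smul_smul, sq]
    rw [h2, map_smul, smul_eq_mul, smul_eq_mul] at h1
    exact mul_left_cancel₀ ht h1
  have hcont : ContinuousAt (fun t : ℝ => fderiv ℝ F (x, t • v) (v, t • A x v)) 0 := by
    have h1 : ContinuousAt (fun t : ℝ => fderiv ℝ F (x, t • v)) 0 := by
      refine ContinuousAt.comp (g := fderiv ℝ F) (f := fun t : ℝ => (x, t • v)) ?_ (by fun_prop)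
      rw [zero_smul]
      exact ((hFs _ hz).fderiv_right (m := ∞) (by simp)).continuousAt
    exact h1.clm_apply (by fun_prop)
  have h3 : Tendsto (fun t : ℝ => fderiv ℝ F (x, t • v) (v, t • A x v)) (𝓝[≠] 0)
      (𝓝 (fderiv ℝ F (x, (0 : ℝ) • v) (v, (0 : ℝ) • A x v))) := hcont.tendsto.mono_left inf_le_left
  have h4 := tendsto_nhds_unique (h3.congr' hscale) tendsto_const_nhds
  rw [zero_smul, zero_smul] at h4
  exact h4.symm

end IsGyroscopicSystemOn

end InvariantVolume
-- Invariant volumes of the reduced equations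
namespace ChaplyginSystem

open TangentCoord

variable {EQ : Type*} [NormedAddCommGroup EQ] [NormedSpace ℝ EQ] [FiniteDimensional ℝ EQ]
  {Q : Type*} [TopologicalSpace Q] [ChartedSpace EQ Q] [IsManifold 𝓘(ℝ, EQ) ∞ Q]
  {EG : Type*} [NormedAddCommGroup EG] [NormedSpace ℝ EG] [FiniteDimensional ℝ EG]
  {G : Type*} [TopologicalSpace G] [ChartedSpace EG G] [Group G] [LieGroup 𝓘(ℝ, EG) ∞ G]
  [MulAction G Q] [ContMDiffSMul 𝓘(ℝ, EG) 𝓘(ℝ, EQ) ∞ G Q] [ProperSMul G Q]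
  {EM : Type*} [NormedAddCommGroup EM] [NormedSpace ℝ EM] [FiniteDimensional ℝ EM]
  {M : Type*} [TopologicalSpace M] [ChartedSpace EM M] [IsManifold 𝓘(ℝ, EM) ∞ M]
  (S : ChaplyginSystem EQ Q EG G EM M)

variable {S} {p₀ : M} {V : Set EM} {A : EM → EM → EM}

theorem _root_.TangentCoord.isOpen_extChartAt_image {U : Set M} (hU : IsOpen U)
    (hUs : U ⊆ (extChartAt 𝓘(ℝ, EM) p₀).source) : IsOpen (extChartAt 𝓘(ℝ, EM) p₀ '' U) := by
  rw [PartialEquiv.image_eq_target_inter_inv_preimage _ hUs]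
  exact (continuousOn_extChartAt_symm p₀).isOpen_inter_preimage (isOpen_extChartAt_target p₀) hU

theorem isGyroscopicSystemOn (hdim : Module.finrank ℝ EM ≤ 2) (hV : IsOpen V)
    (hVt : V ⊆ (extChartAt 𝓘(ℝ, EM) p₀).target) :
    IsGyroscopicSystemOn (S.baseMetric p₀) (S.baseBeta p₀) V where
  isOpen := hV
  metric_smooth _ hx := contDiffAt_baseMetric (hVt hx)
  form_smooth _ hx := contDiffAt_baseBeta hdim (hVt hx)
  symm x _ := S.baseMetric_symm p₀ x
  pos _ hx _ hu := baseMetric_pos (hVt hx) hu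

/-- The trace formula turns the gyroscopic force into the β-terms of `gyroForce`. -/
theorem isReducedAccelerationOn_iff (hdim : Module.finrank ℝ EM ≤ 2)
    (hVt : V ⊆ (extChartAt 𝓘(ℝ, EM) p₀).target) :
    S.IsReducedAccelerationOn p₀ V A ↔
      IsGyroscopicSprayOn (S.baseMetric p₀) (S.baseBeta p₀) V A := by
  refine forall₂_congr fun x hx => forall_congr' fun v => ?_
  rw [ContinuousLinearMap.ext_iff]
  refine forall_congr' fun w => ?_
  rw [fderiv_baseMetric (hVt hx), fderiv_baseMetric (hVt hx), gyroCoord_eq_beta hdim (hVt hx),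
    gyroForce_apply, ← baseMetric_apply]
  constructor <;> intro h <;> linarith

theorem finrank_mul_baseBeta (hdim : Module.finrank ℝ EM ≤ 2) (x v : EM) :
    (Module.finrank ℝ EM : ℝ) * S.baseBeta p₀ x v = 2 * S.baseBeta p₀ x v := by
  rcases hdim.lt_or_eq with h | h
  · rw [baseBeta_eq_zero (Nat.lt_succ_iff.1 h)]
    simp
  · rw [h]
    norm_num

theorem locallyHasBasicInvariantVolume_of_closed (hdim : Module.finrank ℝ EM ≤ 2) {W : Set M}
    (hW : IsOpen W) (h : S.BetaClosedOn W) : S.LocallyHasBasicInvariantVolume W := by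
  intro p hp
  obtain ⟨U, hU, hpU, hUW, φ, hφ, hβ⟩ := exists_potential hdim hW h hp
  have hUs : U ⊆ (extChartAt 𝓘(ℝ, EM) p).source := fun _ hx => (hUW hx).2
  have hVt : extChartAt 𝓘(ℝ, EM) p '' U ⊆ (extChartAt 𝓘(ℝ, EM) p).target := by
    rintro _ ⟨x, hx, rfl⟩
    exact (extChartAt 𝓘(ℝ, EM) p).map_source (hUs hx)
  have hV : IsOpen (extChartAt 𝓘(ℝ, EM) p '' U) := isOpen_extChartAt_image hU hUs
  have hS := isGyroscopicSystemOn (S := S) hdim hV hVt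
  obtain ⟨A, hA⟩ := hS.exists_spray
  have hφd : ∀ x ∈ extChartAt 𝓘(ℝ, EM) p '' U,
      ContDiffAt ℝ ∞ (fun y => φ ((extChartAt 𝓘(ℝ, EM) p).symm y)) x := by
    rintro _ ⟨x, hx, rfl⟩
    exact (contMDiffAt_iff_comp_symm (hUs hx)).1 (hφ.contMDiffAt (hU.mem_nhds hx))
  obtain ⟨σ, hσ, hinv, hbasic⟩ := hS.exists_invariant_volume hA
    (fun x _ v => finrank_mul_baseBeta hdim x v)
    (φ := fun y => φ ((extChartAt 𝓘(ℝ, EM) p).symm y))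
    (fun x hx => (hφd x hx).contDiffWithinAt) (by
      rintro _ ⟨x, hx, rfl⟩
      obtain ⟨q, rfl⟩ := S.proj_surjective x
      convert! ((hφd _ ⟨_, hx, rfl⟩).differentiableAt (by simp)).hasFDerivAt using 1
      ext u
      rw [baseBeta_apply, betaCoord_apply (hUs hx), hβ q hx,
        mvfderiv_eq_fderiv (hUs hx) (mdifferentiableAt_of_contMDiffOn hφ hU hx),
        toCoord_ofCoord (hUs hx)])
  exact ⟨U, hU, hpU, hUs, σ, ⟨A, (isReducedAccelerationOn_iff hdim hVt).2 hA, hσ, hinv⟩,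
    fun x _ v => hbasic x v⟩

theorem closed_of_locallyHasInvariantVolume (hdim : Module.finrank ℝ EM ≤ 2) {W : Set M}
    (h : S.LocallyHasInvariantVolume W) : S.BetaClosedOn W := by
  refine betaClosedOn_of_potential hdim fun p hp => ?_
  obtain ⟨U, hU, hpU, hUs, σ, A, hA, hσ, hinv⟩ := h p hp
  have hVt : extChartAt 𝓘(ℝ, EM) p '' U ⊆ (extChartAt 𝓘(ℝ, EM) p).target := by
    rintro _ ⟨x, hx, rfl⟩
    exact (extChartAt 𝓘(ℝ, EM) p).map_source (hUs hx)
  have hV : IsOpen (extChartAt 𝓘(ℝ, EM) p '' U) := isOpen_extChartAt_image hU hUs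
  obtain ⟨f, hf⟩ := (isGyroscopicSystemOn (S := S) hdim hV hVt).exists_potential_of_invariant_volume
    ((isReducedAccelerationOn_iff hdim hVt).1 hA) (fun x _ v => finrank_mul_baseBeta hdim x v) hσ hinv
  refine ⟨fun p' => f (extChartAt 𝓘(ℝ, EM) p p'), U, hU.mem_nhds hpU, fun q hq => ?_⟩
  have hfq := hf _ ⟨_, hq, rfl⟩
  refine ⟨(mvfderiv_comp_extChartAt (hUs hq) hfq.differentiableAt 0).1, fun u => ?_⟩
  rw [(mvfderiv_comp_extChartAt (hUs hq) hfq.differentiableAt u).2, hfq.fderiv, baseBeta_apply,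
    betaCoord_apply (hUs hq), ofCoord_toCoord (hUs hq)]

end ChaplyginSystem

/-! ## The Levi-Civita connection in charts -/

section LeviCivita

open TangentCoord

variable {EQ : Type*} [NormedAddCommGroup EQ] [NormedSpace ℝ EQ] [FiniteDimensional ℝ EQ]
  {Q : Type*} [TopologicalSpace Q] [ChartedSpace EQ Q] [IsManifold 𝓘(ℝ, EQ) ∞ Q]
  {q₀ q : Q} {g : (q : Q) → TangentSpace 𝓘(ℝ, EQ) q →L[ℝ] TangentSpace 𝓘(ℝ, EQ) q →L[ℝ] ℝ}
  {X Y Z : (q : Q) → TangentSpace 𝓘(ℝ, EQ) q}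

theorem TangentCoord.metricRep_fieldRep (hq : q ∈ (extChartAt 𝓘(ℝ, EQ) q₀).source) :
    (fun y => g ((extChartAt 𝓘(ℝ, EQ) q₀).symm y) (X ((extChartAt 𝓘(ℝ, EQ) q₀).symm y))
      (Y ((extChartAt 𝓘(ℝ, EQ) q₀).symm y))) =ᶠ[𝓝 (extChartAt 𝓘(ℝ, EQ) q₀ q)]
    fun y => metricRep q₀ g y (fieldRep q₀ X y) (fieldRep q₀ Y y) := by
  filter_upwards [target_mem_nhds hq] with y hy
  have h := metricRep_toCoord ((extChartAt 𝓘(ℝ, EQ) q₀).map_target hy) g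
    (X ((extChartAt 𝓘(ℝ, EQ) q₀).symm y)) (Y ((extChartAt 𝓘(ℝ, EQ) q₀).symm y))
  rw [(extChartAt 𝓘(ℝ, EQ) q₀).right_inv hy] at h
  exact h.symm

theorem TangentCoord.mvfderiv_metric (hq : q ∈ (extChartAt 𝓘(ℝ, EQ) q₀).source)
    (hg : ContDiffAt ℝ ∞ (metricRep q₀ g) (extChartAt 𝓘(ℝ, EQ) q₀ q))
    (hX : ContDiffAt ℝ ∞ (fieldRep q₀ X) (extChartAt 𝓘(ℝ, EQ) q₀ q))
    (hY : ContDiffAt ℝ ∞ (fieldRep q₀ Y) (extChartAt 𝓘(ℝ, EQ) q₀ q))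
    (v : TangentSpace 𝓘(ℝ, EQ) q) :
    mvfderiv 𝓘(ℝ, EQ) (fun x => g x (X x) (Y x)) q v =
      fderiv ℝ (fun y => metricRep q₀ g y (fieldRep q₀ X y) (fieldRep q₀ Y y))
        (extChartAt 𝓘(ℝ, EQ) q₀ q) (toCoord q₀ q v) := by
  have h := metricRep_fieldRep (g := g) (X := X) (Y := Y) hq
  have hs : ContMDiffAt 𝓘(ℝ, EQ) 𝓘(ℝ, ℝ) ∞ (fun x => g x (X x) (Y x)) q :=
    (contMDiffAt_iff_comp_symm hq).2 ((Bil.contDiffAt_app hg hX hY).congr_of_eventuallyEq h)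
  rw [mvfderiv_eq_fderiv hq (hs.mdifferentiableAt (by simp)), h.fderiv_eq]

/-- The Koszul identity depends on the test field only through its value at the point, and every
tangent vector extends to a smooth test field with constant components. -/
theorem isLeviCivitaAt_iff_koszul (hq : q ∈ (extChartAt 𝓘(ℝ, EQ) q₀).source)
    (hg : ContDiffAt ℝ ∞ (metricRep q₀ g) (extChartAt 𝓘(ℝ, EQ) q₀ q))
    (hs : ∀ v w, g q v w = g q w v)
    (hX : ContMDiffAt 𝓘(ℝ, EQ) 𝓘(ℝ, EQ).tangent ∞
      (fun x => (⟨x, X x⟩ : TangentBundle 𝓘(ℝ, EQ) Q)) q) (a : TangentSpace 𝓘(ℝ, EQ) q) :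
    IsLeviCivitaAt g X X q a ↔ ∀ z : TangentSpace 𝓘(ℝ, EQ) q,
      2 * g q a z = koszul (metricRep q₀ g) (fieldRep q₀ X) (extChartAt 𝓘(ℝ, EQ) q₀ q)
        (toCoord q₀ q z) := by
  have := FiniteDimensional.complete ℝ EQ
  have hX' := (contMDiffAt_iff_fieldRep hq).1 hX
  have hs' : ∀ u w, metricRep q₀ g (extChartAt 𝓘(ℝ, EQ) q₀ q) u w =
      metricRep q₀ g (extChartAt 𝓘(ℝ, EQ) q₀ q) w u := fun u w => by
    rw [metricRep_apply hq, metricRep_apply hq, hs]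
  have key : ∀ Z : (q : Q) → TangentSpace 𝓘(ℝ, EQ) q,
      ContMDiffAt 𝓘(ℝ, EQ) 𝓘(ℝ, EQ).tangent ∞
        (fun x => (⟨x, Z x⟩ : TangentBundle 𝓘(ℝ, EQ) Q)) q →
      mvfderiv 𝓘(ℝ, EQ) (fun x => g x (X x) (Z x)) q (X q)
        + mvfderiv 𝓘(ℝ, EQ) (fun x => g x (X x) (Z x)) q (X q)
        - mvfderiv 𝓘(ℝ, EQ) (fun x => g x (X x) (X x)) q (Z q)
        + g q (VectorField.mlieBracket 𝓘(ℝ, EQ) X X q) (Z q)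
        - g q (VectorField.mlieBracket 𝓘(ℝ, EQ) X Z q) (X q)
        - g q (VectorField.mlieBracket 𝓘(ℝ, EQ) X Z q) (X q) =
      koszul (metricRep q₀ g) (fieldRep q₀ X) (extChartAt 𝓘(ℝ, EQ) q₀ q) (toCoord q₀ q (Z q)) := by
    intro Z hZ
    have hZ' := (contMDiffAt_iff_fieldRep hq).1 hZ
    rw [mvfderiv_metric hq hg hX' hZ', mvfderiv_metric hq hg hX' hX',
      ← metricRep_toCoord hq g _ (Z q), ← metricRep_toCoord hq g _ (X q),
      toCoord_mlieBracket hq hX hX, toCoord_mlieBracket hq hX hZ, ← fieldRep_extChartAt hq,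
      ← fieldRep_extChartAt hq]
    exact koszul_formula (hg.differentiableAt (by simp)) hs' (hX'.differentiableAt (by simp))
      (hZ'.differentiableAt (by simp))
  constructor
  · intro h z
    have hz := contMDiffAt_ofCoord hq (toCoord q₀ q z)
    have h1 := h (fun x => ofCoord q₀ x (toCoord q₀ q z)) hz
    rw [key _ hz] at h1
    simpa only [ofCoord_toCoord hq] using h1
  · intro h Z hZ
    rw [h, key Z hZ]

/-- The covector of `koszul` as a continuous linear form. -/
noncomputable def koszulForm {E : Type*} [NormedAddCommGroup E] [NormedSpace ℝ E]
    [FiniteDimensional ℝ E] (γ : E → Bil E) (X : E → E) (y : E) : E →L[ℝ] ℝ :=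
  LinearMap.toContinuousLinearMap
    { toFun := koszul γ X y
      map_add' := fun a b => by simp only [koszul, map_add, Bil.add_app, add_apply]; ring
      map_smul' := fun c a => by
        simp only [koszul, map_smul, Bil.smul_app, smul_apply, smul_eq_mul, RingHom.id_apply]; ring }

theorem exists_isLeviCivitaAt (hg : ContDiffAt ℝ ∞ (metricRep q g) (extChartAt 𝓘(ℝ, EQ) q q))
    (hs : ∀ v w, g q v w = g q w v) (hpos : ∀ v, v ≠ 0 → 0 < g q v v)
    (hX : ContMDiffAt 𝓘(ℝ, EQ) 𝓘(ℝ, EQ).tangent ∞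
      (fun x => (⟨x, X x⟩ : TangentBundle 𝓘(ℝ, EQ) Q)) q) :
    ∃ a, IsLeviCivitaAt g X X q a := by
  have hq : q ∈ (extChartAt 𝓘(ℝ, EQ) q).source := mem_extChartAt_source q
  have hp : ∀ u, u ≠ 0 → 0 < metricRep q g (extChartAt 𝓘(ℝ, EQ) q q) u u := by
    intro u hu
    rw [metricRep_apply hq]
    refine hpos _ fun h => hu ?_
    rw [← toCoord_ofCoord hq u, h, map_zero]
  let a := (metricRep q g (extChartAt 𝓘(ℝ, EQ) q q)).app.inverse
    ((1 / 2 : ℝ) • koszulForm (metricRep q g) (fieldRep q X) (extChartAt 𝓘(ℝ, EQ) q q))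
  refine ⟨ofCoord q q a, (isLeviCivitaAt_iff_koszul hq hg hs hX _).2 fun z => ?_⟩
  rw [← metricRep_toCoord hq, toCoord_ofCoord hq, Bil.app_inverse hp]
  change 2 * ((1 / 2) * koszul _ _ _ _) = _
  ring

theorem koszul_congr {E : Type*} [NormedAddCommGroup E] [NormedSpace ℝ E] {γ γ' : E → Bil E}
    {y : E} (h : γ =ᶠ[𝓝 y] γ') (X : E → E) (z : E) : koszul γ X y z = koszul γ' X y z := by
  rw [koszul, koszul, h.fderiv_eq, h.self_of_nhds]

end LeviCivita

namespace ChaplyginSystem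

open TangentCoord

variable {EQ : Type*} [NormedAddCommGroup EQ] [NormedSpace ℝ EQ] [FiniteDimensional ℝ EQ]
  {Q : Type*} [TopologicalSpace Q] [ChartedSpace EQ Q] [IsManifold 𝓘(ℝ, EQ) ∞ Q]
  {EG : Type*} [NormedAddCommGroup EG] [NormedSpace ℝ EG] [FiniteDimensional ℝ EG]
  {G : Type*} [TopologicalSpace G] [ChartedSpace EG G] [Group G] [LieGroup 𝓘(ℝ, EG) ∞ G]
  [MulAction G Q] [ContMDiffSMul 𝓘(ℝ, EG) 𝓘(ℝ, EQ) ∞ G Q] [ProperSMul G Q]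
  {EM : Type*} [NormedAddCommGroup EM] [NormedSpace ℝ EM] [FiniteDimensional ℝ EM]
  {M : Type*} [TopologicalSpace M] [ChartedSpace EM M] [IsManifold 𝓘(ℝ, EM) ∞ M]
  (S : ChaplyginSystem EQ Q EG G EM M)

/-! ## Projective geodesic extensions -/

theorem _root_.Bil.ext {F : Type*} [NormedAddCommGroup F] [NormedSpace ℝ F] {γ δ : Bil F}
    (h : ∀ a b, γ a b = δ a b) : γ = δ :=
  show γ.app = δ.app from ContinuousLinearMap.ext fun a => ContinuousLinearMap.ext (h a)

theorem _root_.TangentCoord.metricRep_smul {q₀ q : Q} (hq : q ∈ (extChartAt 𝓘(ℝ, EQ) q₀).source)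
    (c : Q → ℝ) (g : (q : Q) → TangentSpace 𝓘(ℝ, EQ) q →L[ℝ] TangentSpace 𝓘(ℝ, EQ) q →L[ℝ] ℝ) :
    metricRep q₀ (fun q => c q • g q) =ᶠ[𝓝 (extChartAt 𝓘(ℝ, EQ) q₀ q)]
      fun y => c ((extChartAt 𝓘(ℝ, EQ) q₀).symm y) • metricRep q₀ g y := by
  filter_upwards [eventually_symm_mem_source hq] with y hy
  refine Bil.ext fun a b => ?_
  rw [metricRep_apply' hy]
  change _ = c _ * metricRep q₀ g y a b
  rw [metricRep_apply' hy]
  rfl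

variable {S} {U : Set M} {f : M → ℝ}

theorem mvfderiv_comp_proj {q : Q} (hf : MDifferentiableAt 𝓘(ℝ, EM) 𝓘(ℝ, ℝ) f (S.proj q))
    (v : TangentSpace 𝓘(ℝ, EQ) q) :
    MDifferentiableAt 𝓘(ℝ, EQ) 𝓘(ℝ, ℝ) (fun q => f (S.proj q)) q ∧
    mvfderiv 𝓘(ℝ, EQ) (fun q => f (S.proj q)) q v =
      mvfderiv 𝓘(ℝ, EM) f (S.proj q) (S.dproj q v) := by
  have hπ := (S.proj_smooth.contMDiffAt (x := q)).mdifferentiableAt (by simp)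
  exact ⟨hf.comp q hπ, DFunLike.congr_fun (mfderiv_comp (I := 𝓘(ℝ, EQ)) (I' := 𝓘(ℝ, EM))
    (I'' := 𝓘(ℝ, ℝ)) q hf hπ) v⟩

theorem contMDiffAt_comp_proj (hU : IsOpen U) (hf : ContMDiffOn 𝓘(ℝ, EM) 𝓘(ℝ, ℝ) ∞ f U) {q : Q}
    (hq : S.proj q ∈ U) : ContMDiffAt 𝓘(ℝ, EQ) 𝓘(ℝ, ℝ) ∞ (fun q => f (S.proj q)) q :=
  ContMDiffAt.comp (g := f) q (hf.contMDiffAt (hU.mem_nhds hq)) S.proj_smooth.contMDiffAt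

theorem preimage_mem_nhds (hU : IsOpen U) {q : Q} (hq : S.proj q ∈ U) : S.proj ⁻¹' U ∈ 𝓝 q :=
  S.proj_smooth.continuous.continuousAt.preimage_mem_nhds (hU.mem_nhds hq)

theorem sub_hlift_mem_vert (q : Q) (v : TangentSpace 𝓘(ℝ, EQ) q) :
    v - S.hlift q (S.dproj q v) ∈ S.vert q := by
  change S.dproj q (v - S.hlift q (S.dproj q v)) = 0
  rw [map_sub, dproj_hlift, sub_self]

variable (S) in
/-- A Riemannian metric over `U` which agrees with the kinetic energy metric on the constraint
distribution and makes the vertical distribution orthogonal to it. -/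
structure IsOrthogonalExtensionOn (U : Set M)
    (gbar : (q : Q) → TangentSpace 𝓘(ℝ, EQ) q →L[ℝ] TangentSpace 𝓘(ℝ, EQ) q →L[ℝ] ℝ) : Prop where
  isOpen : IsOpen U
  riemannian : IsRiemannianOn gbar (S.proj ⁻¹' U)
  dist_eq : ∀ q, S.proj q ∈ U → ∀ v ∈ S.dist q, ∀ w ∈ S.dist q,
    gbar q v w = S.metric.inner q v w
  vert_eq : ∀ q, S.proj q ∈ U → ∀ v ∈ S.vert q, ∀ w ∈ S.dist q, gbar q v w = 0

variable {gbar : (q : Q) → TangentSpace 𝓘(ℝ, EQ) q →L[ℝ] TangentSpace 𝓘(ℝ, EQ) q →L[ℝ] ℝ}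

/-! ### Horizontal and vertical components of the conformally changed acceleration -/

namespace IsOrthogonalExtensionOn

variable {q : Q}

theorem contDiffAt_extension (B : S.IsOrthogonalExtensionOn U gbar) (hq : S.proj q ∈ U) :
    ContDiffAt ℝ ∞ (metricRep q gbar) (extChartAt 𝓘(ℝ, EQ) q q) :=
  (contMDiffAt_iff_metricRep (mem_extChartAt_source q)).1
    (B.riemannian.smooth.contMDiffAt (preimage_mem_nhds B.isOpen hq))

theorem contDiffAt_conformal (B : S.IsOrthogonalExtensionOn U gbar)
    (hf : ContMDiffOn 𝓘(ℝ, EM) 𝓘(ℝ, ℝ) ∞ f U) (hq : S.proj q ∈ U) :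
    ContDiffAt ℝ ∞ (metricRep q (fun q => Real.exp (2 * f (S.proj q)) • gbar q))
      (extChartAt 𝓘(ℝ, EQ) q q) := by
  have hs : q ∈ (extChartAt 𝓘(ℝ, EQ) q).source := mem_extChartAt_source q
  have hF := (contMDiffAt_iff_comp_symm hs).1 (contMDiffAt_comp_proj B.isOpen hf hq)
  exact ((contDiffAt_const.mul hF).exp.smul (B.contDiffAt_extension hq)).congr_of_eventuallyEq
    (metricRep_smul hs (fun q => Real.exp (2 * f (S.proj q))) gbar)

variable {X : (q : Q) → TangentSpace 𝓘(ℝ, EQ) q} {a ahat : TangentSpace 𝓘(ℝ, EQ) q}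

theorem two_mul_conformal (B : S.IsOrthogonalExtensionOn U gbar)
    (hf : ContMDiffOn 𝓘(ℝ, EM) 𝓘(ℝ, ℝ) ∞ f U) (hq : S.proj q ∈ U)
    (hX : ContMDiffAt 𝓘(ℝ, EQ) 𝓘(ℝ, EQ).tangent ∞
      (fun x => (⟨x, X x⟩ : TangentBundle 𝓘(ℝ, EQ) Q)) q)
    (hahat : IsLeviCivitaAt (fun q => Real.exp (2 * f (S.proj q)) • gbar q) X X q ahat)
    (z : TangentSpace 𝓘(ℝ, EQ) q) :
    2 * gbar q ahat z = koszul (metricRep q gbar) (fieldRep q X) (extChartAt 𝓘(ℝ, EQ) q q)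
        (toCoord q q z) + 4 * mvfderiv 𝓘(ℝ, EM) f (S.proj q) (S.dproj q (X q)) * gbar q (X q) z
        - 2 * mvfderiv 𝓘(ℝ, EM) f (S.proj q) (S.dproj q z) * gbar q (X q) (X q) := by
  have hs : q ∈ (extChartAt 𝓘(ℝ, EQ) q).source := mem_extChartAt_source q
  have hfd := mdifferentiableAt_of_contMDiffOn hf B.isOpen hq
  have hd := fun v => (mvfderiv_eq_fderiv hs (mvfderiv_comp_proj hfd v).1 v).symm.trans
    (mvfderiv_comp_proj hfd v).2
  have hF := (contMDiffAt_iff_comp_symm hs).1 (contMDiffAt_comp_proj B.isOpen hf hq)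
  have h := (isLeviCivitaAt_iff_koszul hs (B.contDiffAt_conformal hf hq)
    (fun v w => congrArg (Real.exp (2 * f (S.proj q)) * ·) (B.riemannian.symm q hq v w)) hX
    ahat).1 hahat z
  rw [koszul_congr (metricRep_smul hs (fun q => Real.exp (2 * f (S.proj q))) gbar),
    koszul_conformal ((B.contDiffAt_extension hq).differentiableAt (by simp))
      (hF.differentiableAt (by simp)), fieldRep_extChartAt hs, hd, hd, metricRep_toCoord hs,
    metricRep_toCoord hs, (extChartAt 𝓘(ℝ, EQ) q).left_inv hs] at h
  change 2 * (Real.exp (2 * f (S.proj q)) * gbar q ahat z) = _ at h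
  have hne := (Real.exp_pos (2 * f (S.proj q))).ne'
  apply mul_left_cancel₀ hne
  rw [← h]
  ring

/-- Combines `koszul_horizontal` with the conformal change and rewrites the curvature term through
β. The first correction is proportional to X, while the second, |X|² times β - df, is the
obstruction to a projective extension. -/
theorem metric_horizontal (hdim : Module.finrank ℝ EM ≤ 2) (B : S.IsOrthogonalExtensionOn U gbar)
    (hf : ContMDiffOn 𝓘(ℝ, EM) 𝓘(ℝ, ℝ) ∞ f U) (hq : S.proj q ∈ U)
    (hX : ContMDiffAt 𝓘(ℝ, EQ) 𝓘(ℝ, EQ).tangent ∞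
      (fun x => (⟨x, X x⟩ : TangentBundle 𝓘(ℝ, EQ) Q)) q)
    (hXD : ∀ᶠ x in 𝓝 q, X x ∈ S.dist x) (ha : IsLeviCivitaAt S.metric.inner X X q a)
    (hahat : IsLeviCivitaAt (fun q => Real.exp (2 * f (S.proj q)) • gbar q) X X q ahat)
    {z : TangentSpace 𝓘(ℝ, EQ) q} (hz : z ∈ S.dist q) :
    gbar q ahat z = S.metric.inner q a z
      + (2 * mvfderiv 𝓘(ℝ, EM) f (S.proj q) (S.dproj q (X q)) - S.beta q (S.dproj q (X q)))
        * S.metric.inner q (X q) z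
      + (S.beta q (S.dproj q z) - mvfderiv 𝓘(ℝ, EM) f (S.proj q) (S.dproj q z))
        * S.metric.inner q (X q) (X q) := by
  have hs : q ∈ (extChartAt 𝓘(ℝ, EQ) q).source := mem_extChartAt_source q
  have hp : S.proj q ∈ (extChartAt 𝓘(ℝ, EM) (S.proj q)).source := mem_extChartAt_source _
  have hγ := contDiffAt_metricRep (S := S) q hs
  have hXq := hXD.self_of_nhds
  have h1 := (isLeviCivitaAt_iff_koszul hs hγ (S.metric.symm q) hX a).1 ha z
  have h2 := B.two_mul_conformal hf hq hX hahat z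
  have h3 := koszul_horizontal (γ := metricRep q S.metric.inner) (γb := metricRep q gbar)
    (Pr := S.horCoord q (S.proj q)) (X := fieldRep q X) (y := extChartAt 𝓘(ℝ, EQ) q q)
    (z := toCoord q q z) (hγ.differentiableAt (by simp))
    ((B.contDiffAt_extension hq).differentiableAt (by simp))
    (fun u w => by rw [metricRep_apply hs, metricRep_apply hs, S.metric.symm])
    (fun u w => by rw [metricRep_apply hs, metricRep_apply hs, B.riemannian.symm q hq])
    ((contDiffAt_horCoord hs hp).differentiableAt (by simp))
    (((contMDiffAt_iff_fieldRep hs).1 hX).differentiableAt (by simp))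
    (horCoord_section hs hp hXD) (horCoord_idem hs hp) (by
      refine eventually_coord hs (inter_mem (preimage_mem_nhds B.isOpen hq)
        (proj_source_mem_nhds hp)) ?_
      rintro q' ⟨h1, h2⟩ hq' u w
      rw [← toCoord_ofCoord hq' u, ← toCoord_ofCoord hq' w, horCoord_toCoord hq' h2,
        horCoord_toCoord hq' h2, metricRep_toCoord hq', metricRep_toCoord hq',
        B.dist_eq q' h1 _ (S.hlift_mem q' _) _ (S.hlift_mem q' _)])
    (by
      intro u w
      rw [← toCoord_ofCoord hs u, ← toCoord_ofCoord hs w, horCoord_toCoord hs hp,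
        horCoord_toCoord hs hp, ← map_sub, metricRep_toCoord hs, B.riemannian.symm q hq,
        B.vert_eq q hq _ (sub_hlift_mem_vert q _) _ (S.hlift_mem q _)])
    (by rw [horCoord_toCoord hs hp, S.hlift_dproj hz])
  have h4 : metricRep q S.metric.inner (extChartAt 𝓘(ℝ, EQ) q q)
      (fieldRep q X (extChartAt 𝓘(ℝ, EQ) q q)) (curvForm (S.horCoord q (S.proj q))
        (extChartAt 𝓘(ℝ, EQ) q q) (fieldRep q X (extChartAt 𝓘(ℝ, EQ) q q)) (toCoord q q z)) =
      -S.beta q (S.dproj q (X q)) * S.metric.inner q (X q) z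
        + S.beta q (S.dproj q z) * S.metric.inner q (X q) (X q) := by
    rw [fieldRep_extChartAt hs, ← S.hlift_dproj hXq, ← S.hlift_dproj hz, ← toCoord_curvature hs hp,
      metricRep_toCoord hs, dproj_hlift, dproj_hlift, ← metricCurv, S.metricCurv_eq_beta hdim]
    rfl
  rw [h4] at h3
  rw [B.dist_eq q hq _ hXq _ hz, B.dist_eq q hq _ hXq _ hXq] at h2
  linarith

/-- Both conformal terms vanish on a vertical vector, since the factor is a pullback from the base
and X is horizontal; the rest is `koszul_vertical` with the reduced metric on the base. -/
theorem metric_vertical (B : S.IsOrthogonalExtensionOn U gbar)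
    (hf : ContMDiffOn 𝓘(ℝ, EM) 𝓘(ℝ, ℝ) ∞ f U) (hq : S.proj q ∈ U)
    (hX : ContMDiffAt 𝓘(ℝ, EQ) 𝓘(ℝ, EQ).tangent ∞
      (fun x => (⟨x, X x⟩ : TangentBundle 𝓘(ℝ, EQ) Q)) q)
    (hXD : ∀ᶠ x in 𝓝 q, X x ∈ S.dist x)
    (hahat : IsLeviCivitaAt (fun q => Real.exp (2 * f (S.proj q)) • gbar q) X X q ahat)
    {z : TangentSpace 𝓘(ℝ, EQ) q} (hz : z ∈ S.vert q) : gbar q ahat z = 0 := by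
  have hs : q ∈ (extChartAt 𝓘(ℝ, EQ) q).source := mem_extChartAt_source q
  have hp : S.proj q ∈ (extChartAt 𝓘(ℝ, EM) (S.proj q)).source := mem_extChartAt_source _
  have hXq := hXD.self_of_nhds
  have hz0 : S.dproj q z = 0 := hz
  have h2 := B.two_mul_conformal hf hq hX hahat z
  rw [hz0, map_zero, B.riemannian.symm q hq (X q) z, B.vert_eq q hq z hz _ hXq] at h2
  have hbm := contDiffAt_baseMetric (S := S) ((extChartAt 𝓘(ℝ, EM) (S.proj q)).map_source hp)
  have h3 := koszul_vertical (γb := metricRep q gbar) (hh := S.baseMetric (S.proj q))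
    (p := S.projCoord q (S.proj q)) (X := fieldRep q X)
    -- Subtracting the horizontal part extends `z` to a vertical field with value `z` at the point.
    (Z := fun y => toCoord q q z - S.horCoord q (S.proj q) y (toCoord q q z))
    (y := extChartAt 𝓘(ℝ, EQ) q q)
    ((B.contDiffAt_extension hq).differentiableAt (by simp)) (by
      refine eventually_coord hs (preimage_mem_nhds B.isOpen hq) ?_
      intro q' h1 hq' u w
      rw [metricRep_apply hq', metricRep_apply hq', B.riemannian.symm q' h1])
    (contDiffAt_projCoord hs hp) (by
      rw [projCoord_apply hs]
      exact hbm.differentiableAt (by simp))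
    (S.baseMetric_symm _ _)
    (((contMDiffAt_iff_fieldRep hs).1 hX).differentiableAt (by simp))
    ((differentiableAt_const _).fun_sub (((contDiffAt_horCoord hs hp).differentiableAt
      (by simp)).clm_apply (differentiableAt_const _))) (by
      refine eventually_coord hs (inter_mem (inter_mem (preimage_mem_nhds B.isOpen hq)
        (proj_source_mem_nhds hp)) hXD) ?_
      rintro q' ⟨⟨h1, h2⟩, h3⟩ hq' u
      rw [← toCoord_ofCoord hq' u, fieldRep_extChartAt hq', metricRep_toCoord hq',
        fderiv_projCoord hq' h2, fderiv_projCoord hq' h2, projCoord_apply hq', baseMetric_apply,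
        metricCoord_apply h2, ofCoord_toCoord h2, ofCoord_toCoord h2]
      set v := ofCoord q q' u
      have h4 := B.vert_eq q' h1 _ (sub_hlift_mem_vert q' v) _ h3
      rw [map_sub, sub_apply, sub_eq_zero] at h4
      rw [h4, B.dist_eq q' h1 _ (S.hlift_mem q' _) _ h3, redMetric, S.hlift_dproj h3])
    (by
      refine eventually_coord hs (proj_source_mem_nhds hp) ?_
      intro q' h2 hq'
      obtain ⟨v, hv⟩ : ∃ v, toCoord q q' v = toCoord q q z := ⟨_, toCoord_ofCoord hq' _⟩
      rw [← hv, horCoord_toCoord hq' h2, ← map_sub, fderiv_projCoord hq' h2, map_sub, dproj_hlift,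
        sub_self, map_zero])
  beta_reduce at h3
  have h5 : S.hlift q (0 : TangentSpace 𝓘(ℝ, EM) (S.proj q)) = 0 := map_zero (S.hliftₗ q)
  rw [horCoord_toCoord hs hp, hz0, h5, map_zero, sub_zero] at h3
  rw [h3] at h2
  linarith

end IsOrthogonalExtensionOn

variable (S)

/-- Provides smoothness on the tangent bundle of the fibrewise linear function P = d(φ ∘ π). -/
theorem _root_.TangentCoord.contMDiffOn_mvfderiv {N : Set Q} (hN : IsOpen N) {h : Q → ℝ}
    (hh : ∀ q ∈ N, ContMDiffAt 𝓘(ℝ, EQ) 𝓘(ℝ, ℝ) ∞ h q) :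
    ContMDiffOn 𝓘(ℝ, EQ).tangent 𝓘(ℝ, ℝ) ∞
      (fun z : TangentBundle 𝓘(ℝ, EQ) Q => mvfderiv 𝓘(ℝ, EQ) h z.proj z.2) {z | z.proj ∈ N} := by
  intro z hz
  have hs : z.proj ∈ (extChartAt 𝓘(ℝ, EQ) z.proj).source := mem_extChartAt_source _
  have hπ : ContMDiff 𝓘(ℝ, EQ).tangent 𝓘(ℝ, EQ) ∞
      (fun z : TangentBundle 𝓘(ℝ, EQ) Q => z.proj) := Bundle.contMDiff_proj _
  have h1 : ContMDiffAt 𝓘(ℝ, EQ).tangent 𝓘(ℝ, EQ) ∞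
      (fun w : TangentBundle 𝓘(ℝ, EQ) Q => extChartAt 𝓘(ℝ, EQ) z.proj w.proj) z :=
    ContMDiffAt.comp (g := extChartAt 𝓘(ℝ, EQ) z.proj) (I' := 𝓘(ℝ, EQ)) z
      (contMDiffAt_extChartAt'' hs) hπ.contMDiffAt
  have hd : ContDiffAt ℝ ∞ (fderiv ℝ fun y => h ((extChartAt 𝓘(ℝ, EQ) z.proj).symm y))
      (extChartAt 𝓘(ℝ, EQ) z.proj z.proj) :=
    ((contMDiffAt_iff_comp_symm hs).1 (hh _ hz)).fderiv_right (by simp)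
  have h2 : ContMDiffAt 𝓘(ℝ, EQ).tangent 𝓘(ℝ, EQ →L[ℝ] ℝ) ∞
      (fun w : TangentBundle 𝓘(ℝ, EQ) Q =>
        fderiv ℝ (fun y => h ((extChartAt 𝓘(ℝ, EQ) z.proj).symm y))
          (extChartAt 𝓘(ℝ, EQ) z.proj w.proj)) z :=
    ContMDiffAt.comp (I' := 𝓘(ℝ, EQ))
      (g := fderiv ℝ fun y => h ((extChartAt 𝓘(ℝ, EQ) z.proj).symm y)) z hd.contMDiffAt h1
  have h3 : ContMDiffAt 𝓘(ℝ, EQ).tangent 𝓘(ℝ, EQ) ∞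
      (fun w : TangentBundle 𝓘(ℝ, EQ) Q =>
        (trivializationAt EQ (TangentSpace 𝓘(ℝ, EQ)) z.proj w).2) z := by
    have hm : z ∈ (trivializationAt EQ (TangentSpace 𝓘(ℝ, EQ)) z.proj).source :=
      FiberBundle.mem_trivializationAt_proj_source
    exact contMDiffAt_snd.comp z
      ((Trivialization.contMDiffOn (IB := 𝓘(ℝ, EQ)) (n := ∞)
        (trivializationAt EQ (TangentSpace 𝓘(ℝ, EQ)) z.proj)).contMDiffAt
        ((trivializationAt EQ (TangentSpace 𝓘(ℝ, EQ)) z.proj).open_source.mem_nhds hm))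
  refine ((h2.clm_apply h3).congr_of_eventuallyEq ?_).contMDiffWithinAt
  have hev := hπ.continuous.continuousAt.eventually
    (((isOpen_extChartAt_source (I := 𝓘(ℝ, EQ)) z.proj).inter hN).mem_nhds ⟨hs, hz⟩)
  filter_upwards [hev] with w hw
  rw [mvfderiv_eq_fderiv hw.1 ((hh _ hw.2).mdifferentiableAt (by simp)), toCoord,
    Trivialization.continuousLinearMapAt_apply_of_mem]
  exact mem_baseSet hw.1

/-- The metric which agrees with the kinetic energy metric on the constraint distribution and on the
vertical distribution, and makes them orthogonal. -/
noncomputable def orthExt (q : Q) :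
    TangentSpace 𝓘(ℝ, EQ) q →L[ℝ] TangentSpace 𝓘(ℝ, EQ) q →L[ℝ] ℝ :=
  let g : EQ →L[ℝ] EQ →L[ℝ] ℝ := S.metric.inner q
  let H : EQ →L[ℝ] EQ := LinearMap.toContinuousLinearMap (E := EQ) (F' := EQ)
    (S.hliftₗ q ∘ₗ (S.dproj q).toLinearMap)
  (g.bilinearComp H H + g.bilinearComp (ContinuousLinearMap.id ℝ EQ - H)
    (ContinuousLinearMap.id ℝ EQ - H) : EQ →L[ℝ] EQ →L[ℝ] ℝ)

theorem orthExt_apply (q : Q) (v w : TangentSpace 𝓘(ℝ, EQ) q) :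
    S.orthExt q v w = S.metric.inner q (S.hlift q (S.dproj q v)) (S.hlift q (S.dproj q w)) +
      S.metric.inner q (v - S.hlift q (S.dproj q v)) (w - S.hlift q (S.dproj q w)) := rfl

theorem isRiemannianOn_orthExt (N : Set Q) : IsRiemannianOn S.orthExt N where
  symm q _ v w := by
    rw [orthExt_apply, orthExt_apply, S.metric.symm q (S.hlift q (S.dproj q w)),
      S.metric.symm q (w - _)]
  pos q _ v hv := by
    have hnn : ∀ w, 0 ≤ S.metric.inner q w w := fun w => by
      by_cases hw : w = 0
      · rw [hw, map_zero]
      · exact (S.metric.pos q w hw).le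
    rw [orthExt_apply]
    by_cases h0 : S.hlift q (S.dproj q v) = 0
    · rw [h0, sub_zero, map_zero, zero_add]
      exact S.metric.pos q v hv
    · exact add_pos_of_pos_of_nonneg (S.metric.pos q _ h0) (hnn _)
  smooth q _ := by
    have hs : q ∈ (extChartAt 𝓘(ℝ, EQ) q).source := mem_extChartAt_source q
    have hp : S.proj q ∈ (extChartAt 𝓘(ℝ, EM) (S.proj q)).source := mem_extChartAt_source _
    refine ContMDiffAt.contMDiffWithinAt ((contMDiffAt_iff_metricRep hs).2 ?_)
    refine Bil.contDiffAt_of_app fun u w => ?_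
    have hγ := contDiffAt_metricRep (S := S) q hs
    have hH : ∀ u : EQ, ContDiffAt ℝ ∞ (fun y => S.horCoord q (S.proj q) y u)
        (extChartAt 𝓘(ℝ, EQ) q q) := fun u =>
      (contDiffAt_horCoord hs hp).clm_apply contDiffAt_const
    refine ((Bil.contDiffAt_app hγ (hH u) (hH w)).add (Bil.contDiffAt_app hγ
      ((contDiffAt_const (c := u)).sub (hH u))
      ((contDiffAt_const (c := w)).sub (hH w)))).congr_of_eventuallyEq ?_
    refine eventually_coord hs (proj_source_mem_nhds hp) ?_
    intro q' h2 hq'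
    beta_reduce
    rw [← toCoord_ofCoord hq' u, ← toCoord_ofCoord hq' w, horCoord_toCoord hq' h2,
      horCoord_toCoord hq' h2, ← map_sub, ← map_sub, metricRep_toCoord hq', metricRep_toCoord hq',
      metricRep_toCoord hq', orthExt_apply]

theorem dact_hlift_dproj (h : G) (q : Q) (v : TangentSpace 𝓘(ℝ, EQ) q) :
    dact Q h q (S.hlift q (S.dproj q v)) = S.hlift (h • q) (S.dproj (h • q) (dact Q h q v)) := by
  have h1 := dact_vertProj (S := S) h v
  rw [vertProj_apply, vertProj_apply, map_sub] at h1
  exact sub_right_injective h1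

theorem orthExt_invariant (h : G) (q : Q) (v w : TangentSpace 𝓘(ℝ, EQ) q) :
    S.orthExt (h • q) (mfderiv 𝓘(ℝ, EQ) 𝓘(ℝ, EQ) (fun x : Q => h • x) q v)
      (mfderiv 𝓘(ℝ, EQ) 𝓘(ℝ, EQ) (fun x : Q => h • x) q w) = S.orthExt q v w := by
  change S.orthExt (h • q) (dact Q h q v) (dact Q h q w) = _
  rw [orthExt_apply, orthExt_apply, ← dact_hlift_dproj, ← dact_hlift_dproj, ← map_sub, ← map_sub]
  exact congrArg₂ (· + ·) (S.metric_invariant h q _ _) (S.metric_invariant h q _ _)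

theorem isOrthogonalExtensionOn_orthExt {U : Set M} (hU : IsOpen U) :
    S.IsOrthogonalExtensionOn U S.orthExt where
  isOpen := hU
  riemannian := S.isRiemannianOn_orthExt _
  dist_eq q _ v hv w hw := by
    rw [orthExt_apply, S.hlift_dproj hv, S.hlift_dproj hw, sub_self, map_zero, zero_apply, add_zero]
  vert_eq q _ v hv w hw := by
    have h0 : S.dproj q v = 0 := hv
    have h1 : S.hlift q (0 : TangentSpace 𝓘(ℝ, EM) (S.proj q)) = 0 := map_zero (S.hliftₗ q)
    rw [orthExt_apply, h0, h1, S.hlift_dproj hw, sub_self, map_zero, map_zero, zero_apply, add_zero]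

variable {S}

theorem IsOrthogonalExtensionOn.eq_zero {U : Set M}
    {gbar : (q : Q) → TangentSpace 𝓘(ℝ, EQ) q →L[ℝ] TangentSpace 𝓘(ℝ, EQ) q →L[ℝ] ℝ}
    (B : S.IsOrthogonalExtensionOn U gbar) {q : Q} (hq : S.proj q ∈ U)
    {w : TangentSpace 𝓘(ℝ, EQ) q} (h1 : ∀ z ∈ S.dist q, gbar q w z = 0)
    (h2 : ∀ z ∈ S.vert q, gbar q w z = 0) : w = 0 := by
  by_contra hne
  have h := B.riemannian.pos q hq w hne
  have h3 : gbar q w (S.hlift q (S.dproj q w) + (w - S.hlift q (S.dproj q w))) = 0 := by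
    rw [map_add, h1 _ (S.hlift_mem q _), h2 _ (sub_hlift_mem_vert q w), add_zero]
  rw [add_sub_cancel] at h3
  exact h.ne' h3

/-- With f = φ the obstruction β - df vanishes and the factor 2 df - β of X becomes dφ, so P = d(φ ∘
π). The two accelerations then agree against horizontal and against vertical vectors. -/
theorem hasConformalGeodesicExtensionOn (hdim : Module.finrank ℝ EM ≤ 2) {U : Set M}
    (hU : IsOpen U) {φ : M → ℝ} (hφ : ContMDiffOn 𝓘(ℝ, EM) 𝓘(ℝ, ℝ) ∞ φ U)
    (hβ : ∀ q, S.proj q ∈ U → ∀ u, S.beta q u = mvfderiv 𝓘(ℝ, EM) φ (S.proj q) u) :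
    S.HasConformalGeodesicExtensionOn U := by
  have B := S.isOrthogonalExtensionOn_orthExt hU
  refine ⟨φ, S.orthExt, fun q => mvfderiv 𝓘(ℝ, EQ) (fun q => φ (S.proj q)) q, hφ, B.riemannian,
    fun h q _ => S.orthExt_invariant h q, B.dist_eq, B.vert_eq, ⟨?_, ?_, ?_⟩, ?_⟩
  · intro q hq v w
    exact congrArg (Real.exp (2 * φ (S.proj q)) * ·) (B.riemannian.symm q hq v w)
  · intro q hq v hv
    exact mul_pos (Real.exp_pos _) (B.riemannian.pos q hq v hv)
  · intro q hq
    exact ((contMDiffAt_iff_metricRep (mem_extChartAt_source q)).2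
      (B.contDiffAt_conformal hφ hq)).contMDiffWithinAt
  · refine ⟨contMDiffOn_mvfderiv (hU.preimage S.proj_smooth.continuous)
      fun q hq => contMDiffAt_comp_proj hU hφ hq, ?_⟩
    intro q hq X hX hXD
    have hs : q ∈ (extChartAt 𝓘(ℝ, EQ) q).source := mem_extChartAt_source q
    obtain ⟨a, ha⟩ := exists_isLeviCivitaAt (g := S.metric.inner) (contDiffAt_metricRep q hs)
      (S.metric.symm q) (S.metric.pos q) hX
    obtain ⟨ahat, hahat⟩ := exists_isLeviCivitaAt
      (g := fun q => Real.exp (2 * φ (S.proj q)) • S.orthExt q) (B.contDiffAt_conformal hφ hq)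
      (fun v w => congrArg (Real.exp (2 * φ (S.proj q)) * ·) (B.riemannian.symm q hq v w))
      (fun v hv => mul_pos (Real.exp_pos _) (B.riemannian.pos q hq v hv)) hX
    refine ⟨a, ahat, ha, hahat, Eq.symm (sub_eq_zero.1 (B.eq_zero hq (fun z hz => ?_)
      fun z hz => ?_))⟩
    · rw [map_sub, map_sub, map_smul, sub_apply, sub_apply, smul_apply, smul_eq_mul,
        B.metric_horizontal hdim hφ hq hX hXD ha hahat hz, B.dist_eq q hq _ (S.orthProj_mem q a) _ hz,
        S.metric_orthProj a hz, B.dist_eq q hq _ hXD.self_of_nhds _ hz, hβ q hq, hβ q hq,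
        (mvfderiv_comp_proj (mdifferentiableAt_of_contMDiffOn hφ hU hq) (X q)).2]
      ring
    · rw [map_sub, map_sub, map_smul, sub_apply, sub_apply, smul_apply, smul_eq_mul,
        B.metric_vertical hφ hq hX hXD hahat hz, B.riemannian.symm q hq (X q),
        B.vert_eq q hq z hz _ hXD.self_of_nhds, B.riemannian.symm q hq (S.orthProj q a),
        B.vert_eq q hq z hz _ (S.orthProj_mem q a)]
      simp

theorem locallyHasConformalGeodesicExtension_of_closed (hdim : Module.finrank ℝ EM ≤ 2)
    {W : Set M} (hW : IsOpen W) (h : S.BetaClosedOn W) :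
    S.LocallyHasConformalGeodesicExtension W := by
  intro p hp
  obtain ⟨U, hU, hpU, -, φ, hφ, hβ⟩ := exists_potential hdim hW h hp
  exact ⟨U, hU, hpU, hasConformalGeodesicExtensionOn hdim hU hφ hβ⟩

theorem closed_of_finrank_le_one (hdim : Module.finrank ℝ EM ≤ 1) (W : Set M) :
    S.BetaClosedOn W := by
  intro p₀ x _ _ u w
  have h0 : ∀ w, S.betaCoord p₀ w = fun _ => 0 := fun w => funext fun x => S.beta_eq_zero hdim _ _
  rw [h0, h0]
  simp

/-- Put α = β - df. Taking z = u in `metric_horizontal` eliminates P and leaves α(z) g(u, u) = α(u)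
g(u, z) for all u and z. In dimension two each u ≠ 0 has some z ≠ 0 orthogonal to it, and exchanging
the roles gives α(u) g(z, z) = 0. -/
theorem beta_eq_of_extension (hdim : Module.finrank ℝ EM = 2) {U : Set M}
    {f : M → ℝ} {gbar : (q : Q) → TangentSpace 𝓘(ℝ, EQ) q →L[ℝ] TangentSpace 𝓘(ℝ, EQ) q →L[ℝ] ℝ}
    {P : (q : Q) → TangentSpace 𝓘(ℝ, EQ) q →L[ℝ] ℝ} (B : S.IsOrthogonalExtensionOn U gbar)
    (hf : ContMDiffOn 𝓘(ℝ, EM) 𝓘(ℝ, ℝ) ∞ f U)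
    (hP : S.IsProjectiveGeodesicExtensionOn (S.proj ⁻¹' U)
      (fun q => Real.exp (2 * f (S.proj q)) • gbar q) P) {q : Q} (hq : S.proj q ∈ U)
    (u : TangentSpace 𝓘(ℝ, EM) (S.proj q)) :
    S.beta q u = mvfderiv 𝓘(ℝ, EM) f (S.proj q) u := by
  have key : ∀ u z : TangentSpace 𝓘(ℝ, EM) (S.proj q),
      (S.beta q z - mvfderiv 𝓘(ℝ, EM) f (S.proj q) z) * S.redMetric q u u =
        (S.beta q u - mvfderiv 𝓘(ℝ, EM) f (S.proj q) u) * S.redMetric q u z := by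
    intro u z
    let X := S.hliftField (FiberBundle.extend EM u)
    have hX : ContMDiffAt 𝓘(ℝ, EQ) 𝓘(ℝ, EQ).tangent ∞
        (fun x => (⟨x, X x⟩ : TangentBundle 𝓘(ℝ, EQ) Q)) q :=
      contMDiffAt_hliftField (FiberBundle.contMDiffAt_extend 𝓘(ℝ, EM) EM u)
    have hXD : ∀ᶠ x in 𝓝 q, X x ∈ S.dist x := Eventually.of_forall (hliftField_mem _)
    have hXq : X q = S.hlift q u := by
      change S.hlift q (FiberBundle.extend EM u (S.proj q)) = _
      rw [FiberBundle.extend_apply_self]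
    obtain ⟨a, ahat, ha, hahat, hah⟩ := hP.2.2 q hq X hX hXD
    have h : ∀ z, (2 * mvfderiv 𝓘(ℝ, EM) f (S.proj q) u - S.beta q u - P q (X q)) *
        S.redMetric q u z + (S.beta q z - mvfderiv 𝓘(ℝ, EM) f (S.proj q) z) *
        S.redMetric q u u = 0 := by
      intro z
      have h1 := B.metric_horizontal hdim.le hf hq hX hXD ha hahat (S.hlift_mem q z)
      have h2 := B.dist_eq q hq _ (S.orthProj_mem q a) _ (S.hlift_mem q z)
      rw [S.metric_orthProj a (S.hlift_mem q z), hah, map_sub, map_smul, sub_apply, smul_apply,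
        smul_eq_mul, h1, B.dist_eq q hq _ hXD.self_of_nhds _ (S.hlift_mem q z)] at h2
      rw [hXq, dproj_hlift, dproj_hlift] at h2
      rw [redMetric, redMetric, hXq]
      linarith
    by_cases hu : u = 0
    · have h0 : S.redMetric q 0 z = 0 := by simpa using S.redMetric_smul_left q 0 0 z
      have h1 : S.redMetric q 0 0 = 0 := by simpa using S.redMetric_smul_left q 0 0 0
      rw [hu, h0, h1, mul_zero, mul_zero]
    · have h1 := h u
      rw [← add_mul] at h1
      have h2 := (mul_eq_zero.1 h1).resolve_right (S.redMetric_pos q hu).ne'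
      have h3 := h z
      linear_combination h3 - S.redMetric q u z * h2
  by_cases hu : u = 0
  · rw [hu, map_zero, beta_eq_trace, map_zero, map_zero]
  have : FiniteDimensional ℝ (TangentSpace 𝓘(ℝ, EM) (S.proj q)) :=
    inferInstanceAs (FiniteDimensional ℝ EM)
  obtain ⟨v, hv⟩ := exists_linearIndependent_pair_of_one_lt_finrank (R := ℝ)
    (by rw [finrank_tangentSpace]; omega) hu
  have hup := S.redMetric_pos q hu
  -- Gram–Schmidt without division: orthogonal to `u`, and nonzero because the coefficient of `v`
  -- is.
  let z := S.redMetric q u u • v + (-S.redMetric q u v) • u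
  have hz : z ≠ 0 := by
    intro h0
    rw [LinearIndependent.pair_iff] at hv
    exact hup.ne' (hv _ _ ((add_comm _ _).trans h0)).2
  have huz : S.redMetric q u z = 0 := by
    rw [redMetric_add_right, redMetric_smul_right, redMetric_smul_right]
    ring
  have h1 := key u z
  have h2 := key z u
  rw [S.redMetric_symm q z u, huz, mul_zero] at h2
  exact sub_eq_zero.1 ((mul_eq_zero.1 h2).resolve_right (S.redMetric_pos q hz).ne')

theorem closed_of_locallyHasConformalGeodesicExtension (hdim : Module.finrank ℝ EM ≤ 2)
    {W : Set M} (h : S.LocallyHasConformalGeodesicExtension W) : S.BetaClosedOn W := by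
  -- In dimension one there is no orthogonal direction, so `f` need not be a potential; closedness
  -- then comes from β = 0.
  rcases hdim.lt_or_eq with hlt | heq
  · exact closed_of_finrank_le_one (Nat.lt_succ_iff.1 hlt) W
  refine betaClosedOn_of_potential hdim fun p hp => ?_
  obtain ⟨U, hU, hpU, f, gbar, P, hf, hR, -, hD, hV, hP⟩ := h p hp
  exact ⟨f, U, hU.mem_nhds hpU, fun q hq => ⟨mdifferentiableAt_of_contMDiffOn hf hU hq,
    beta_eq_of_extension heq ⟨hU, hR, hD, hV⟩ hf hP hq⟩⟩

end ChaplyginSystem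

theorem mainTheorem9
    {EQ : Type*} [NormedAddCommGroup EQ] [NormedSpace ℝ EQ] [FiniteDimensional ℝ EQ]
    {Q : Type*} [TopologicalSpace Q] [T2Space Q] [SecondCountableTopology Q]
    [ChartedSpace EQ Q] [IsManifold 𝓘(ℝ, EQ) ∞ Q]
    {EG : Type*} [NormedAddCommGroup EG] [NormedSpace ℝ EG] [FiniteDimensional ℝ EG]
    {G : Type*} [TopologicalSpace G] [ChartedSpace EG G] [Group G] [LieGroup 𝓘(ℝ, EG) ∞ G]
    [MulAction G Q] [ContMDiffSMul 𝓘(ℝ, EG) 𝓘(ℝ, EQ) ∞ G Q] [ProperSMul G Q]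
    {EM : Type*} [NormedAddCommGroup EM] [NormedSpace ℝ EM] [FiniteDimensional ℝ EM]
    {M : Type*} [TopologicalSpace M] [T2Space M] [SecondCountableTopology M]
    [ChartedSpace EM M] [IsManifold 𝓘(ℝ, EM) ∞ M]
    (S : ChaplyginSystem EQ Q EG G EM M)
    (hdim : Module.finrank ℝ EM ≤ 2)
    (W : Set M) (hW : IsOpen W) :
    List.TFAE [
      S.BetaClosedOn W,
      S.LocallyPhiSimple W,
      S.BetaClosedOn W ∧ S.BetaXiOn W,
      S.BetaClosedOn W ∧ S.BetaGammaOn W ∧ S.ThetaZeroOn W,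
      S.LocallyHasConformalGeodesicExtension W,
      S.BetaClosedOn W ∧ S.BetaGammaOn W,
      S.LocallyHasInvariantVolume W,
      S.LocallyHasBasicInvariantVolume W] := by
  tfae_have 1 ↔ 2 := ⟨ChaplyginSystem.locallyPhiSimple_of_closed hdim hW,
    ChaplyginSystem.closed_of_locallyPhiSimple hdim⟩
  tfae_have 1 ↔ 3 := ⟨fun h => ⟨h, S.betaXiOn hdim W⟩, And.left⟩
  tfae_have 1 ↔ 4 := ⟨fun h => ⟨h, S.betaGammaOn hdim W, S.thetaZeroOn hdim W⟩, And.left⟩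
  tfae_have 1 ↔ 5 := ⟨ChaplyginSystem.locallyHasConformalGeodesicExtension_of_closed hdim hW,
    ChaplyginSystem.closed_of_locallyHasConformalGeodesicExtension hdim⟩
  tfae_have 1 ↔ 6 := ⟨fun h => ⟨h, S.betaGammaOn hdim W⟩, And.left⟩
  tfae_have 1 → 8 := ChaplyginSystem.locallyHasBasicInvariantVolume_of_closed hdim hW
  tfae_have 8 → 7 := fun h p hp =>
    let ⟨U, hU, hpU, hs, σ, hσ, _⟩ := h p hp
    ⟨U, hU, hpU, hs, σ, hσ⟩
  tfae_have 7 → 1 := ChaplyginSystem.closed_of_locallyHasInvariantVolume hdim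
  tfae_finish
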